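/- Throughout, $G=(V,E)$ is an $n$-vertex graph (finite, simple, undirected), and paths need not be simple. **Definitions.** A *decomposition* $(U,\Gamma)$ of $G$ consists of a set $U\subseteq V$ and a (possibly empty) collection $\Gamma=\{\gamma_1,\dots,\gamma_k\}$ of pairwise disjoint vertex sets, each given with a spanning tree $T(\gamma_j)$ of the induced graph $G[\gamma_j]$; $U$ may intersect $V(\Gamma)=\bigcup_j\gamma_j$. Let $\Delta(\Gamma)$ be the maximum degree of the trees $T(\gamma_j)$ ($0$ if $\Gamma=\emptyset$). A path *respects* $(U,\Gamma)$ if each of its segments without a $U$-vertex is contained in a single $\gamma_j$. For $F\subseteq V$, vertices $s,t$ are *$F$-connected* if $s,t\notin F$ and they are connected in $G-F$. A triplet $\langle s,t,F\rangle$ *respects* $(U,\Gamma)$ if $s,t$ are not $F$-connected or some $s$-$t$ path in $G-F$ respects $(U,\Gamma)$. It is *captured* by $(U,\Gamma)$ if $s,t$ are connected in $G[\gamma_j]-F$ for some $j$. For a set $\mathcal Q$ of triplets $\langle s,t,F\rangle$ with $|F|\le f$, $(U,\Gamma)$ is an *$f$-respecting-decomposition ($f$-RD) with respect to $\mathcal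 Q$* if every triplet in $\mathcal Q$ respects $(U,\Gamma)$. If $s\in\gamma_j$, let $U(s,F)$ be the set of all $u\in U\setminus F$ such that $u$ or a neighbour of $u$ in $G$ lies in the connected component of $s$ in $G[\gamma_j]-F$ (there is no such $u$ if $s\in F$); if $s\in U\setminus V(\Gamma)$, let $U(s,F)=\{s\}$; otherwise, let $U(s,F)=\emptyset$. **Theorem.** There are a deterministic algorithm $\mathsf{FTDecomp}$ and an absolute constant $C>0$ such that for every $n$-vertex graph $G$, every integer $f\ge 1$ and every decomposition $(U,\Gamma)$ of $G$, the algorithm, given $G$, $f$ and $(U,\Gamma)$ (with the trees $T(\gamma_j)$), computes in time polynomial in $n$ (on a random access machine with unit-cost addition and subtraction) a decomposition $(B,\Lambda)$ of $G$ with the following properties. 1. For every set $\mathcal Q$ of triplets (not known to the algorithm) with respect to which $(U,\Gamma)$ is an $f$-RD, there is a set $\mathcal Q'$ of triplets such that $(B,\Lambda)$ is an $f$-RD with respect to $\mathcal Q'$, and whenever $\langle s,t,F\rangle\in\mathcal Q$ is not captured by $(U,\Gamma)$, then $\langle a,b,F\rangle\in\mathcal Q'$ for every $\langle a,b\rangle\in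 U(s,F)\times U(t,F)$. 2. $|B|\le |U|/2$. 3. $\Delta(\Lambda)\le\Delta(\Gamma)+(C f\log n)^{12}$. -/

import Mathlib

namespace FTDecomp

/-! ## Decompositions of a graph -/

section Graph

variable {V : Type*}

/-- A decomposition `(U, Γ)` of `G`.  The collection `Γ = {γ_1, …, γ_k}` is given by the trees
`T(γ_j)`, which are pairwise vertex-disjoint subgraphs of `G`; the set `γ_j` is the vertex set
of `T(γ_j)`, so that `T(γ_j)` is a spanning tree of `G[γ_j]`. -/
structure Decomposition (G : SimpleGraph V) where
  U : Finset V
  k : ℕ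
  tree : Fin k → G.Subgraph
  isTree : ∀ j, (tree j).coe.IsTree
  disjoint : ∀ i j, i ≠ j → Disjoint (tree i).verts (tree j).verts

/-- `s` and `t` both lie in `S` and are connected in the induced graph `G[S]`. -/
def ConnectedIn (G : SimpleGraph V) (S : Set V) (s t : V) : Prop :=
  ∃ p : G.Walk s t, ∀ v ∈ p.support, v ∈ S

/-- `s` and `t` are `F`-connected: they avoid `F` and are connected in `G - F`. -/
def FConnected (G : SimpleGraph V) (F : Finset V) (s t : V) : Prop :=
  ConnectedIn G {v | v ∉ F} s t

namespace Decomposition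

variable {G : SimpleGraph V}

/-- The vertex set `γ_j`. -/
def part (D : Decomposition G) (j : Fin D.k) : Set V := (D.tree j).verts

/-- `Δ(Γ)`, the maximum degree of the trees `T(γ_j)`; it is `0` if `Γ` is empty. -/
noncomputable def maxDegree [Fintype V] (D : Decomposition G) : ℕ :=
  Finset.univ.sup fun j : Fin D.k => Finset.univ.sup fun v : V => ((D.tree j).neighborSet v).ncard

/-- A (not necessarily simple) path respects `(U, Γ)` if each of its segments that has no
`U`-vertex is contained in a single `γ_j`. -/
def PathRespects (D : Decomposition G) {s t : V} (p : G.Walk s t) : Prop :=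
  ∀ (x y : V) (q : G.Walk x y), q.IsSubwalk p → (∀ v ∈ q.support, v ∉ D.U) →
    ∃ j, ∀ v ∈ q.support, v ∈ D.part j

/-- The triplet `⟨s, t, F⟩` respects `(U, Γ)`. -/
def Respects (D : Decomposition G) (s t : V) (F : Finset V) : Prop :=
  FConnected G F s t → ∃ p : G.Walk s t, (∀ v ∈ p.support, v ∉ F) ∧ D.PathRespects p

/-- The triplet `⟨s, t, F⟩` is captured by `(U, Γ)`: `s` and `t` are connected in some
`G[γ_j] - F`. -/
def Captured (D : Decomposition G) (s t : V) (F : Finset V) : Prop :=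
  ∃ j, ConnectedIn G {v | v ∈ D.part j ∧ v ∉ F} s t

/-- `(U, Γ)` is an `f`-respecting-decomposition with respect to the set `Q` of triplets
`⟨s, t, F⟩` with `|F| ≤ f`. -/
def IsRD (D : Decomposition G) (f : ℕ) (Q : Set (V × V × Finset V)) : Prop :=
  ∀ s t F, (s, t, F) ∈ Q → F.card ≤ f ∧ D.Respects s t F

/-- The set `U(s, F)`.  If `s ∈ γ_j`, it consists of all `u ∈ U - F` such that `u` or a neighbour
of `u` is in the connected component of `s` in `G[γ_j] - F`.  If `s` is a `U`-vertex in none of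
the `γ_j`, it is `{s}`. -/
def near (D : Decomposition G) (s : V) (F : Finset V) : Set V :=
  {u | (∃ j, s ∈ D.part j ∧ u ∈ D.U ∧ u ∉ F ∧
          ∃ w, (w = u ∨ G.Adj u w) ∧ ConnectedIn G {v | v ∈ D.part j ∧ v ∉ F} s w) ∨
       (s ∈ D.U ∧ (∀ j, s ∉ D.part j) ∧ u = s)}

end Decomposition

end Graph

/-! ## Deterministic algorithms and their running time

Random access machines, written as structured programs.  The memory consists of registers
holding natural numbers and of arrays of natural numbers with two indices; a program names
finitely many registers and arrays.  The arithmetic operations are addition and truncated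
subtraction, so numbers have at most `O(t + b)` bits after `t` steps from an input of `b`-bit
numbers, and unit cost is polynomially equivalent to the cost on a Turing machine. -/

/-- A memory state: `reg x` is register `x`, and `arr a i j` is cell `(i, j)` of array `a`. -/
structure Store where
  reg : ℕ → ℕ
  arr : ℕ → ℕ → ℕ → ℕ

/-- Expressions. -/
inductive Expr where
  | const (c : ℕ)
  | reg (x : ℕ)
  | read (a : ℕ) (i j : Expr)
  | add (e₁ e₂ : Expr)
  | sub (e₁ e₂ : Expr)

/-- The value of an expression. -/
def Expr.eval (σ : Store) : Expr → ℕ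
  | const c => c
  | reg x => σ.reg x
  | read a i j => σ.arr a (i.eval σ) (j.eval σ)
  | add e₁ e₂ => e₁.eval σ + e₂.eval σ
  | sub e₁ e₂ => e₁.eval σ - e₂.eval σ

/-- The number of steps for the evaluation of an expression: one for each operation. -/
def Expr.cost : Expr → ℕ
  | const _ => 1
  | reg _ => 1
  | read _ i j => i.cost + j.cost + 1
  | add e₁ e₂ => e₁.cost + e₂.cost + 1
  | sub e₁ e₂ => e₁.cost + e₂.cost + 1

/-- Programs.  A test `e` succeeds if the value of `e` is not `0`. -/
inductive Program where
  | skip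
  | assign (x : ℕ) (e : Expr)
  | write (a : ℕ) (i j e : Expr)
  | seq (c₁ c₂ : Program)
  | branch (e : Expr) (c₁ c₂ : Program)
  | loop (e : Expr) (c : Program)

/-- The store after setting register `x` to `m`. -/
def Store.setReg (σ : Store) (x m : ℕ) : Store where
  reg := fun y => if y = x then m else σ.reg y
  arr := σ.arr

/-- The store after setting cell `(i, j)` of array `a` to `m`. -/
def Store.setArr (σ : Store) (a i j m : ℕ) : Store where
  reg := σ.reg
  arr := fun a' i' j' => if a' = a ∧ i' = i ∧ j' = j then m else σ.arr a' i' j'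

/-- `Runs c σ τ t`: started in `σ`, the program `c` halts in `τ` after exactly `t` steps. -/
inductive Runs : Program → Store → Store → ℕ → Prop where
  | skip (σ : Store) : Runs .skip σ σ 1
  | assign (σ : Store) (x : ℕ) (e : Expr) :
      Runs (.assign x e) σ (σ.setReg x (e.eval σ)) (e.cost + 1)
  | write (σ : Store) (a : ℕ) (i j e : Expr) :
      Runs (.write a i j e) σ (σ.setArr a (i.eval σ) (j.eval σ) (e.eval σ))
        (i.cost + j.cost + e.cost + 1)
  | seq {c₁ c₂ : Program} {σ τ ρ : Store} {t₁ t₂ : ℕ} :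
      Runs c₁ σ τ t₁ → Runs c₂ τ ρ t₂ → Runs (.seq c₁ c₂) σ ρ (t₁ + t₂ + 1)
  | branch_true {e : Expr} {c₁ c₂ : Program} {σ τ : Store} {t : ℕ} :
      e.eval σ ≠ 0 → Runs c₁ σ τ t → Runs (.branch e c₁ c₂) σ τ (e.cost + t + 1)
  | branch_false {e : Expr} {c₁ c₂ : Program} {σ τ : Store} {t : ℕ} :
      e.eval σ = 0 → Runs c₂ σ τ t → Runs (.branch e c₁ c₂) σ τ (e.cost + t + 1)
  | loop_true {e : Expr} {c : Program} {σ τ ρ : Store} {t₁ t₂ : ℕ} :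
      e.eval σ ≠ 0 → Runs c σ τ t₁ → Runs (.loop e c) τ ρ t₂ →
        Runs (.loop e c) σ ρ (e.cost + t₁ + t₂ + 1)
  | loop_false {e : Expr} {c : Program} {σ : Store} :
      e.eval σ = 0 → Runs (.loop e c) σ σ (e.cost + 1)

/-- Programs are deterministic: the final store and the number of steps are determined by the
program and the initial store. -/
theorem Runs.deterministic {c : Program} {σ τ τ' : Store} {t t' : ℕ}
    (h : Runs c σ τ t) (h' : Runs c σ τ' t') : τ = τ' ∧ t = t' := by
  induction h generalizing τ' t' with
  | skip => cases h'; exact ⟨rfl, rfl⟩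
  | assign => cases h'; exact ⟨rfl, rfl⟩
  | write => cases h'; exact ⟨rfl, rfl⟩
  | seq _ _ ih₁ ih₂ =>
    cases h' with
    | seq a b =>
      obtain ⟨rfl, rfl⟩ := ih₁ a
      obtain ⟨rfl, rfl⟩ := ih₂ b
      exact ⟨rfl, rfl⟩
  | branch_true he _ ih =>
    cases h' with
    | branch_true _ a => obtain ⟨rfl, rfl⟩ := ih a; exact ⟨rfl, rfl⟩
    | branch_false he' _ => exact absurd he' he
  | branch_false he _ ih =>
    cases h' with
    | branch_true he' _ => exact absurd he he'
    | branch_false _ a => obtain ⟨rfl, rfl⟩ := ih a; exact ⟨rfl, rfl⟩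
  | loop_true he _ _ ih₁ ih₂ =>
    cases h' with
    | loop_true _ a b =>
      obtain ⟨rfl, rfl⟩ := ih₁ a
      obtain ⟨rfl, rfl⟩ := ih₂ b
      exact ⟨rfl, rfl⟩
    | loop_false he' => exact absurd he' he
  | loop_false he =>
    cases h' with
    | loop_true he' _ _ => exact absurd he he'
    | loop_false _ => exact ⟨rfl, rfl⟩

/-! ## Input and output format -/

open Classical in
/-- The input `(f, G, U, Γ)` for a graph `G` on `{0, …, n - 1}`.  Registers `0`, `1`, `2` hold
`n`, `f` and `k = |Γ|`.  Array `0` is the adjacency matrix of `G`, row `0` of array `1` is the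
indicator of `U`, row `j` of array `2` is the indicator of `γ_j`, and array `3` is the adjacency
matrix of the union of the (vertex-disjoint) trees `T(γ_j)`.  All other cells are `0`. -/
noncomputable def inputStore {n : ℕ} (f : ℕ) (G : SimpleGraph (Fin n)) (D : Decomposition G) :
    Store where
  reg := fun x => if x = 0 then n else if x = 1 then f else if x = 2 then D.k else 0
  arr := fun a i j =>
    if (a = 0 ∧ ∃ u v : Fin n, (u : ℕ) = i ∧ (v : ℕ) = j ∧ G.Adj u v) ∨
       (a = 1 ∧ i = 0 ∧ ∃ v : Fin n, (v : ℕ) = j ∧ v ∈ D.U) ∨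
       (a = 2 ∧ ∃ (l : Fin D.k) (v : Fin n), (l : ℕ) = i ∧ (v : ℕ) = j ∧ v ∈ D.part l) ∨
       (a = 3 ∧ ∃ (l : Fin D.k) (u v : Fin n), (u : ℕ) = i ∧ (v : ℕ) = j ∧ (D.tree l).Adj u v)
    then 1 else 0

open Classical in
/-- The memory holds the decomposition `(U, Γ)` in register `2` and arrays `1`, `2`, `3`, in the
same format as in the input.  The other cells are arbitrary. -/
def Holds {n : ℕ} {G : SimpleGraph (Fin n)} (σ : Store) (D : Decomposition G) : Prop :=
  σ.reg 2 = D.k ∧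
  (∀ v : Fin n, σ.arr 1 0 v = if v ∈ D.U then 1 else 0) ∧
  (∀ (l : Fin D.k) (v : Fin n), σ.arr 2 l v = if v ∈ D.part l then 1 else 0) ∧
  (∀ u v : Fin n, σ.arr 3 u v = if ∃ l, (D.tree l).Adj u v then 1 else 0)

end FTDecomp

/-!
The new decomposition `(B, Λ)` is found without any use of the given collection `Γ`: all vertices of
`U(s, F)` lie in `U`, so it suffices that for all `a, b ∈ U` and all sets `F` of at most `f`
vertices, the triplet `⟨a, b, F⟩` respects `(B, Λ)`.

The algorithm keeps a set `X ⊇ U` of vertices such that the restriction to `G[X]` does not change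
the connectivity of vertices of `U` in `G - F`, for any `F` with `|F| ≤ f` (`Keeps`). Let `T` be a
forest in `G[X]`, and let `W` be the set of vertices of degree at least `l` in `T`. Local
search in the style of Fürer and Raghavachari yields a forest such that, for `O(log n)` consecutive
values of the level `l`, every edge of `G[X] - W` joins two vertices of the same component of the
subforest on the vertices of degree at most `l` (`LocalOpt`, `searchC_spec`). If `2|W| ≤ |U|` for
one of the levels, then `B = W` together with the components of this subforest is a solution, as
every segment of a path in `G[X]` that avoids `W` lies in a single component (`LocalOpt.sol`,
`respects_forestDecomposition`).

Otherwise, the sizes of the sets `W` decrease by at most a factor `2` from some level to the next,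
since `n < 2 ^ L` where `L + 1` is the number of levels. Removal of vertices of high degree from a
forest leaves many components (`card_reps_remove_high`), and by local optimality the same holds for
`G[X]` (`card_reps_le_of_localOpt`): there are more than `K|W| + |U|` components of `G[X] - W`,
where `K = (f log n) ^ O(1)`. Then one of them can be removed from `X`. To see this, consider the
`K` sets of numbers that have one of three given residues modulo a small number. For each `F` with
`|F| ≤ f` and any three vertices outside of `F` one of these sets contains the three vertices and is
disjoint from `F` (`exists_residueSet`), because there are many primes below a suitable bound and
each difference has few prime factors. For each set `S` of this family at most `|W|` components are
needed to connect the vertices of `W ∩ S` through components whose labels are in `S`, if one goes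
through the components in the order of their labels (`card_needed_le`). A component that contains no
vertex of `U` and is needed for none of the sets is redundant: any passage through it can be
replaced by a path that avoids `F` and uses only components with smaller labels (`conn_drop`). Hence
each round either succeeds or makes `X` smaller, so `N = n + 2` rounds suffice (`rounds_spec`).

The algorithm is written in a small language of array programs in which each loop runs over a range
of length `N`, so that running times are polynomial by construction. Its programs are
compiled to random access machines (`Cmd.comp_halts`), and their effect is analysed on the level of
the array language. Its arrays are used as follows.
* `0` to `3`: input and output in the given format.
* `4`, `5`, `6`: the set `U`, the set `X` and the forest `T`.
* `7`, `8`: the number `L` and `2 ^ L`; `9`: the table of remainders.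
* `10`, `11`, `12`: the argument and two results of transitive closures.
* `13` to `16`: the ends of the edges which an exchange adds and deletes.
* `18`, `19`: the labels of components and the flag for needed components.
* `20`, `21`, `22`: the recorded solution, that is, `B`, the vertices of the forest and the forest.
* `23`, `24`, `25`: the bound on residues, the first level and the number `3 * f * L + 1`.
* `27`, `28`: the representatives and the numbers of the components in the output.

Variable `9` is the current level relative to the first one, variable `10` is the component under
consideration, variables `11` to `14` give the residue set, and those from `20` on are bound in
terms or count repetitions.
-/

namespace FTDecomp

/-! ### A language of bounded array programs -/

/-- Contents of the arrays of a program. -/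
abbrev Mem := ℕ → ℕ → ℕ → ℕ

/-- Terms of the array language. `par x` reads one of four parameters, `sum k e` is the sum of
`e` over all values `< N` of the variable `k`, where `N` is parameter `3`. -/
inductive Tm where
  | lit (c : ℕ)
  | par (x : Fin 4)
  | var (k : ℕ)
  | get (a : ℕ) (i j : Tm)
  | add (e₁ e₂ : Tm)
  | sub (e₁ e₂ : Tm)
  | ite (c e₁ e₂ : Tm)
  | sum (k : ℕ) (e : Tm)

/-- The value of a term, for parameters `p`, variables `ρ` and arrays `m`. -/
def Tm.ev (p : Fin 4 → ℕ) (m : Mem) : Tm → (ℕ → ℕ) → ℕ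
  | lit c, _ => c
  | par x, _ => p x
  | var k, ρ => ρ k
  | get a i j, ρ => m a (i.ev p m ρ) (j.ev p m ρ)
  | add e₁ e₂, ρ => e₁.ev p m ρ + e₂.ev p m ρ
  | sub e₁ e₂, ρ => e₁.ev p m ρ - e₂.ev p m ρ
  | ite c e₁ e₂, ρ => if c.ev p m ρ ≠ 0 then e₁.ev p m ρ else e₂.ev p m ρ
  | sum k e, ρ => ∑ i ∈ Finset.range (p 3), e.ev p m (Function.update ρ k i)

/-- Commands of the array language. `fill a e` sets all cells `(i, j)` with `i, j < N` of the
array `a` simultaneously to the values of `e` at `i, j` (variables `0` and `1`), and `loop k c`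
runs `c` for all values `< N` of the variable `k`. -/
inductive Cmd where
  | fill (a : ℕ) (e : Tm)
  | seq (c₁ c₂ : Cmd)
  | cond (e : Tm) (c : Cmd)
  | loop (k : ℕ) (c : Cmd)

/-- The state after the rounds `0, …, N - 1` of a loop with body `g`. -/
def loopN {α : Type*} (g : ℕ → α → α) : ℕ → α → α
  | 0, s => s
  | N + 1, s => g N (loopN g N s)

/-- The arrays after a command. -/
def Cmd.exec (p : Fin 4 → ℕ) : Cmd → (ℕ → ℕ) → Mem → Mem
  | fill a e, ρ, m => fun a' i j =>
      if a' = a ∧ i < p 3 ∧ j < p 3 then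
        e.ev p m (Function.update (Function.update ρ 0 i) 1 j)
      else m a' i j
  | seq c₁ c₂, ρ, m => c₂.exec p ρ (c₁.exec p ρ m)
  | cond e c, ρ, m => if e.ev p m ρ ≠ 0 then c.exec p ρ m else m
  | loop k c, ρ, m => loopN (fun i m => c.exec p (Function.update ρ k i) m) (p 3) m

/-! ### Compilation to random access machines -/

/-- The register of variable `k`. -/
def vreg (k : ℕ) : ℕ := 4 + 2 * k

/-- The register at position `d` of the evaluation stack. -/
def sreg (d : ℕ) : ℕ := 5 + 2 * d

/-- The machine array of an array of the language. Machine array `4` is a buffer. -/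
def loc (a : ℕ) : ℕ := if a < 4 then a else a + 1

/-- `body` for all values `< N` of variable `k`, whose old value is kept at stack position `d`. -/
def forProg (k d : ℕ) (body : Program) : Program :=
  .seq (.assign (sreg d) (.reg (vreg k)))
    (.seq (.assign (vreg k) (.const 0))
      (.seq (.loop (.sub (.reg 3) (.reg (vreg k)))
          (.seq body (.assign (vreg k) (.add (.reg (vreg k)) (.const 1)))))
        (.assign (vreg k) (.reg (sreg d)))))

/-- The program that computes a term into stack position `d`. -/
def Tm.comp : Tm → ℕ → Program
  | lit c, d => .assign (sreg d) (.const c)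
  | par x, d => .assign (sreg d) (.reg x)
  | var k, d => .assign (sreg d) (.reg (vreg k))
  | get a i j, d => .seq (i.comp d) (.seq (j.comp (d + 1))
      (.assign (sreg d) (.read (loc a) (.reg (sreg d)) (.reg (sreg (d + 1))))))
  | add e₁ e₂, d => .seq (e₁.comp d) (.seq (e₂.comp (d + 1))
      (.assign (sreg d) (.add (.reg (sreg d)) (.reg (sreg (d + 1))))))
  | sub e₁ e₂, d => .seq (e₁.comp d) (.seq (e₂.comp (d + 1))
      (.assign (sreg d) (.sub (.reg (sreg d)) (.reg (sreg (d + 1))))))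
  | ite c e₁ e₂, d => .seq (c.comp d) (.branch (.reg (sreg d)) (e₁.comp d) (e₂.comp d))
  | sum k e, d => .seq (.assign (sreg d) (.const 0))
      (forProg k (d + 1) (.seq (e.comp (d + 2))
        (.assign (sreg d) (.add (.reg (sreg d)) (.reg (sreg (d + 2)))))))

/-- The program of a command, with the stack positions `≥ d` at its disposal. -/
def Cmd.comp : Cmd → ℕ → Program
  | fill a e, d => .seq
      (forProg 0 d (forProg 1 (d + 1) (.seq (e.comp (d + 2))
        (.write 4 (.reg (vreg 0)) (.reg (vreg 1)) (.reg (sreg (d + 2)))))))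
      (forProg 0 d (forProg 1 (d + 1)
        (.write (loc a) (.reg (vreg 0)) (.reg (vreg 1))
          (.read 4 (.reg (vreg 0)) (.reg (vreg 1))))))
  | seq c₁ c₂, d => .seq (c₁.comp d) (c₂.comp d)
  | cond e c, d => .seq (e.comp d) (.branch (.reg (sreg d)) (c.comp d) .skip)
  | loop k c, d => forProg k d (c.comp (d + 1))

open Polynomial in
/-- A bound on the time of `forProg`, for a bound `b` on the time of the body. -/
noncomputable def forCost (b : ℕ[X]) : ℕ[X] := X * (b + 20) + 20

open Polynomial in
/-- A bound on the time for a term, in terms of `N`. -/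
noncomputable def Tm.cost : Tm → ℕ[X]
  | lit _ => 2
  | par _ => 2
  | var _ => 2
  | get _ i j => i.cost + j.cost + 20
  | add e₁ e₂ => e₁.cost + e₂.cost + 20
  | sub e₁ e₂ => e₁.cost + e₂.cost + 20
  | ite c e₁ e₂ => c.cost + e₁.cost + e₂.cost + 20
  | sum _ e => forCost (e.cost + 20) + 20

open Polynomial in
/-- A bound on the time for a command, in terms of `N`. -/
noncomputable def Cmd.cost : Cmd → ℕ[X]
  | fill _ e => forCost (forCost (e.cost + 20)) + forCost (forCost 20) + 20
  | seq c₁ c₂ => c₁.cost + c₂.cost + 20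
  | cond e c => e.cost + c.cost + 20
  | loop _ c => forCost c.cost

/-- The program `c`, started in `σ`, halts within `b` steps in a store that satisfies `Q`. -/
def Halts (c : Program) (σ : Store) (b : ℕ) (Q : Store → Prop) : Prop :=
  ∃ τ t, Runs c σ τ t ∧ t ≤ b ∧ Q τ

theorem Halts.mono {c : Program} {σ : Store} {b b' : ℕ} {Q Q' : Store → Prop}
    (h : Halts c σ b Q) (hb : b ≤ b') (hQ : ∀ τ, Q τ → Q' τ) : Halts c σ b' Q' := by
  obtain ⟨τ, t, h, ht, hq⟩ := h
  exact ⟨τ, t, h, ht.trans hb, hQ τ hq⟩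

theorem Halts.seq {c₁ c₂ : Program} {σ : Store} {b₁ b₂ b : ℕ} {Q R : Store → Prop}
    (h : Halts c₁ σ b₁ Q) (h' : ∀ τ, Q τ → Halts c₂ τ b₂ R) (hb : b₁ + b₂ + 1 ≤ b) :
    Halts (.seq c₁ c₂) σ b R := by
  obtain ⟨τ, t, h, ht, hq⟩ := h
  obtain ⟨τ', t', h', ht', hq'⟩ := h' τ hq
  exact ⟨τ', _, .seq h h', by omega, hq'⟩

theorem Halts.assign {σ : Store} {x : ℕ} {e : Expr} {b : ℕ} {Q : Store → Prop}
    (h : Q (σ.setReg x (e.eval σ))) (hb : e.cost + 1 ≤ b) : Halts (.assign x e) σ b Q :=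
  ⟨_, _, .assign σ x e, hb, h⟩

theorem Halts.write {σ : Store} {a : ℕ} {i j e : Expr} {b : ℕ} {Q : Store → Prop}
    (h : Q (σ.setArr a (i.eval σ) (j.eval σ) (e.eval σ)))
    (hb : i.cost + j.cost + e.cost + 1 ≤ b) : Halts (.write a i j e) σ b Q :=
  ⟨_, _, .write σ a i j e, hb, h⟩

theorem Halts.branch {σ : Store} {e : Expr} {c₁ c₂ : Program} {b₁ b₂ b : ℕ} {Q : Store → Prop}
    (h₁ : e.eval σ ≠ 0 → Halts c₁ σ b₁ Q) (h₂ : e.eval σ = 0 → Halts c₂ σ b₂ Q)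
    (hb : e.cost + b₁ + b₂ + 1 ≤ b) : Halts (.branch e c₁ c₂) σ b Q := by
  by_cases he : e.eval σ = 0
  · obtain ⟨τ, t, h, ht, hq⟩ := h₂ he
    exact ⟨τ, _, .branch_false he h, by omega, hq⟩
  · obtain ⟨τ, t, h, ht, hq⟩ := h₁ he
    exact ⟨τ, _, .branch_true he h, by omega, hq⟩

/-- The rule for a loop with `N` rounds: the invariant `I i` holds before round `i`, and the test
fails after `N` rounds. -/
theorem Halts.loop {e : Expr} {c : Program} {b N : ℕ} (I : ℕ → Store → Prop)
    (hbody : ∀ i < N, ∀ σ, I i σ → e.eval σ ≠ 0 ∧ Halts c σ b (I (i + 1)))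
    (hend : ∀ σ, I N σ → e.eval σ = 0) (σ : Store) (h0 : I 0 σ) :
    Halts (.loop e c) σ (N * (b + e.cost + 1) + e.cost + 1) (I N) := by
  suffices h : ∀ r, ∀ i, i + r = N → ∀ σ, I i σ →
      Halts (.loop e c) σ (r * (b + e.cost + 1) + e.cost + 1) (I N) from
    h N 0 (by omega) σ h0
  intro r
  induction r with
  | zero =>
    intro i hi σ hσ
    obtain rfl : i = N := by omega
    exact ⟨σ, _, .loop_false (hend σ hσ), by omega, hσ⟩
  | succ r ih =>
    intro i hi σ hσ
    obtain ⟨he, τ, t, hr, ht, hτ⟩ := hbody i (by omega) σ hσ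
    obtain ⟨τ', t', hr', ht', hτ'⟩ := ih (i + 1) (by omega) τ hτ
    refine ⟨τ', _, .loop_true he hr hr', ?_, hτ'⟩
    rw [Nat.succ_mul]; omega

@[simp] theorem vreg_inj {k l : ℕ} : vreg k = vreg l ↔ k = l := by unfold vreg; omega
@[simp] theorem sreg_inj {k l : ℕ} : sreg k = sreg l ↔ k = l := by unfold sreg; omega
@[simp] theorem vreg_ne_sreg (k d : ℕ) : vreg k ≠ sreg d := by unfold vreg sreg; omega
@[simp] theorem sreg_ne_vreg (k d : ℕ) : sreg d ≠ vreg k := by unfold vreg sreg; omega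
@[simp] theorem fin_ne_vreg (x : Fin 4) (k : ℕ) : (x : ℕ) ≠ vreg k := by unfold vreg; omega
@[simp] theorem fin_ne_sreg (x : Fin 4) (k : ℕ) : (x : ℕ) ≠ sreg k := by unfold sreg; omega
@[simp] theorem loc_inj {a b : ℕ} : loc a = loc b ↔ a = b := by
  unfold loc; split_ifs <;> omega
@[simp] theorem loc_ne_four (a : ℕ) : loc a ≠ 4 := by unfold loc; split_ifs <;> omega
@[simp] theorem four_ne_loc (a : ℕ) : 4 ≠ loc a := by unfold loc; split_ifs <;> omega

/-- The store represents the parameters `p`, the variables `ρ` and the arrays `m`. -/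
structure Repr (p : Fin 4 → ℕ) (ρ : ℕ → ℕ) (m : Mem) (σ : Store) : Prop where
  par : ∀ x : Fin 4, σ.reg x = p x
  var : ∀ k, σ.reg (vreg k) = ρ k
  arr : ∀ a, σ.arr (loc a) = m a

theorem Repr.setReg_sreg {p ρ m σ} (h : Repr p ρ m σ) (d v : ℕ) :
    Repr p ρ m (σ.setReg (sreg d) v) :=
  ⟨fun x => by simp [Store.setReg, h.par], fun k => by simp [Store.setReg, h.var], h.arr⟩

theorem Repr.setReg_vreg {p ρ m σ} (h : Repr p ρ m σ) (k v : ℕ) :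
    Repr p (Function.update ρ k v) m (σ.setReg (vreg k) v) :=
  ⟨fun x => by simp [Store.setReg, h.par],
    fun k => by simp [Store.setReg, h.var, Function.update_apply], h.arr⟩

theorem Repr.setArr_buffer {p ρ m σ} (h : Repr p ρ m σ) (i j v : ℕ) :
    Repr p ρ m (σ.setArr 4 i j v) :=
  ⟨h.par, h.var, fun a => by funext i j; simp [Store.setArr, h.arr]⟩

/-- The stack below position `d` is the same in both stores. -/
def StackEq (d : ℕ) (σ τ : Store) : Prop := ∀ i < d, τ.reg (sreg i) = σ.reg (sreg i)

theorem StackEq.setReg_sreg {d σ τ} (h : StackEq d σ τ) {i : ℕ} (hi : d ≤ i) (v : ℕ) :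
    StackEq d σ (τ.setReg (sreg i) v) := fun j hj => by
  have : j ≠ i := by omega
  simp [Store.setReg, h j hj, this]

theorem StackEq.setReg_vreg {d σ τ} (h : StackEq d σ τ) (k : ℕ) (v : ℕ) :
    StackEq d σ (τ.setReg (vreg k) v) := fun j hj => by
  simp [Store.setReg, h j hj]

theorem StackEq.trans {d d' σ τ τ'} (h : StackEq d σ τ) (h' : StackEq d' τ τ') (hd : d ≤ d') :
    StackEq d σ τ' := fun i hi => (h' i (by omega)).trans (h i hi)

theorem StackEq.refl (d σ) : StackEq d σ σ := fun _ _ => rfl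

/-- The rule for counting loops. Before round `i` the store represents the arrays `M i` and
satisfies the invariant `J i`, which must not depend on the loop variable or on the stack position
where its old value is kept. -/
theorem forProg_halts {k d : ℕ} {body : Program} {b : Polynomial ℕ} {p ρ}
    (M : ℕ → Mem) (J : ℕ → Store → Prop)
    (hJv : ∀ i σ v, J i σ → J i (σ.setReg (vreg k) v))
    (hJs : ∀ i σ v, J i σ → J i (σ.setReg (sreg d) v))
    (hbody : ∀ i < p 3, ∀ σ, Repr p (Function.update ρ k i) (M i) σ → J i σ →
      Halts body σ (b.eval (p 3)) fun τ =>
        Repr p (Function.update ρ k i) (M (i + 1)) τ ∧ J (i + 1) τ ∧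
          τ.reg (sreg d) = σ.reg (sreg d))
    (σ : Store) (hσ : Repr p ρ (M 0) σ) (h0 : J 0 σ) :
    Halts (forProg k d body) σ ((forCost b).eval (p 3)) fun τ =>
      Repr p ρ (M (p 3)) τ ∧ J (p 3) τ := by
  refine Halts.seq (b₁ := 2) (b₂ := (p 3) * (b.eval (p 3) + 20) + 10)
    (Q := fun τ => Repr p ρ (M 0) τ ∧ J 0 τ ∧ τ.reg (sreg d) = ρ k) ?_ ?_ ?_
  · refine Halts.assign ⟨hσ.setReg_sreg _ _, hJs _ _ _ h0, ?_⟩ (by simp [Expr.cost])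
    simp [Store.setReg, Expr.eval, hσ.var]
  · rintro τ ⟨h1, h2, h4⟩
    refine Halts.seq (b₁ := 2) (b₂ := (p 3) * (b.eval (p 3) + 20) + 7)
      (Q := fun τ => Repr p (Function.update ρ k 0) (M 0) τ ∧ J 0 τ ∧
        τ.reg (sreg d) = ρ k) ?_ ?_ (by omega)
    · exact Halts.assign ⟨h1.setReg_vreg _ _, hJv _ _ _ h2, by simp [Store.setReg, h4]⟩
        (by simp [Expr.cost])
    · rintro τ ⟨h1, h2, h4⟩
      refine Halts.seq (b₁ := (p 3) * (b.eval (p 3) + 20) + 4) (b₂ := 2)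
        (Q := fun τ => Repr p (Function.update ρ k (p 3)) (M (p 3)) τ ∧ J (p 3) τ ∧
           τ.reg (sreg d) = ρ k) ?_ ?_ (by omega)
      · refine (Halts.loop (b := b.eval (p 3) + 8) (N := p 3)
          (I := fun i τ => Repr p (Function.update ρ k i) (M i) τ ∧ J i τ ∧
             τ.reg (sreg d) = ρ k) ?_ ?_ τ ⟨h1, h2, h4⟩).mono ?_ (fun _ h => h)
        · rintro i hi τ ⟨h1, h2, h4⟩
          refine ⟨?_, ?_⟩
          · have := h1.par 3
            have h' := h1.var k
            simp only [Function.update_self] at h'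
            simp only [Expr.eval, h']
            have : τ.reg 3 = p 3 := this
            omega
          · refine Halts.seq (b₁ := b.eval (p 3)) (b₂ := 4) (hbody i hi τ h1 h2) ?_ (by omega)
            rintro τ' ⟨g1, g2, g3⟩
            refine Halts.assign ⟨?_, hJv _ _ _ g2, ?_⟩ (by simp [Expr.cost])
            · have := g1.setReg_vreg k (i + 1)
              rw [Function.update_idem] at this
              have h' := g1.var k
              simp only [Function.update_self] at h'
              simpa [Expr.eval, h'] using this
            · simp [Store.setReg, g3, h4]
        · rintro τ ⟨h1, h2, h4⟩
          have h' := h1.var k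
          simp only [Function.update_self] at h'
          have : τ.reg 3 = p 3 := h1.par 3
          simp [Expr.eval, h', this]
        · simp only [Expr.cost]
          have : p 3 * (b.eval (p 3) + 8 + (1 + 1 + 1) + 1) ≤ p 3 * (b.eval (p 3) + 20) :=
            Nat.mul_le_mul_left _ (by omega)
          omega
      · rintro τ ⟨h1, h2, h4⟩
        refine Halts.assign ⟨?_, hJv _ _ _ h2⟩ (by simp [Expr.cost])
        have := h1.setReg_vreg k (ρ k)
        rw [Function.update_idem, Function.update_eq_self] at this
        simpa [Expr.eval, h4] using this
  · simp [forCost]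
    omega

/-- The program of a term computes its value in polynomial time. It changes neither the arrays nor
what the registers represent, nor the evaluation stack below position `d`. -/
theorem Tm.comp_halts {p : Fin 4 → ℕ} {m : Mem} (e : Tm) :
    ∀ (d : ℕ) (ρ : ℕ → ℕ) (σ : Store), Repr p ρ m σ →
    Halts (e.comp d) σ (e.cost.eval (p 3)) fun τ =>
      Repr p ρ m τ ∧ τ.arr = σ.arr ∧ τ.reg (sreg d) = e.ev p m ρ ∧ StackEq d σ τ := by
  have bin : ∀ (e₁ e₂ : Tm) (E : Expr) (v : ℕ) (d : ℕ) (ρ : ℕ → ℕ) (σ : Store),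
      (∀ (d : ℕ) (ρ : ℕ → ℕ) (σ : Store), Repr p ρ m σ →
        Halts (e₁.comp d) σ (e₁.cost.eval (p 3)) fun τ =>
          Repr p ρ m τ ∧ τ.arr = σ.arr ∧ τ.reg (sreg d) = e₁.ev p m ρ ∧ StackEq d σ τ) →
      (∀ (d : ℕ) (ρ : ℕ → ℕ) (σ : Store), Repr p ρ m σ →
        Halts (e₂.comp d) σ (e₂.cost.eval (p 3)) fun τ =>
          Repr p ρ m τ ∧ τ.arr = σ.arr ∧ τ.reg (sreg d) = e₂.ev p m ρ ∧ StackEq d σ τ) →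
      E.cost ≤ 10 → (∀ τ, Repr p ρ m τ → τ.reg (sreg d) = e₁.ev p m ρ →
        τ.reg (sreg (d + 1)) = e₂.ev p m ρ → E.eval τ = v) → Repr p ρ m σ →
      Halts (.seq (e₁.comp d) (.seq (e₂.comp (d + 1)) (.assign (sreg d) E))) σ
        (e₁.cost.eval (p 3) + e₂.cost.eval (p 3) + 20) fun τ =>
          Repr p ρ m τ ∧ τ.arr = σ.arr ∧ τ.reg (sreg d) = v ∧ StackEq d σ τ := by
    intro e₁ e₂ E v d ρ σ ih₁ ih₂ hE hv hσ
    refine Halts.seq (ih₁ d ρ σ hσ) (b₂ := e₂.cost.eval (p 3) + 15) ?_ (by omega)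
    rintro τ ⟨h1, h2, h3, h4⟩
    refine Halts.seq (ih₂ (d + 1) ρ τ h1) (b₂ := 12) ?_ (by omega)
    rintro τ' ⟨g1, g2, g3, g4⟩
    refine Halts.assign ⟨g1.setReg_sreg _ _, ?_, ?_, ?_⟩ (by omega)
    · simp [Store.setReg, g2, h2]
    · simp only [Store.setReg, if_true]
      exact hv τ' g1 ((g4 d (by omega)).trans h3) g3
    · exact (h4.trans g4 (by omega)).setReg_sreg le_rfl _
  induction e with
  | lit c =>
    intro d ρ σ hσ
    exact Halts.assign ⟨hσ.setReg_sreg _ _, rfl, by simp [Store.setReg, Expr.eval, ev],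
      (StackEq.refl d σ).setReg_sreg le_rfl _⟩ (by simp [Expr.cost, cost])
  | par x =>
    intro d ρ σ hσ
    exact Halts.assign ⟨hσ.setReg_sreg _ _, rfl, by simp [Store.setReg, Expr.eval, ev, hσ.par],
      (StackEq.refl d σ).setReg_sreg le_rfl _⟩ (by simp [Expr.cost, cost])
  | var k =>
    intro d ρ σ hσ
    exact Halts.assign ⟨hσ.setReg_sreg _ _, rfl, by simp [Store.setReg, Expr.eval, ev, hσ.var],
      (StackEq.refl d σ).setReg_sreg le_rfl _⟩ (by simp [Expr.cost, cost])
  | get a i j ih₁ ih₂ =>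
    intro d ρ σ hσ
    refine (bin i j _ _ d ρ σ ih₁ ih₂ ?_ ?_ hσ).mono (by simp [cost]) (fun _ h => h)
    · simp [Expr.cost]
    · intro τ h h1 h2
      simp [Expr.eval, ev, h1, h2, h.arr]
  | add e₁ e₂ ih₁ ih₂ =>
    intro d ρ σ hσ
    refine (bin e₁ e₂ _ _ d ρ σ ih₁ ih₂ ?_ ?_ hσ).mono (by simp [cost]) (fun _ h => h)
    · simp [Expr.cost]
    · intro τ h h1 h2
      simp [Expr.eval, ev, h1, h2]
  | sub e₁ e₂ ih₁ ih₂ =>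
    intro d ρ σ hσ
    refine (bin e₁ e₂ _ _ d ρ σ ih₁ ih₂ ?_ ?_ hσ).mono (by simp [cost]) (fun _ h => h)
    · simp [Expr.cost]
    · intro τ h h1 h2
      simp [Expr.eval, ev, h1, h2]
  | ite c e₁ e₂ ih ih₁ ih₂ =>
    intro d ρ σ hσ
    refine Halts.seq (ih d ρ σ hσ) (b₂ := e₁.cost.eval (p 3) + e₂.cost.eval (p 3) + 10) ?_
      (by simp [cost]; omega)
    rintro τ ⟨h1, h2, h3, h4⟩
    refine Halts.branch (b₁ := e₁.cost.eval (p 3)) (b₂ := e₂.cost.eval (p 3))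
      (fun h => ?_) (fun h => ?_) (by simp [Expr.cost]; omega)
    · refine (ih₁ d ρ τ h1).mono le_rfl ?_
      rintro τ' ⟨g1, g2, g3, g4⟩
      simp only [Expr.eval, h3] at h
      exact ⟨g1, g2.trans h2, by simp [ev, h, g3], h4.trans g4 le_rfl⟩
    · refine (ih₂ d ρ τ h1).mono le_rfl ?_
      rintro τ' ⟨g1, g2, g3, g4⟩
      simp only [Expr.eval, h3] at h
      exact ⟨g1, g2.trans h2, by simp [ev, h, g3], h4.trans g4 le_rfl⟩
  | sum k e ih =>
    intro d ρ σ hσ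
    refine Halts.seq (b₁ := 2) (b₂ := (forCost (e.cost + 20)).eval (p 3))
      (Q := fun τ => Repr p ρ m τ ∧ τ.arr = σ.arr ∧ τ.reg (sreg d) = 0 ∧ StackEq d σ τ) ?_ ?_
      (by simp [cost]; omega)
    · exact Halts.assign ⟨hσ.setReg_sreg _ _, rfl, by simp [Store.setReg, Expr.eval],
        (StackEq.refl d σ).setReg_sreg le_rfl _⟩ (by simp [Expr.cost])
    · rintro τ ⟨h1, h2, h3, h4⟩
      refine (forProg_halts (fun _ => m) (fun i τ => τ.arr = σ.arr ∧ StackEq d σ τ ∧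
        τ.reg (sreg d) = ∑ j ∈ Finset.range i, e.ev p m (Function.update ρ k j))
        ?_ ?_ ?_ τ h1 ⟨h2, h4, by simpa using h3⟩).mono le_rfl ?_
      · rintro i τ v ⟨g1, g2, g3⟩
        exact ⟨g1, g2.setReg_vreg _ _, by simp [Store.setReg, g3]⟩
      · rintro i τ v ⟨g1, g2, g3⟩
        exact ⟨g1, g2.setReg_sreg (by omega) _, by simp [Store.setReg, g3]⟩
      · rintro i hi τ h ⟨g1, g2, g3⟩
        refine Halts.seq (ih (d + 2) _ τ h) (b₂ := 10) ?_ (by simp)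
        rintro τ' ⟨f1, f2, f3, f4⟩
        refine Halts.assign ⟨f1.setReg_sreg _ _, ⟨f2.trans g1, ?_, ?_⟩, ?_⟩ (by simp [Expr.cost])
        · exact (g2.trans f4 (by omega)).setReg_sreg le_rfl _
        · simp [Store.setReg, Expr.eval, f3, f4 d (by omega), g3, Finset.sum_range_succ]
        · simp [Store.setReg, f4 (d + 1) (by omega)]
      · rintro τ' ⟨g1, ⟨g2, g3, g4⟩⟩
        exact ⟨g1, g2, g4, g3⟩

/-- The program of a command has the effect of the command, in polynomial time, and leaves the
evaluation stack below position `d` unchanged. -/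
theorem Cmd.comp_halts {p : Fin 4 → ℕ} (c : Cmd) :
    ∀ (d : ℕ) (ρ : ℕ → ℕ) (m : Mem) (σ : Store), Repr p ρ m σ →
    Halts (c.comp d) σ (c.cost.eval (p 3)) fun τ =>
      Repr p ρ (c.exec p ρ m) τ ∧ StackEq d σ τ := by
  induction c with
  | seq c₁ c₂ ih₁ ih₂ =>
    intro d ρ m σ hσ
    refine Halts.seq (ih₁ d ρ m σ hσ) (b₂ := c₂.cost.eval (p 3)) ?_ (by simp [cost])
    rintro τ ⟨h1, h2⟩
    refine (ih₂ d ρ _ τ h1).mono le_rfl ?_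
    rintro τ' ⟨g1, g2⟩
    exact ⟨g1, h2.trans g2 le_rfl⟩
  | cond e c ih =>
    intro d ρ m σ hσ
    refine Halts.seq (e.comp_halts d ρ σ hσ) (b₂ := c.cost.eval (p 3) + 10) ?_
      (by simp [cost]; omega)
    rintro τ ⟨h1, h2, h3, h4⟩
    refine Halts.branch (b₁ := c.cost.eval (p 3)) (b₂ := 1)
      (fun h => ?_) (fun h => ?_) (by simp [Expr.cost]; omega)
    · refine (ih d ρ m τ h1).mono le_rfl ?_
      rintro τ' ⟨g1, g2⟩
      simp only [Expr.eval, h3] at h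
      exact ⟨by simpa [exec, h] using g1, h4.trans g2 le_rfl⟩
    · simp only [Expr.eval, h3] at h
      exact ⟨τ, 1, .skip τ, le_rfl, by simpa [exec, h] using h1, h4⟩
  | loop k c ih =>
    intro d ρ m σ hσ
    refine (forProg_halts
      (fun i => loopN (fun i m => c.exec p (Function.update ρ k i) m) i m)
      (fun _ τ => StackEq d σ τ) ?_ ?_ ?_ σ hσ (StackEq.refl d σ)).mono le_rfl (fun _ h => h)
    · exact fun i τ v h => h.setReg_vreg _ _
    · exact fun i τ v h => h.setReg_sreg le_rfl _
    · intro i hi τ h1 h2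
      refine (ih (d + 1) _ _ τ h1).mono le_rfl ?_
      rintro τ' ⟨g1, g2⟩
      exact ⟨g1, h2.trans g2 (by omega), g2 d (by omega)⟩
  | fill a e =>
    intro d ρ m σ hσ
    refine Halts.seq (b₁ := (forCost (forCost (e.cost + 20))).eval (p 3))
      (b₂ := (forCost (forCost 20)).eval (p 3))
      (Q := fun τ => Repr p ρ m τ ∧ StackEq d σ τ ∧ ∀ i < p 3, ∀ j < p 3, τ.arr 4 i j =
        e.ev p m (Function.update (Function.update ρ 0 i) 1 j)) ?_ ?_ (by simp [cost])
    · -- The values are computed into the buffer.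
      refine (forProg_halts (fun _ => m) (fun i τ => StackEq d σ τ ∧ ∀ i' < i, ∀ j < p 3,
        τ.arr 4 i' j = e.ev p m (Function.update (Function.update ρ 0 i') 1 j))
        ?_ ?_ ?_ σ hσ ⟨StackEq.refl d σ, by simp⟩).mono le_rfl (fun _ h => h)
      · exact fun i τ v h => ⟨h.1.setReg_vreg _ _, h.2⟩
      · exact fun i τ v h => ⟨h.1.setReg_sreg le_rfl _, h.2⟩
      · rintro i hi τ h ⟨h1, h2⟩
        refine (forProg_halts (fun _ => m) (fun j τ' => (StackEq (d + 1) τ τ' ∧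
          ∀ i' < i, ∀ j < p 3,
            τ'.arr 4 i' j = e.ev p m (Function.update (Function.update ρ 0 i') 1 j)) ∧
          ∀ j' < j, τ'.arr 4 i j' = e.ev p m (Function.update (Function.update ρ 0 i) 1 j'))
          ?_ ?_ ?_ τ h ⟨⟨StackEq.refl _ τ, h2⟩, by simp⟩).mono le_rfl ?_
        · exact fun i τ v h => ⟨⟨h.1.1.setReg_vreg _ _, h.1.2⟩, h.2⟩
        · exact fun i τ v h => ⟨⟨h.1.1.setReg_sreg le_rfl _, h.1.2⟩, h.2⟩
        · rintro j hj τ' g ⟨⟨g1, g2⟩, g3⟩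
          refine Halts.seq (e.comp_halts (d + 2) _ τ' g) (b₂ := 10) ?_ (by simp)
          rintro τ'' ⟨f1, f2, f3, f4⟩
          have hv0 : τ''.reg (vreg 0) = i := by simpa using f1.var 0
          have hv1 : τ''.reg (vreg 1) = j := by simpa using f1.var 1
          refine Halts.write ?_ (by simp [Expr.cost])
          simp only [Expr.eval, hv0, hv1, f3]
          refine ⟨f1.setArr_buffer _ _ _, ⟨⟨?_, ?_⟩, ?_⟩, ?_⟩
          · intro l hl
            exact (f4 l (by omega)).trans (g1 l hl)
          · intro i' hi' j' hj'
            have : i' ≠ i := by omega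
            simp [Store.setArr, this, f2, g2 i' hi' j' hj']
          · intro j' hj'
            rcases Nat.lt_succ_iff_lt_or_eq.mp hj' with h | rfl
            · have : j' ≠ j := by omega
              simp [Store.setArr, this, f2, g3 j' h]
            · simp [Store.setArr]
          · exact f4 (d + 1) (by omega)
        · rintro τ' ⟨g1, ⟨g2, g3⟩, g4⟩
          refine ⟨g1, ⟨h1.trans g2 (by omega), ?_⟩, g2 d (by omega)⟩
          intro i' hi' j hj
          rcases Nat.lt_succ_iff_lt_or_eq.mp hi' with h | rfl
          · exact g3 i' h j hj
          · exact g4 j hj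
    · -- The buffer is copied.
      rintro σ' ⟨hσ', hst, hbuf⟩
      let v : ℕ → ℕ → ℕ := fun i j => e.ev p m (Function.update (Function.update ρ 0 i) 1 j)
      -- `M r` are the arrays after `r` rows, and `M' r c` those after `c` more cells of row `r`.
      let M : ℕ → Mem := fun r a' i j => if a' = a ∧ i < r ∧ j < p 3 then v i j else m a' i j
      let M' : ℕ → ℕ → Mem := fun r c a' i j =>
        if a' = a ∧ (i < r ∧ j < p 3 ∨ i = r ∧ j < c) then v i j else m a' i j
      have hM0 : M 0 = m := by funext a' i j; simp [M]
      have hM'0 : ∀ r, M' r 0 = M r := by intro r; funext a' i j; simp [M, M']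
      have hM' : ∀ r, M' r (p 3) = M (r + 1) := by
        intro r; funext a' i j; simp only [M, M']
        congr 1
        simp only [Nat.lt_succ_iff_lt_or_eq, eq_iff_iff]
        tauto
      refine (forProg_halts M (fun _ τ => StackEq d σ τ ∧ ∀ i < p 3, ∀ j < p 3, τ.arr 4 i j = v i j)
        ?_ ?_ ?_ σ' (hM0 ▸ hσ') ⟨hst, hbuf⟩).mono le_rfl (fun _ h => ⟨h.1, h.2.1⟩)
      · exact fun i τ v h => ⟨h.1.setReg_vreg _ _, h.2⟩
      · exact fun i τ v h => ⟨h.1.setReg_sreg le_rfl _, h.2⟩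
      · rintro i hi τ h ⟨h1, h2⟩
        refine (forProg_halts (M' i) (fun j τ' => StackEq (d + 1) τ τ' ∧
          ∀ i < p 3, ∀ j < p 3, τ'.arr 4 i j = v i j)
          ?_ ?_ ?_ τ (by rwa [hM'0]) ⟨StackEq.refl _ τ, h2⟩).mono le_rfl ?_
        · exact fun i τ v h => ⟨h.1.setReg_vreg _ _, h.2⟩
        · exact fun i τ v h => ⟨h.1.setReg_sreg le_rfl _, h.2⟩
        · rintro j hj τ' g ⟨g1, g2⟩
          have hv0 : τ'.reg (vreg 0) = i := by simpa using g.var 0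
          have hv1 : τ'.reg (vreg 1) = j := by simpa using g.var 1
          refine Halts.write ?_ (by simp [Expr.cost])
          simp only [Expr.eval, hv0, hv1, g2 i hi j hj]
          refine ⟨⟨g.par, g.var, ?_⟩, ⟨g1, ?_⟩, rfl⟩
          · intro a'
            funext i' j'
            simp only [Store.setArr, loc_inj, g.arr, M']
            have hlt : j' < j + 1 ↔ j' < j ∨ j' = j := Nat.lt_succ_iff_lt_or_eq
            by_cases ha : a' = a <;> by_cases hi' : i' = i <;> by_cases hj' : j' = j <;>
              simp [ha, hi', hj', -Order.lt_add_one_iff, hlt]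
          · intro i' hi' j' hj'
            simp [Store.setArr, g2 i' hi' j' hj']
        · rintro τ' ⟨g1, g2, g3⟩
          exact ⟨hM' i ▸ g1, ⟨h1.trans g2 (by omega), g3⟩, g2 d (by omega)⟩

/-! ### Connectivity, representatives and forests -/

section

/-- `x` and `y` are joined by a walk of `r`-steps. -/
abbrev Conn (r : ℕ → ℕ → Prop) : ℕ → ℕ → Prop := Relation.ReflTransGen r

/-- The restriction of the relation `r` to the vertices in `A`. -/
def Res (r : ℕ → ℕ → Prop) (A : ℕ → Prop) : ℕ → ℕ → Prop := fun a b => r a b ∧ A a ∧ A b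

/-- The relation `r` with the additional edge `xy`. -/
def addE (r : ℕ → ℕ → Prop) (x y : ℕ) : ℕ → ℕ → Prop :=
  fun a b => r a b ∨ (a = x ∧ b = y) ∨ (a = y ∧ b = x)

/-- The relation `r` without the edge `xy`. -/
def delE (r : ℕ → ℕ → Prop) (x y : ℕ) : ℕ → ℕ → Prop :=
  fun a b => r a b ∧ ¬(a = x ∧ b = y) ∧ ¬(a = y ∧ b = x)

/-- Symmetry of a relation. -/
def Symm (r : ℕ → ℕ → Prop) : Prop := ∀ a b, r a b → r b a

/-- A graph is acyclic if each of its edges is a bridge. -/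
def Acy (r : ℕ → ℕ → Prop) : Prop := ∀ u v, r u v → ¬Conn (delE r u v) u v

variable {r r' : ℕ → ℕ → Prop} {A : ℕ → Prop}

theorem Conn.mono (h : ∀ a b, r a b → r' a b) {x y : ℕ} (hc : Conn r x y) : Conn r' x y :=
  Relation.ReflTransGen.mono h x y hc

theorem Conn.symm (h : Symm r) {x y : ℕ} (hc : Conn r x y) : Conn r y x := by
  induction hc with
  | refl => exact .refl
  | tail _ h' ih => exact .head (h _ _ h') ih

theorem Symm.res (h : Symm r) : Symm (Res r A) := fun a b hab => ⟨h a b hab.1, hab.2.2, hab.2.1⟩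

theorem Symm.addE (h : Symm r) (x y : ℕ) : Symm (addE r x y) := by
  rintro a b (hab | ⟨rfl, rfl⟩ | ⟨rfl, rfl⟩)
  · exact Or.inl (h _ _ hab)
  · exact Or.inr (Or.inr ⟨rfl, rfl⟩)
  · exact Or.inr (Or.inl ⟨rfl, rfl⟩)

theorem Symm.delE (h : Symm r) (x y : ℕ) : Symm (delE r x y) :=
  fun a b hab => ⟨h a b hab.1, fun hh => hab.2.2 ⟨hh.2, hh.1⟩, fun hh => hab.2.1 ⟨hh.2, hh.1⟩⟩

theorem Conn.of_res_right {x y : ℕ} (h : Conn (Res r A) x y) (hx : A x) : A y := by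
  induction h with
  | refl => exact hx
  | tail _ h _ => exact h.2.2

/-- A walk that uses the additional edge `xy` can be shortened to one that uses it only once. -/
theorem Conn.of_addE {x y a b : ℕ} (h : Conn (addE r x y) a b) :
    Conn r a b ∨ (Conn r a x ∧ Conn r y b) ∨ (Conn r a y ∧ Conn r x b) := by
  induction h with
  | refl => exact Or.inl .refl
  | tail _ h ih =>
    rcases h with h | ⟨rfl, rfl⟩ | ⟨rfl, rfl⟩
    · rcases ih with ih | ⟨i, j⟩ | ⟨i, j⟩
      · exact Or.inl (ih.tail h)
      · exact Or.inr (Or.inl ⟨i, j.tail h⟩)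
      · exact Or.inr (Or.inr ⟨i, j.tail h⟩)
    · rcases ih with ih | ⟨i, j⟩ | ⟨i, j⟩
      · exact Or.inr (Or.inl ⟨ih, .refl⟩)
      · exact Or.inr (Or.inl ⟨i, .refl⟩)
      · exact Or.inl i
    · rcases ih with ih | ⟨i, j⟩ | ⟨i, j⟩
      · exact Or.inr (Or.inr ⟨ih, .refl⟩)
      · exact Or.inl i
      · exact Or.inr (Or.inr ⟨i, .refl⟩)

theorem delE_comm (x y : ℕ) : delE r x y = delE r y x := by
  funext a b; simp only [delE, eq_iff_iff]; tauto

theorem addE_delE (hr : Symm r) {x y : ℕ} (h : r x y) : addE (delE r x y) x y = r := by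
  funext a b
  simp only [addE, delE, eq_iff_iff]
  have := hr _ _ h
  constructor
  · rintro (⟨h, -⟩ | ⟨rfl, rfl⟩ | ⟨rfl, rfl⟩) <;> assumption
  · tauto

theorem Acy.irrefl (h : Acy r) (u : ℕ) : ¬r u u := fun hu => h u u hu .refl

theorem Acy.delE (h : Acy r) (x y : ℕ) : Acy (delE r x y) := fun u v huv hc =>
  h u v huv.1 (hc.mono fun _ _ hab => ⟨hab.1.1, hab.2⟩)

theorem Acy.addE (hs : Symm r) (h : Acy r) {x y : ℕ} (hxy : ¬Conn r x y) : Acy (addE r x y) := by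
  have hne : ¬(x = y) := fun e => hxy (e ▸ .refl)
  have new : ¬Conn (FTDecomp.delE (FTDecomp.addE r x y) x y) x y := fun hc => hxy <| hc.mono (by
    rintro a b ⟨hab | hab | hab, h1, h2⟩
    · exact hab
    · exact absurd hab h1
    · exact absurd hab h2)
  rintro u v (huv | ⟨rfl, rfl⟩ | ⟨rfl, rfl⟩) hc
  · -- A path that avoids `uv` either avoids `xy`, or with `uv` it joins `x` and `y` in `r`.
    by_cases hr : (u = x ∧ v = y) ∨ (u = y ∧ v = x)
    · rcases hr with ⟨rfl, rfl⟩ | ⟨rfl, rfl⟩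
      · exact hxy (.single huv)
      · exact hxy (.single (hs _ _ huv))
    · have hc' : Conn (FTDecomp.addE (FTDecomp.delE r u v) x y) u v := hc.mono (by
        rintro a b ⟨hab | hab, h1, h2⟩
        · exact Or.inl ⟨hab, h1, h2⟩
        · exact Or.inr hab)
      have hsub : ∀ a b, FTDecomp.delE r u v a b → r a b := fun a b hab => hab.1
      rcases hc'.of_addE with hc | ⟨i, j⟩ | ⟨i, j⟩
      · exact h u v huv hc
      · exact hxy (((i.mono hsub).symm hs).trans (.trans (.single huv) ((j.mono hsub).symm hs)))
      · exact hxy ((j.mono hsub).trans (.trans (.single (hs _ _ huv)) (i.mono hsub)))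
  · exact new hc
  · rw [delE_comm] at hc
    exact new (hc.symm ((hs.addE _ _).delE _ _))

open Classical in
/-- The set `A` contains one representative of each of its `r`-components: its least element. -/
noncomputable def reps (r : ℕ → ℕ → Prop) (A : Finset ℕ) : Finset ℕ :=
  A.filter fun c => ∀ y ∈ A, Conn r c y → c ≤ y

open Classical in
/-- Each element of `A` is connected to the representative of its component. -/
theorem exists_rep {A : Finset ℕ} {x : ℕ} (hx : x ∈ A) :
    ∃ c ∈ reps r A, Conn r x c := by
  have hne : (A.filter fun c => Conn r x c).Nonempty :=
    ⟨x, by simp [hx, Relation.ReflTransGen.refl]⟩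
  have hm := Finset.min'_mem _ hne
  rw [Finset.mem_filter] at hm
  refine ⟨_, Finset.mem_filter.mpr ⟨hm.1, fun y hy hc => ?_⟩, hm.2⟩
  exact Finset.min'_le _ _ (Finset.mem_filter.mpr ⟨hy, hm.2.trans hc⟩)

theorem rep_unique (hs : Symm r) {A : Finset ℕ} {c d : ℕ} (hc : c ∈ reps r A) (hd : d ∈ reps r A)
    (h : Conn r c d) : c = d := by
  classical
  simp only [reps, Finset.mem_filter] at hc hd
  exact le_antisymm (hc.2 d hd.1 h) (hd.2 c hc.1 (h.symm hs))

theorem reps_anti (h : ∀ a b, Conn r a b → Conn r' a b) (A : Finset ℕ) :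
    reps r' A ⊆ reps r A := by
  classical
  intro c hc
  simp only [reps, Finset.mem_filter] at hc ⊢
  exact ⟨hc.1, fun y hy hcy => hc.2 y hy (h _ _ hcy)⟩

/-- If two elements of `A` become connected, then some representative is lost. -/
theorem exists_lost_rep (hs : Symm r') (h : ∀ a b, Conn r a b → Conn r' a b) {A : Finset ℕ}
    {x y : ℕ} (hx : x ∈ A) (hy : y ∈ A) (hr : ¬Conn r x y) (hrs : Symm r) (hr' : Conn r' x y) :
    ∃ c ∈ reps r A, c ∉ reps r' A := by
  obtain ⟨c, hc, hxc⟩ := exists_rep (r := r) hx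
  obtain ⟨d, hd, hyd⟩ := exists_rep (r := r) hy
  by_cases h1 : c ∈ reps r' A
  · by_cases h2 : d ∈ reps r' A
    · have : c = d := rep_unique hs h1 h2
        (((h _ _ hxc).symm hs).trans (hr'.trans (h _ _ hyd)))
      subst this
      exact absurd (hxc.trans (hyd.symm hrs)) hr
    · exact ⟨d, hd, h2⟩
  · exact ⟨c, hc, h1⟩

/-- An edge between two components decreases the number of components. -/
theorem card_reps_addE_lt (hs : Symm r) {A : Finset ℕ} {x y : ℕ} (hx : x ∈ A) (hy : y ∈ A)
    (h : ¬Conn r x y) : (reps (addE r x y) A).card + 1 ≤ (reps r A).card := by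
  have hsub : ∀ a b, Conn r a b → Conn (addE r x y) a b := fun a b hab => hab.mono fun _ _ => Or.inl
  obtain ⟨c, hc, hc'⟩ := exists_lost_rep (hs.addE x y) hsub hx hy h hs
    (.single (Or.inr (Or.inl ⟨rfl, rfl⟩)))
  exact Finset.card_lt_card ⟨reps_anti hsub A, fun hh => hc' (hh hc)⟩

/-- An edge decreases the number of components by at most one. -/
theorem card_reps_le_addE (hs : Symm r) (A : Finset ℕ) (x y : ℕ) :
    (reps r A).card ≤ (reps (addE r x y) A).card + 1 := by
  classical
  have hsub : ∀ a b, Conn r a b → Conn (addE r x y) a b := fun a b hab => hab.mono fun _ _ => Or.inl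
  have key : (reps r A \ reps (addE r x y) A).card ≤ 1 := by
    rw [Finset.card_le_one]
    -- A lost representative `c` is in the component of `x` or `y`, and some smaller element is in
    -- the other one of these components.
    have lost : ∀ c ∈ reps r A \ reps (addE r x y) A, ∃ y' ∈ A, y' < c ∧
        ((Conn r c x ∧ Conn r y y') ∨ (Conn r c y ∧ Conn r x y')) := by
      intro c hc
      simp only [Finset.mem_sdiff, reps, Finset.mem_filter, not_and, not_forall] at hc
      obtain ⟨⟨hcA, hcr⟩, hc'⟩ := hc
      obtain ⟨y', hy', hcy, hlt⟩ := hc' hcA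
      refine ⟨y', hy', by omega, ?_⟩
      rcases hcy.of_addE with h | h | h
      · exact absurd (hcr y' hy' h) hlt
      · exact Or.inl h
      · exact Or.inr h
    have main : ∀ c ∈ reps r A \ reps (addE r x y) A, ∀ d ∈ reps r A \ reps (addE r x y) A,
        c < d → False := by
      intro c hc d hd hlt
      obtain ⟨c', hc', hcc, h1⟩ := lost c hc
      obtain ⟨d', hd', hdd, h2⟩ := lost d hd
      have hcr := (Finset.mem_sdiff.mp hc).1
      have hdr := (Finset.mem_sdiff.mp hd).1
      have hcd : ¬Conn r c d := fun h => hlt.ne (rep_unique hs hcr hdr h)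
      simp only [reps, Finset.mem_filter] at hcr hdr
      rcases h1 with ⟨h1, h1'⟩ | ⟨h1, h1'⟩ <;> rcases h2 with ⟨h2, h2'⟩ | ⟨h2, h2'⟩
      · exact hcd (h1.trans (h2.symm hs))
      · have := hdr.2 c' hc' (h2.trans h1'); omega
      · have := hdr.2 c' hc' (h2.trans h1'); omega
      · exact hcd (h1.trans (h2.symm hs))
    intro c hc d hd
    rcases lt_trichotomy c d with h | h | h
    · exact (main c hc d hd h).elim
    · exact h
    · exact (main d hd c hc h).elim
  have := Finset.card_sdiff_add_card (reps r A) (reps (addE r x y) A)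
  rw [Finset.union_eq_left.mpr (reps_anti hsub A)] at this
  omega

open Classical in
/-- The number of pairs `(a, b)` with `r a b` in a finite set. -/
noncomputable def pairs (r : ℕ → ℕ → Prop) (A : Finset ℕ) : ℕ :=
  ((A ×ˢ A).filter fun q => r q.1 q.2).card

theorem pairs_addE {A : Finset ℕ} {x y : ℕ} (hx : x ∈ A) (hy : y ∈ A) (hxy : x ≠ y)
    (h1 : ¬r x y) (h2 : ¬r y x) : pairs (addE r x y) A = pairs r A + 2 := by
  classical
  have : (A ×ˢ A).filter (fun q => addE r x y q.1 q.2) =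
      insert (x, y) (insert (y, x) ((A ×ˢ A).filter fun q => r q.1 q.2)) := by
    ext ⟨a, b⟩
    simp only [Finset.mem_filter, Finset.mem_product, Finset.mem_insert, Prod.mk.injEq]
    simp only [addE]
    constructor
    · tauto
    · rintro (⟨rfl, rfl⟩ | ⟨rfl, rfl⟩ | h) <;> tauto
  unfold pairs
  rw [this, Finset.card_insert_of_notMem, Finset.card_insert_of_notMem]
  · simp [h2]
  · simp [h1, hxy]

/-- In a graph on `A`, the number of components is at least the number of vertices minus the
number of edges, with equality for forests. -/
theorem card_reps_pairs (A : Finset ℕ) : ∀ (m : ℕ) (r : ℕ → ℕ → Prop), pairs r A = m → Symm r →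
    (∀ a, ¬r a a) → (∀ a b, r a b → a ∈ A) →
    2 * A.card ≤ pairs r A + 2 * (reps r A).card ∧
      (Acy r → pairs r A + 2 * (reps r A).card ≤ 2 * A.card) := by
  classical
  intro m
  induction m using Nat.strong_induction_on with
  | _ m ih =>
  intro r hm hs hi hA
  by_cases h : ∃ x y, r x y
  · obtain ⟨x, y, hxy⟩ := h
    have hx := hA x y hxy
    have hy := hA y x (hs _ _ hxy)
    have hne : x ≠ y := fun e => hi x (by rw [e] at hxy ⊢; exact hxy)
    have hp : pairs r A = pairs (delE r x y) A + 2 := by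
      conv_lhs => rw [← addE_delE hs hxy]
      exact pairs_addE hx hy hne (by simp [delE]) (by simp [delE])
    obtain ⟨i1, i2⟩ := ih (pairs (delE r x y) A) (by omega) (delE r x y) rfl (hs.delE x y)
      (fun a h => hi a h.1) (fun a b h => hA a b h.1)
    constructor
    · have := card_reps_le_addE (hs.delE x y) A x y
      rw [addE_delE hs hxy] at this
      omega
    · intro hacy
      have := card_reps_addE_lt (hs.delE x y) hx hy (hacy x y hxy)
      rw [addE_delE hs hxy] at this
      have := i2 (hacy.delE x y)
      omega
  · push Not at h
    have h1 : pairs r A = 0 := by simp [pairs, h]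
    have h2 : reps r A = A := by
      unfold reps
      rw [Finset.filter_true_of_mem]
      intro c _ y _ hcy
      induction hcy with
      | refl => exact le_rfl
      | tail _ h' _ => exact absurd h' (h _ _)
    rw [h1, h2]
    omega

/-! ### Exchange of forest edges -/

section Exchange

variable {T : ℕ → ℕ → Prop} {P : ℕ → Prop} {x y : ℕ}

/-- If the forest `T` joins `x` and `y`, but not inside `P`, then there is an edge `vz` on the
path with `z` in the component of `x` inside `P` and `v ∉ P`. -/
theorem exists_exit_edge (hx : P x) (hxy : ¬Conn (Res T P) x y) (hT : Symm T) (h : Conn T x y) :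
    ∃ v z, ¬P v ∧ T v z ∧ Conn (Res T P) x z ∧
      Conn (Res T fun u => ¬Conn (Res T P) x u) v y := by
  suffices hh : ∀ b, Conn T x b → Conn (Res T P) x b ∨ ∃ v z, ¬P v ∧ T v z ∧ Conn (Res T P) x z ∧
      Conn (Res T fun u => ¬Conn (Res T P) x u) v b by
    exact (hh y h).resolve_left hxy
  intro b hb
  induction hb with
  | refl => exact Or.inl .refl
  | @tail b c _ hbc ih =>
    by_cases hc : Conn (Res T P) x c
    · exact Or.inl hc
    · right
      by_cases hb : Conn (Res T P) x b
      · have hPc : ¬P c := fun hPc => hc (hb.tail ⟨hbc, hb.of_res_right hx, hPc⟩)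
        exact ⟨c, b, hPc, hT _ _ hbc, hb, .refl⟩
      · obtain ⟨v, z, h1, h2, h3, h4⟩ := ih.resolve_left hb
        exact ⟨v, z, h1, h2, h3, h4.tail ⟨hbc, hb, hc⟩⟩

variable {v z : ℕ}

theorem conn_delE_left (hT : Symm T) (hv : ¬P v) (hz : Conn (Res T P) x z) :
    Conn (delE T v z) z x :=
  (hz.symm hT.res).mono fun _ _ hab => ⟨hab.1, fun h => hv (h.1 ▸ hab.2.1),
    fun h => hv (h.2 ▸ hab.2.2)⟩

theorem conn_delE_right (hz : Conn (Res T P) x z)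
    (hvy : Conn (Res T fun u => ¬Conn (Res T P) x u) v y) : Conn (delE T v z) v y :=
  hvy.mono fun _ _ hab => ⟨hab.1, fun h => hab.2.2 (h.2 ▸ hz), fun h => hab.2.1 (h.1 ▸ hz)⟩

/-- Deletion of the exit edge `vz` separates `x` and `y`, as `x` stays connected to `z` and `y` to
`v`. Hence the edge `xy` can be added in exchange for `vz`. -/
theorem not_conn_delE (hT : Symm T) (hv : ¬P v) (hz : Conn (Res T P) x z)
    (hvy : Conn (Res T fun u => ¬Conn (Res T P) x u) v y) (hacy : Acy T) (hvz : T v z) :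
    ¬Conn (delE T v z) x y := fun h =>
  hacy v z hvz ((conn_delE_right hz hvy).trans
    ((h.symm (hT.delE _ _)).trans ((conn_delE_left hT hv hz).symm (hT.delE _ _))))

/-- The exchange of `vz` for `xy` preserves connectivity. -/
theorem conn_exchange (hT : Symm T) (hv : ¬P v) (hz : Conn (Res T P) x z)
    (hvy : Conn (Res T fun u => ¬Conn (Res T P) x u) v y) {a b : ℕ} (h : Conn T a b) :
    Conn (addE (delE T v z) x y) a b := by
  have hsub : ∀ a b, delE T v z a b → addE (delE T v z) x y a b := fun _ _ => Or.inl
  have key : Conn (addE (delE T v z) x y) v z :=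
    ((conn_delE_right hz hvy).mono hsub).trans (.trans (.single (Or.inr (Or.inr ⟨rfl, rfl⟩)))
      (((conn_delE_left hT hv hz).symm (hT.delE _ _)).mono hsub))
  induction h with
  | refl => exact .refl
  | @tail b c _ hbc ih =>
    refine ih.trans ?_
    by_cases h1 : b = v ∧ c = z
    · obtain ⟨rfl, rfl⟩ := h1; exact key
    · by_cases h2 : b = z ∧ c = v
      · obtain ⟨rfl, rfl⟩ := h2
        exact key.symm ((hT.delE _ _).addE _ _)
      · exact .single (Or.inl ⟨hbc, h1, h2⟩)

end Exchange

/-! ### The potential of the local search -/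

open Classical in
/-- The degree of `v` in a graph on the vertices `< n`. -/
noncomputable def deg (r : ℕ → ℕ → Prop) (n v : ℕ) : ℕ := ((Finset.range n).filter (r v)).card

theorem deg_mono (h : ∀ a b, r a b → r' a b) (n v : ℕ) : deg r n v ≤ deg r' n v := by
  classical
  exact Finset.card_le_card fun b hb => by
    simp only [Finset.mem_filter] at hb ⊢
    exact ⟨hb.1, h _ _ hb.2⟩

theorem deg_addE {n x y : ℕ} (hx : x < n) (hy : y < n) (hxy : x ≠ y) (h1 : ¬r x y) (h2 : ¬r y x)
    (v : ℕ) : deg (addE r x y) n v = deg r n v + if v = x ∨ v = y then 1 else 0 := by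
  classical
  unfold deg
  by_cases hvx : v = x
  · subst hvx
    have : (Finset.range n).filter (addE r v y v) = insert y ((Finset.range n).filter (r v)) := by
      ext b
      simp only [addE, Finset.mem_filter, Finset.mem_range, Finset.mem_insert]
      constructor
      · tauto
      · rintro (rfl | h) <;> tauto
    rw [this, Finset.card_insert_of_notMem (by simp [h1])]
    simp
  · by_cases hvy : v = y
    · subst hvy
      have : (Finset.range n).filter (addE r x v v) = insert x ((Finset.range n).filter (r v)) := by
        ext b
        simp only [addE, Finset.mem_filter, Finset.mem_range, Finset.mem_insert]
        constructor
        · tauto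
        · rintro (rfl | h) <;> tauto
      rw [this, Finset.card_insert_of_notMem (by simp [h2])]
      simp
    · have : addE r x y v = r v := by funext b; simp [addE, hvx, hvy]
      simp only [this, hvx, hvy, or_self, if_false, add_zero]

/-- The potential of a forest: vertices of degree above `d` count exponentially. -/
noncomputable def pot (d n : ℕ) (r : ℕ → ℕ → Prop) : ℕ := ∑ v ∈ Finset.range n, 3 ^ (deg r n v - d)

theorem pot_addE {d n x y : ℕ} (hx : x < n) (hy : y < n) (hxy : x ≠ y) (h1 : ¬r x y)
    (h2 : ¬r y x) :
    pot d n (addE r x y) + (3 ^ (deg r n x - d) + 3 ^ (deg r n y - d)) =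
      pot d n r + (3 ^ (deg r n x + 1 - d) + 3 ^ (deg r n y + 1 - d)) := by
  classical
  unfold pot
  have hx' : x ∈ Finset.range n := Finset.mem_range.mpr hx
  have hy' : y ∈ (Finset.range n).erase x :=
    Finset.mem_erase.mpr ⟨hxy.symm, Finset.mem_range.mpr hy⟩
  rw [← Finset.add_sum_erase _ _ hx', ← Finset.add_sum_erase _ _ hy',
    ← Finset.add_sum_erase (a := x) (Finset.range n) (fun v => 3 ^ (deg r n v - d)) hx',
    ← Finset.add_sum_erase (a := y) _ (fun v => 3 ^ (deg r n v - d)) hy']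
  have : ∑ v ∈ ((Finset.range n).erase x).erase y, 3 ^ (deg (addE r x y) n v - d) =
      ∑ v ∈ ((Finset.range n).erase x).erase y, 3 ^ (deg r n v - d) := by
    refine Finset.sum_congr rfl fun v hv => ?_
    simp only [Finset.mem_erase] at hv
    rw [deg_addE hx hy hxy h1 h2]
    simp [hv.1, hv.2.1]
  rw [this, deg_addE hx hy hxy h1 h2, deg_addE hx hy hxy h1 h2]
  simp
  ring

/-- The increase of the degree of a vertex of degree less than `l` costs at most two thirds of `3 ^
(l - d)`. -/
theorem three_pow_step_le {d l a : ℕ} (hd : d ≤ l) (ha : a < l) :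
    3 * 3 ^ (a + 1 - d) ≤ 3 * 3 ^ (a - d) + 2 * 3 ^ (l - d) := by
  by_cases h : a < d
  · have h1 : a + 1 - d = 0 := by omega
    have h2 : a - d = 0 := by omega
    rw [h1, h2]; omega
  · obtain ⟨s, rfl⟩ := Nat.exists_eq_add_of_le (not_lt.mp h)
    have h1 : d + s + 1 - d = s + 1 := by omega
    have h2 : d + s - d = s := by omega
    have h3 : 3 ^ (s + 1) ≤ 3 ^ (l - d) := Nat.pow_le_pow_right (by norm_num) (by omega)
    rw [h1, h2]
    rw [pow_succ] at h3 ⊢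
    omega

/-- The decrease of the degree of a vertex of degree more than `l` gains at least `2 * 3 ^ (l - d)`.
-/
theorem three_pow_step_ge {d l a : ℕ} (hd : d ≤ l) (ha : l ≤ a) :
    3 ^ (a - d) + 2 * 3 ^ (l - d) ≤ 3 ^ (a + 1 - d) := by
  have h1 : a + 1 - d = (a - d) + 1 := by omega
  have h3 : 3 ^ (l - d) ≤ 3 ^ (a - d) := Nat.pow_le_pow_right (by norm_num) (by omega)
  rw [h1, pow_succ]
  omega

/-- An exchange that lowers the degree of a vertex of degree `> l` and raises only degrees `< l`
makes the potential smaller. -/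
theorem pot_exchange_lt {T : ℕ → ℕ → Prop} {d n l x y v z : ℕ} (hs : Symm T) (hi : ∀ a, ¬T a a)
    (hn : ∀ a b, T a b → a < n) (hd : d ≤ l) (hxn : x < n) (hyn : y < n) (hxy : x ≠ y)
    (hT : ¬delE T v z x y) (hx : deg T n x < l) (hy : deg T n y < l) (hvz : T v z)
    (hv : l < deg T n v) :
    pot d n (addE (delE T v z) x y) < pot d n T := by
  have hne : v ≠ z := fun e => hi v (by rw [← e] at hvz; exact hvz)
  have e1 := pot_addE (r := delE T v z) (d := d) (hn v z hvz) (hn z v (hs _ _ hvz)) hne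
    (by simp [delE]) (by simp [delE])
  have e2 := pot_addE (r := delE T v z) (d := d) hxn hyn hxy hT
    (fun h => hT ((hs.delE _ _) _ _ h))
  rw [addE_delE hs hvz] at e1
  have dv : deg T n v = deg (delE T v z) n v + 1 := by
    conv_lhs => rw [← addE_delE hs hvz]
    rw [deg_addE (hn v z hvz) (hn z v (hs _ _ hvz)) hne (by simp [delE]) (by simp [delE])]
    simp
  have hsub : ∀ a b, delE T v z a b → T a b := fun _ _ h => h.1
  have s1 := three_pow_step_ge (a := deg (delE T v z) n v) hd (by omega)
  have s2 := three_pow_step_le hd ((deg_mono hsub n x).trans_lt hx)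
  have s3 := three_pow_step_le hd ((deg_mono hsub n y).trans_lt hy)
  have s4 : 3 ^ (deg (delE T v z) n z - d) ≤ 3 ^ (deg (delE T v z) n z + 1 - d) :=
    Nat.pow_le_pow_right (by norm_num) (by omega)
  have s5 : 0 < 3 ^ (l - d) := by positivity
  omega

end

/-! ### Counting components -/

theorem Acy.anti {r r' : ℕ → ℕ → Prop} (h : Acy r') (hr : ∀ a b, r a b → r' a b) : Acy r :=
  fun u v huv hc => h u v (hr _ _ huv) (hc.mono fun _ _ hab => ⟨hr _ _ hab.1, hab.2⟩)

open Classical in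
theorem pairs_eq_sum (r : ℕ → ℕ → Prop) (A : Finset ℕ) :
    pairs r A = ∑ a ∈ A, ∑ b ∈ A, if r a b then 1 else 0 := by
  rw [pairs, Finset.card_filter, Finset.sum_product]

/-- The restriction to a set that contains `A` does not change the edges inside `A`. -/
theorem pairs_res (r : ℕ → ℕ → Prop) (A : Finset ℕ) (P : ℕ → Prop) (h : ∀ a ∈ A, P a) :
    pairs (Res r P) A = pairs r A := by
  classical
  rw [pairs_eq_sum, pairs_eq_sum]
  refine Finset.sum_congr rfl fun a ha => Finset.sum_congr rfl fun b hb => ?_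
  simp [Res, h a ha, h b hb]

open Classical in
theorem deg_eq_sum {r : ℕ → ℕ → Prop} {X : Finset ℕ} {n : ℕ} (hX : X ⊆ Finset.range n)
    (hr : ∀ a b, r a b → b ∈ X) (v : ℕ) : deg r n v = ∑ b ∈ X, if r v b then 1 else 0 := by
  rw [deg, ← Finset.card_filter]
  congr 1
  ext b
  simp only [Finset.mem_filter]
  exact ⟨fun h => ⟨hr _ _ h.2, h.2⟩, fun h => ⟨hX h.1, h.2⟩⟩

open Classical in
/-- Removing the set `W` of vertices of degree `> l` from a forest leaves at least `(l - 1)|W|`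
components: at least `(l + 1)|W|` pairs of adjacent vertices start in `W`, and the forest has fewer
than `|W|` edges inside `W`. -/
theorem card_reps_remove_high {T : ℕ → ℕ → Prop} {X : Finset ℕ} {n l : ℕ}
    (hX : X ⊆ Finset.range n) (hs : Symm T) (hacy : Acy T) (hT : ∀ a b, T a b → a ∈ X) :
    (l + 1) * (X.filter fun v => l < deg T n v).card ≤
      (reps (Res T fun v => v ∈ X ∧ deg T n v ≤ l) (X.filter fun v => deg T n v ≤ l)).card +
        2 * (X.filter fun v => l < deg T n v).card := by
  set A := X.filter fun v => deg T n v ≤ l with hA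
  set W := X.filter fun v => l < deg T n v with hW
  have hW' : X.filter (fun v => ¬deg T n v ≤ l) = W := by simp [hW]
  let t : ℕ → ℕ → ℕ := fun a b => if T a b then 1 else 0
  have split : ∀ g : ℕ → ℕ, ∑ b ∈ X, g b = ∑ b ∈ A, g b + ∑ b ∈ W, g b := fun g => by
    rw [hA, ← hW', Finset.sum_filter_add_sum_filter_not]
  -- The edges of the forest and of its part on `W` are counted exactly, and there are at least as
  -- many components on `A` as vertices minus edges. The sums over `X` split into `A` and `W`.
  have h1 := (card_reps_pairs X _ T rfl hs hacy.irrefl hT).2 hacy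
  have h2 := (card_reps_pairs W _ (Res T (· ∈ W)) rfl hs.res
    (fun a h => hacy.irrefl a h.1) (fun a b h => h.2.1)).2 (hacy.anti fun a b h => h.1)
  have h3 := (card_reps_pairs A _ (Res T fun v => v ∈ X ∧ deg T n v ≤ l) rfl hs.res
    (fun a h => hacy.irrefl a h.1) (fun a b h => by simpa [hA] using h.2.1)).1
  rw [pairs_res _ _ _ (fun a ha => ha), pairs_eq_sum] at h2
  rw [pairs_res _ _ _ (fun a ha => by simpa [hA] using ha), pairs_eq_sum] at h3
  rw [pairs_eq_sum, split] at h1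
  simp_rw [split] at h1
  rw [Finset.sum_add_distrib, Finset.sum_add_distrib] at h1
  have hcomm : ∑ a ∈ A, ∑ b ∈ W, (if T a b then 1 else 0) =
      ∑ a ∈ W, ∑ b ∈ A, (if T a b then 1 else 0) := by
    rw [Finset.sum_comm]
    refine Finset.sum_congr rfl fun a _ => Finset.sum_congr rfl fun b _ => ?_
    simp only [show T b a ↔ T a b from ⟨hs _ _, hs _ _⟩]
  have hdeg : (l + 1) * W.card ≤ ∑ a ∈ W, ∑ b ∈ A, (if T a b then 1 else 0) +
      ∑ a ∈ W, ∑ b ∈ W, (if T a b then 1 else 0) := by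
    rw [← Finset.sum_add_distrib, mul_comm, ← smul_eq_mul, ← Finset.sum_const]
    refine Finset.sum_le_sum fun a ha => ?_
    rw [← split, ← deg_eq_sum hX (fun a b h => hT b a (hs _ _ h))]
    exact (Finset.mem_filter.mp ha).2
  have hcard : X.card = A.card + W.card := by
    simpa using split (fun _ => 1)
  omega

/-- The forest `T` admits no exchange at level `l` in the graph `G` on `X`. -/
def LocalOpt (G T : ℕ → ℕ → Prop) (X : Finset ℕ) (n l : ℕ) : Prop :=
  ∀ x y, G x y → x ∈ X → y ∈ X → deg T n x < l → deg T n y < l →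
    Conn (Res T fun v => v ∈ X ∧ deg T n v ≤ l) x y

open Classical in
/-- For a locally optimal forest, the graph has at least as many components after removal of the
vertices of degree `≥ l` as the forest has after removal of the vertices of degree `> l`, up to
the number of vertices of degree `l`. -/
theorem card_reps_le_of_localOpt {G T : ℕ → ℕ → Prop} {X : Finset ℕ} {n l : ℕ}
    (hs : Symm T) (hopt : LocalOpt G T X n l) :
    (reps (Res T fun v => v ∈ X ∧ deg T n v ≤ l) (X.filter fun v => deg T n v ≤ l)).card +
        (X.filter fun v => l < deg T n v).card ≤
      (reps (Res G fun v => v ∈ X ∧ deg T n v < l) (X.filter fun v => deg T n v < l)).card +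
        (X.filter fun v => l ≤ deg T n v).card := by
  set R := reps (Res T fun v => v ∈ X ∧ deg T n v ≤ l) (X.filter fun v => deg T n v ≤ l)
  set A := X.filter fun v => deg T n v < l
  -- The components of the forest that contain a vertex of degree `< l` lie in different components
  -- of the graph. The representatives of the others are vertices of degree exactly `l`.
  let P : ℕ → Prop := fun c => ∃ u ∈ A, Conn (Res T fun v => v ∈ X ∧ deg T n v ≤ l) c u
  have h1 : (R.filter P).card ≤
      (reps (Res G fun v => v ∈ X ∧ deg T n v < l) A).card := by
    have : ∀ c, ∃ d, P c → d ∈ reps (Res G fun v => v ∈ X ∧ deg T n v < l) A ∧ ∃ u,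
        Conn (Res T fun v => v ∈ X ∧ deg T n v ≤ l) c u ∧
        Conn (Res G fun v => v ∈ X ∧ deg T n v < l) u d := by
      intro c
      by_cases hc : P c
      · obtain ⟨u, hu, hcu⟩ := hc
        obtain ⟨d, hd, hud⟩ := exists_rep (r := Res G fun v => v ∈ X ∧ deg T n v < l) hu
        exact ⟨d, fun _ => ⟨hd, u, hcu, hud⟩⟩
      · exact ⟨0, fun h => absurd h hc⟩
    choose φ hφ using this
    refine Finset.card_le_card_of_injOn φ (fun c hc => (hφ c (Finset.mem_filter.mp hc).2).1) ?_
    intro c hc c' hc' heq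
    obtain ⟨hcR, hcP⟩ := Finset.mem_filter.mp hc
    obtain ⟨hcR', hcP'⟩ := Finset.mem_filter.mp hc'
    obtain ⟨-, u, hcu, hud⟩ := hφ c hcP
    obtain ⟨-, u', hcu', hud'⟩ := hφ c' hcP'
    rw [← heq] at hud'
    have tr : ∀ a b, Conn (Res G fun v => v ∈ X ∧ deg T n v < l) a b →
        Conn (Res T fun v => v ∈ X ∧ deg T n v ≤ l) a b := by
      intro a b hab
      induction hab with
      | refl => exact .refl
      | tail _ h ih => exact ih.trans (hopt _ _ h.1 h.2.1.1 h.2.2.1 h.2.1.2 h.2.2.2)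
    exact rep_unique hs.res hcR hcR' (hcu.trans ((tr _ _ hud).trans
      (((tr _ _ hud').symm hs.res).trans (hcu'.symm hs.res))))
  have h2 : (R.filter fun c => ¬P c).card + (X.filter fun v => l < deg T n v).card ≤
      (X.filter fun v => l ≤ deg T n v).card := by
    rw [← Finset.card_union_of_disjoint]
    · refine Finset.card_le_card fun c hc => ?_
      rcases Finset.mem_union.mp hc with hc | hc
      · obtain ⟨hcR, hcP⟩ := Finset.mem_filter.mp hc
        have hcX := (Finset.mem_filter.mp (Finset.mem_filter.mp hcR).1).1
        refine Finset.mem_filter.mpr ⟨hcX, not_lt.mp fun hlt => hcP ⟨c, ?_, .refl⟩⟩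
        exact Finset.mem_filter.mpr ⟨hcX, hlt⟩
      · exact Finset.mem_filter.mpr ⟨(Finset.mem_filter.mp hc).1, (Finset.mem_filter.mp hc).2.le⟩
    · rw [Finset.disjoint_left]
      intro c hc hc'
      have h1 := (Finset.mem_filter.mp (Finset.mem_filter.mp (Finset.mem_filter.mp hc).1).1).2
      have h2 := (Finset.mem_filter.mp hc').2
      omega
  have := Finset.card_filter_add_card_filter_not (s := R) P
  omega

/-! ### Redundant components -/

section Drop

variable {G : ℕ → ℕ → Prop} {X : Finset ℕ} {W S : ℕ → Prop} {lab : ℕ → ℕ} {c : ℕ}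

/-- The vertices of `W` in `S`, and of the components of `G[X] - W` with a label in `S` that is
smaller than `c`. -/
def Allowed (X : Finset ℕ) (W S : ℕ → Prop) (lab : ℕ → ℕ) (c : ℕ) : ℕ → Prop := fun u =>
  u ∈ X ∧ ((W u ∧ S u) ∨ (¬W u ∧ S (lab u) ∧ lab u < c))

/-- `w` is a vertex of `W` adjacent to the component of `c` in `G[X] - W`. -/
def Touches (G : ℕ → ℕ → Prop) (X : Finset ℕ) (W : ℕ → Prop) (c w : ℕ) : Prop :=
  w ∈ X ∧ W w ∧ ∃ u, Conn (Res G fun v => v ∈ X ∧ ¬W v) c u ∧ G w u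

/-- The component with label `c` is needed for the set `S`: it connects two vertices of `W ∩ S`
which are not connected by `W ∩ S` and the components in `S` with smaller labels. -/
def Needed (G : ℕ → ℕ → Prop) (X : Finset ℕ) (W S : ℕ → Prop) (lab : ℕ → ℕ) (c : ℕ) : Prop :=
  S c ∧ ∃ w w', S w ∧ S w' ∧ Touches G X W c w ∧ Touches G X W c w' ∧
    ¬Conn (Res G (Allowed X W S lab c)) w w'

open Classical in
/-- The function `lab` gives the label of the component of each vertex of `G[X] - W`. -/
def IsLabel (G : ℕ → ℕ → Prop) (X : Finset ℕ) (W : ℕ → Prop) (lab : ℕ → ℕ) : Prop :=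
  ∀ u ∈ X, ¬W u → lab u ∈ reps (Res G fun v => v ∈ X ∧ ¬W v) (X.filter fun v => ¬W v) ∧
    Conn (Res G fun v => v ∈ X ∧ ¬W v) u (lab u)

theorem Allowed.mono {d u : ℕ} (h : Allowed X W S lab c u) (hcd : c ≤ d) :
    Allowed X W S lab d u :=
  ⟨h.1, h.2.imp id fun h => ⟨h.1, h.2.1, h.2.2.trans_le hcd⟩⟩

open Classical in
/-- The label of a component is its representative. -/
theorem IsLabel.eq_of_conn (hG : Symm G) (hlab : IsLabel G X W lab)
    (hc : c ∈ reps (Res G fun v => v ∈ X ∧ ¬W v) (X.filter fun v => ¬W v)) {u : ℕ}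
    (h : Conn (Res G fun v => v ∈ X ∧ ¬W v) c u) : lab u = c := by
  have hcX : c ∈ X ∧ ¬W c := Finset.mem_filter.mp (Finset.mem_filter.mp hc).1
  have hu := h.of_res_right hcX
  obtain ⟨h1, h2⟩ := hlab u hu.1 hu.2
  exact (rep_unique hG.res hc h1 (h.trans h2)).symm

open Classical in
/-- For each set `S`, at most `|W|` components are needed: each of them decreases the number of
components of `W ∩ S`. -/
theorem card_needed_le (hG : Symm G) (hlab : IsLabel G X W lab) :
    ((reps (Res G fun v => v ∈ X ∧ ¬W v) (X.filter fun v => ¬W v)).filter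
      fun c => Needed G X W S lab c).card ≤ (X.filter W).card := by
  set B := X.filter fun w => W w ∧ S w
  let r : ℕ → ℕ → ℕ → Prop := fun c => Res G (Allowed X W S lab c)
  have hmono : ∀ c d, c ≤ d → ∀ a b, Conn (r c) a b → Conn (r d) a b := fun c d hcd a b h =>
    h.mono fun _ _ h => ⟨h.1, h.2.1.mono hcd, h.2.2.mono hcd⟩
  have lost : ∀ c, ∃ w, c ∈ reps (Res G fun v => v ∈ X ∧ ¬W v) (X.filter fun v => ¬W v) →
      Needed G X W S lab c → w ∈ reps (r c) B ∧ w ∉ reps (r (c + 1)) B := by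
    intro c
    by_cases h : c ∈ reps (Res G fun v => v ∈ X ∧ ¬W v) (X.filter fun v => ¬W v) ∧
        Needed G X W S lab c
    · obtain ⟨hc, hSc, w, w', hS, hS', ⟨hX, hW, u, hu, hwu⟩, ⟨hX', hW', u', hu', hwu'⟩, hn⟩ := h
      -- Allowing the component of `c` joins `w` and `w'`.
      have hall : ∀ v, Conn (Res G fun v => v ∈ X ∧ ¬W v) c v →
          Allowed X W S lab (c + 1) v := by
        intro v hv
        have hcX : c ∈ X ∧ ¬W c := Finset.mem_filter.mp (Finset.mem_filter.mp hc).1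
        have := hv.of_res_right hcX
        have hl := hlab.eq_of_conn hG hc hv
        exact ⟨this.1, Or.inr ⟨this.2, by rwa [hl], by omega⟩⟩
      have hconn : ∀ v, Conn (Res G fun v => v ∈ X ∧ ¬W v) c v → Conn (r (c + 1)) c v := by
        intro v hv
        induction hv with
        | refl => exact .refl
        | tail h h' ih => exact ih.tail ⟨h'.1, hall _ h, hall _ (h.tail h')⟩
      have e1 : Conn (r (c + 1)) c w := (hconn u hu).tail
        ⟨hG _ _ hwu, hall u hu, hX, Or.inl ⟨hW, hS⟩⟩
      have e2 : Conn (r (c + 1)) c w' := (hconn u' hu').tail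
        ⟨hG _ _ hwu', hall u' hu', hX', Or.inl ⟨hW', hS'⟩⟩
      obtain ⟨v, hv, hv'⟩ := exists_lost_rep (A := B) (r := r c) (r' := r (c + 1)) hG.res
        (hmono c (c + 1) (by omega)) (x := w) (y := w') (Finset.mem_filter.mpr ⟨hX, hW, hS⟩)
        (Finset.mem_filter.mpr ⟨hX', hW', hS'⟩) hn hG.res ((e1.symm hG.res).trans e2)
      exact ⟨v, fun _ _ => ⟨hv, hv'⟩⟩
    · exact ⟨0, fun h1 h2 => absurd ⟨h1, h2⟩ h⟩
  -- The vertex lost when `c` is allowed stays lost, so different components lose different ones.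
  choose φ hφ using lost
  refine (Finset.card_le_card_of_injOn φ (t := B) ?_ ?_).trans
    (Finset.card_le_card fun w hw => ?_)
  · intro c hc
    obtain ⟨h1, h2⟩ := Finset.mem_filter.mp hc
    exact (Finset.mem_filter.mp (hφ c h1 h2).1).1
  · have key : ∀ c ∈ (reps (Res G fun v => v ∈ X ∧ ¬W v) (X.filter fun v => ¬W v)).filter
        fun c => Needed G X W S lab c, ∀ d ∈ (reps (Res G fun v => v ∈ X ∧ ¬W v)
        (X.filter fun v => ¬W v)).filter fun c => Needed G X W S lab c,
        c < d → φ c ≠ φ d := by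
      intro c hc d hd hcd heq
      obtain ⟨h1, h2⟩ := Finset.mem_filter.mp hc
      obtain ⟨h1', h2'⟩ := Finset.mem_filter.mp hd
      apply (hφ c h1 h2).2
      rw [heq]
      exact reps_anti (hmono (c + 1) d hcd) B (hφ d h1' h2').1
    intro c hc d hd heq
    rcases lt_trichotomy c d with h | h | h
    · exact absurd heq (key c hc d hd h)
    · exact h
    · exact absurd heq.symm (key d hd c hc h)
  · obtain ⟨h1, h2, -⟩ := Finset.mem_filter.mp hw
    exact Finset.mem_filter.mpr ⟨h1, h2⟩

open Classical in
/-- If a component of `G[X] - W` is needed for no set of a family that separates the vertices from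
sets `F` of at most `f` vertices, then it can be removed without changing the connectivity in
`G[X] - F` of the remaining vertices. -/
theorem conn_drop {n f : ℕ} (hG : Symm G) (hX : X ⊆ Finset.range n) (hlab : IsLabel G X W lab)
    (hc : c ∈ reps (Res G fun v => v ∈ X ∧ ¬W v) (X.filter fun v => ¬W v))
    (family : Set (ℕ → Prop))
    (hfam : ∀ (F : Finset ℕ) (a b c : ℕ), F ⊆ Finset.range n → F.card ≤ f → a < n → b < n →
      c < n → a ∉ F → b ∉ F → c ∉ F → ∃ S ∈ family, S a ∧ S b ∧ S c ∧ ∀ e ∈ F, ¬S e)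
    (hneed : ∀ S ∈ family, ¬Needed G X W S lab c)
    (F : Finset ℕ) (hF : F.card ≤ f) {a b : ℕ}
    (ha : ¬Conn (Res G fun v => v ∈ X ∧ ¬W v) c a) (hb : ¬Conn (Res G fun v => v ∈ X ∧ ¬W v) c b)
    (hab : Conn (Res G fun v => v ∈ X ∧ v ∉ F) a b) :
    Conn (Res G fun v => (v ∈ X ∧ ¬Conn (Res G fun v => v ∈ X ∧ ¬W v) c v) ∧ v ∉ F) a b := by
  set C : ℕ → Prop := fun v => Conn (Res G fun v => v ∈ X ∧ ¬W v) c v with hC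
  have hcX : c ∈ X ∧ ¬W c := Finset.mem_filter.mp (Finset.mem_filter.mp hc).1
  have hstep : ∀ u v, C u → G u v → v ∈ X → ¬C v → W v := by
    intro u v hu huv hv hCv
    by_contra hW
    have := hu.of_res_right hcX
    exact hCv (hu.tail ⟨huv, this, hv, hW⟩)
  -- Two vertices outside of `F` that touch the component are connected without it.
  have bypass : ∀ w w', Touches G X W c w → Touches G X W c w' → w ∉ F → w' ∉ F →
      Conn (Res G fun v => (v ∈ X ∧ ¬C v) ∧ v ∉ F) w w' := by
    intro w w' hw hw' hwF hwF'
    -- The label of each component that meets `F`, other than `c`, has to be avoided too.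
    let F' : Finset ℕ := (((F.filter (· ∈ X)).image fun u => if W u then u else lab u)).erase c
    have hF'W : ∀ w ∈ X, W w → w ∉ F → w ∉ F' := by
      intro w hwX hwW hwF h
      obtain ⟨-, h⟩ := Finset.mem_erase.mp h
      obtain ⟨e, he, heq⟩ := Finset.mem_image.mp h
      obtain ⟨heF, heX⟩ := Finset.mem_filter.mp he
      by_cases hWe : W e
      · simp only [hWe, if_true] at heq
        exact hwF (heq ▸ heF)
      · simp only [hWe, if_false] at heq
        have := (hlab e heX hWe).1
        have := (Finset.mem_filter.mp (Finset.mem_filter.mp this).1).2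
        exact this (heq ▸ hwW)
    have hF'n : F' ⊆ Finset.range n := by
      intro w h
      obtain ⟨-, h⟩ := Finset.mem_erase.mp h
      obtain ⟨e, he, heq⟩ := Finset.mem_image.mp h
      obtain ⟨heF, heX⟩ := Finset.mem_filter.mp he
      by_cases hWe : W e
      · simp only [hWe, if_true] at heq
        exact heq ▸ hX heX
      · simp only [hWe, if_false] at heq
        have := (hlab e heX hWe).1
        exact hX (heq ▸ (Finset.mem_filter.mp (Finset.mem_filter.mp this).1).1)
    have hF'c : F'.card ≤ f := (Finset.card_erase_le.trans Finset.card_image_le).trans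
      ((Finset.card_filter_le _ _).trans hF)
    obtain ⟨S, hS, h1, h2, h3, h4⟩ := hfam F' w w' c hF'n hF'c (Finset.mem_range.mp (hX hw.1))
      (Finset.mem_range.mp (hX hw'.1)) (Finset.mem_range.mp (hX hcX.1))
      (hF'W w hw.1 hw.2.1 hwF) (hF'W w' hw'.1 hw'.2.1 hwF') (by simp [F'])
    have hconn : Conn (Res G (Allowed X W S lab c)) w w' := by
      by_contra hn
      exact hneed S hS ⟨h3, w, w', h1, h2, hw, hw', hn⟩
    have hall : ∀ u, Allowed X W S lab c u → (u ∈ X ∧ ¬C u) ∧ u ∉ F := by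
      rintro u ⟨huX, ⟨hWu, hSu⟩ | ⟨hWu, hSu, hlt⟩⟩
      · have hCu : ¬C u := fun h => (h.of_res_right hcX).2 hWu
        refine ⟨⟨huX, hCu⟩, fun huF => h4 u ?_ hSu⟩
        refine Finset.mem_erase.mpr ⟨fun e => hcX.2 (e ▸ hWu), Finset.mem_image.mpr ⟨u, ?_, ?_⟩⟩
        · exact Finset.mem_filter.mpr ⟨huF, huX⟩
        · simp [hWu]
      · refine ⟨⟨huX, fun h => ?_⟩, fun huF => h4 (lab u) ?_ hSu⟩
        · have := hlab.eq_of_conn hG hc h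
          omega
        · refine Finset.mem_erase.mpr ⟨hlt.ne, Finset.mem_image.mpr ⟨u, ?_, ?_⟩⟩
          · exact Finset.mem_filter.mpr ⟨huF, huX⟩
          · simp [hWu]
    exact hconn.mono fun u v h => ⟨h.1, hall u h.2.1, hall v h.2.2⟩
  -- A walk in `C` is represented by the vertex of `W` from which it has entered `C`.
  suffices h : (¬C b → Conn (Res G fun v => (v ∈ X ∧ ¬C v) ∧ v ∉ F) a b) ∧
      (C b → ∃ w, Touches G X W c w ∧ w ∉ F ∧
        Conn (Res G fun v => (v ∈ X ∧ ¬C v) ∧ v ∉ F) a w) from h.1 hb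
  clear hb
  induction hab with
  | refl => exact ⟨fun _ => .refl, fun h => absurd h ha⟩
  | @tail u v _ huv ih =>
    obtain ⟨huv, ⟨huX, huF⟩, ⟨hvX, hvF⟩⟩ := huv
    by_cases hu : C u
    · obtain ⟨w, hw, hwF, hconn⟩ := ih.2 hu
      refine ⟨fun hv => ?_, fun hv => ⟨w, hw, hwF, hconn⟩⟩
      exact hconn.trans (bypass w v hw ⟨hvX, hstep u v hu huv hvX hv, u, hu, hG _ _ huv⟩ hwF hvF)
    · refine ⟨fun hv => (ih.1 hu).tail ⟨huv, ⟨⟨huX, hu⟩, huF⟩, ⟨hvX, hv⟩, hvF⟩, fun hv => ?_⟩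
      exact ⟨u, ⟨huX, hstep v u hv (hG _ _ huv) huX hu, v, hv, huv⟩, huF, ih.1 hu⟩

end Drop

/-! ### Separating vertices by their residues -/

/-- There are at least `t` primes up to `2 * t ^ 2`. As in Chebyshev's bound, the central binomial
coefficient of `s = t ^ 2` is at least `4 ^ s / (2 * s)`, and it is a product of powers of primes up
to `2 * s`, each of which is at most `2 * s`. -/
theorem le_card_primes (t : ℕ) (ht : 1 ≤ t) :
    t ≤ ((Finset.range (2 * t ^ 2 + 1)).filter Nat.Prime).card := by
  by_contra! hlt
  set s := t ^ 2 with hs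
  have hs0 : 0 < s := by positivity
  have h1 : s.centralBinom ≤ (2 * s) ^ ((Finset.range (2 * s + 1)).filter Nat.Prime).card := by
    rw [← Nat.prod_pow_factorization_centralBinom s, ← Finset.prod_const]
    rw [← Finset.prod_filter_mul_prod_filter_not (Finset.range (2 * s + 1)) Nat.Prime]
    rw [Finset.prod_eq_one (s := (Finset.range (2 * s + 1)).filter fun p => ¬Nat.Prime p), mul_one]
    · exact Finset.prod_le_prod' fun p _ => Nat.pow_factorization_choose_le (by omega)
    · intro p hp
      rw [Nat.factorization_eq_zero_of_not_prime _ (Finset.mem_filter.mp hp).2, pow_zero]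
  have h2 := Nat.four_pow_le_two_mul_self_mul_centralBinom s hs0
  have h3 : (2 * s) ^ (((Finset.range (2 * s + 1)).filter Nat.Prime).card + 1) ≤ (2 * s) ^ t :=
    Nat.pow_le_pow_right (by omega) hlt
  have h4 : (4 ^ t) ^ t ≤ (2 * s) ^ t := by
    rw [← pow_mul, ← pow_two, ← hs]
    calc 4 ^ s ≤ 2 * s * s.centralBinom := h2
      _ ≤ 2 * s * (2 * s) ^ ((Finset.range (2 * s + 1)).filter Nat.Prime).card :=
          Nat.mul_le_mul_left _ h1
      _ ≤ (2 * s) ^ t := by rw [← pow_succ']; exact h3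
  have h5 : 4 ^ t ≤ 2 * s := (Nat.pow_le_pow_iff_left (by omega)).mp h4
  have h6 : ∀ t : ℕ, 1 ≤ t → 2 * t ^ 2 < 4 ^ t := by
    intro t ht
    induction t, ht using Nat.le_induction with
    | base => norm_num
    | succ t ht ih =>
      have h1 : (t + 1) ^ 2 ≤ 4 * t ^ 2 := by nlinarith
      have h2 : 4 ^ (t + 1) = 4 * 4 ^ t := by ring
      omega
  have := h6 t ht
  omega

theorem card_primeFactors_le {m L : ℕ} (hm : m ≠ 0) (h : m < 2 ^ L) : m.primeFactors.card ≤ L := by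
  have h1 : 2 ^ m.primeFactors.card ≤ ∏ p ∈ m.primeFactors, p :=
    Finset.pow_card_le_prod _ _ _ fun p hp => (Nat.prime_of_mem_primeFactors hp).two_le
  have h2 : ∏ p ∈ m.primeFactors, p ≤ m :=
    Nat.le_of_dvd (Nat.pos_of_ne_zero hm) (Nat.prod_primeFactors_dvd m)
  exact ((Nat.pow_lt_pow_iff_right (by omega)).mp ((h1.trans h2).trans_lt h)).le

/-- The sets of all numbers with one of three given residues modulo `p`, for small `p`. -/
def residueSets (N M : ℕ) : Set (ℕ → Prop) :=
  {S | ∃ p < N, ∃ y₁ < N, ∃ y₂ < N, ∃ y₃ < N, (p ≤ M ∧ y₁ ≤ M ∧ y₂ ≤ M ∧ y₃ ≤ M) ∧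
    S = fun e => e % p = y₁ ∨ e % p = y₂ ∨ e % p = y₃}

/-- Three vertices outside of a set `F` of at most `f` vertices can be separated from `F` by their
residues modulo some number `p ≤ M`. If `M` is large, then `p = n + 1` will do. Otherwise `p` is a
prime that divides none of the at most `3 * f` differences, each of which has at most `L` prime
factors. -/
theorem exists_residueSet {n f L M : ℕ} (hL : n < 2 ^ L)
    (hM : n + 1 ≤ M ∨ 2 * (3 * f * L + 1) ^ 2 ≤ M) (F : Finset ℕ) (a b c : ℕ)
    (hFn : F ⊆ Finset.range n) (hF : F.card ≤ f) (ha : a < n) (hb : b < n) (hc : c < n)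
    (haF : a ∉ F) (hbF : b ∉ F) (hcF : c ∉ F) :
    ∃ S ∈ residueSets (n + 2) M, S a ∧ S b ∧ S c ∧ ∀ e ∈ F, ¬S e := by
  suffices h : ∃ p, 0 < p ∧ p < n + 2 ∧ p ≤ M ∧ ∀ e ∈ F, ∀ x ∈ ({a, b, c} : Finset ℕ),
      e % p ≠ x % p by
    obtain ⟨p, hp, hpn, hpM, hsep⟩ := h
    have hlt : ∀ x, x % p < p := fun x => Nat.mod_lt x hp
    refine ⟨_, ⟨p, hpn, a % p, (hlt a).trans hpn, b % p, (hlt b).trans hpn, c % p,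
      (hlt c).trans hpn, ⟨hpM, (hlt a).le.trans hpM, (hlt b).le.trans hpM, (hlt c).le.trans hpM⟩,
      rfl⟩, Or.inl rfl, Or.inr (Or.inl rfl), Or.inr (Or.inr rfl), fun e he => ?_⟩
    have := hsep e he
    simp only [Finset.mem_insert, Finset.mem_singleton, forall_eq_or_imp, forall_eq] at this
    tauto
  have hxn : ∀ x ∈ ({a, b, c} : Finset ℕ), x < n ∧ x ∉ F := by
    simp only [Finset.mem_insert, Finset.mem_singleton, forall_eq_or_imp, forall_eq]
    tauto
  by_cases hMn : n + 1 ≤ M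
  · refine ⟨n + 1, by omega, by omega, hMn, fun e he x hx heq => ?_⟩
    have hen := Finset.mem_range.mp (hFn he)
    obtain ⟨h1, h2⟩ := hxn x hx
    rw [Nat.mod_eq_of_lt (by omega), Nat.mod_eq_of_lt (by omega)] at heq
    exact h2 (heq ▸ he)
  · have hM' := hM.resolve_left hMn
    set t := 3 * f * L + 1
    let bad : Finset ℕ := (F ×ˢ ({a, b, c} : Finset ℕ)).biUnion fun q =>
      (Nat.dist q.1 q.2).primeFactors
    have hpos : ∀ e ∈ F, ∀ x ∈ ({a, b, c} : Finset ℕ), Nat.dist e x ≠ 0 := by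
      intro e he x hx h0
      exact (hxn x hx).2 (Nat.eq_of_dist_eq_zero h0 ▸ he)
    have hbad : bad.card < t := by
      have h1 : bad.card ≤ (F ×ˢ ({a, b, c} : Finset ℕ)).card * L := by
        refine Finset.card_biUnion_le_card_mul _ _ _ fun q hq => ?_
        obtain ⟨hq1, hq2⟩ := Finset.mem_product.mp hq
        refine card_primeFactors_le (hpos _ hq1 _ hq2) (lt_of_lt_of_le ?_ hL.le)
        have h1 := Finset.mem_range.mp (hFn hq1)
        have h2 := (hxn _ hq2).1
        unfold Nat.dist
        omega
      have h2 : (F ×ˢ ({a, b, c} : Finset ℕ)).card ≤ 3 * f := by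
        rw [Finset.card_product, mul_comm]
        exact Nat.mul_le_mul Finset.card_le_three hF
      exact Nat.lt_succ_of_le (h1.trans (Nat.mul_le_mul_right _ h2))
    obtain ⟨p, hp, hpb⟩ := Finset.exists_mem_notMem_of_card_lt_card
      (hbad.trans_le (le_card_primes t (by omega)))
    obtain ⟨hp1, hp2⟩ := Finset.mem_filter.mp hp
    have := Finset.mem_range.mp hp1
    refine ⟨p, hp2.pos, by omega, by omega, fun e he x hx heq => hpb ?_⟩
    refine Finset.mem_biUnion.mpr ⟨(e, x), Finset.mem_product.mpr ⟨he, hx⟩, ?_⟩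
    refine Nat.mem_primeFactors.mpr ⟨hp2, ?_, hpos e he x hx⟩
    rcases le_total e x with h | h
    · rw [Nat.dist_eq_sub_of_le h]
      exact (Nat.modEq_iff_dvd' h).mp heq
    · rw [Nat.dist_comm, Nat.dist_eq_sub_of_le h]
      exact (Nat.modEq_iff_dvd' h).mp heq.symm

/-! ### Derived terms and commands -/

namespace Tm

/-- Negation. -/
def not (a : Tm) : Tm := .ite a (.lit 0) (.lit 1)
/-- Conjunction. -/
def and (a b : Tm) : Tm := .ite a b (.lit 0)
/-- Disjunction. -/
def or (a b : Tm) : Tm := .ite a (.lit 1) b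
/-- The test `a < b`. -/
def lt (a b : Tm) : Tm := .sub b a
/-- The test `a ≤ b`. -/
def le (a b : Tm) : Tm := not (.sub a b)
/-- The test `a = b`. -/
def eq (a b : Tm) : Tm := and (le a b) (le b a)
/-- The existential quantifier over the values `< N` of variable `k`. -/
def ex (k : ℕ) (a : Tm) : Tm := .sum k a
/-- The number of values `< N` of variable `k` that pass the test `a`. -/
def count (k : ℕ) (a : Tm) : Tm := .sum k (.ite a (.lit 1) (.lit 0))
/-- The least value of variable `k` that passes the test `a`, or `N`: this is the number of values
`l` of variable `k'` such that no value `≤ l` passes the test. -/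
def least (k k' : ℕ) (a : Tm) : Tm := count k' (not (ex k (and (le (.var k) (.var k')) a)))
/-- The scalar kept in array `a`. -/
def cell (a : ℕ) : Tm := .get a (.lit 0) (.lit 0)
/-- The entry `i` of the vector kept in the first column of array `a`. -/
def vec (a : ℕ) (i : Tm) : Tm := .get a i (.lit 0)

/-- The test `a` succeeds. -/
def tr (p : Fin 4 → ℕ) (m : Mem) (a : Tm) (ρ : ℕ → ℕ) : Prop := a.ev p m ρ ≠ 0

variable {p : Fin 4 → ℕ} {m : Mem} {ρ : ℕ → ℕ}

theorem tr_iff {a : Tm} : a.tr p m ρ ↔ a.ev p m ρ ≠ 0 := Iff.rfl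

@[simp] theorem tr_not {a : Tm} : (not a).tr p m ρ ↔ ¬a.tr p m ρ := by
  simp [tr, not, ev]
@[simp] theorem tr_and {a b : Tm} : (and a b).tr p m ρ ↔ a.tr p m ρ ∧ b.tr p m ρ := by
  simp [tr, and, ev]
@[simp] theorem tr_or {a b : Tm} : (or a b).tr p m ρ ↔ a.tr p m ρ ∨ b.tr p m ρ := by
  by_cases h : a.ev p m ρ = 0 <;> simp [tr, or, ev, h]
@[simp] theorem tr_lt {a b : Tm} : (lt a b).tr p m ρ ↔ a.ev p m ρ < b.ev p m ρ := by
  simp [tr, lt, ev, Nat.sub_eq_zero_iff_le]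
@[simp] theorem tr_le {a b : Tm} : (le a b).tr p m ρ ↔ a.ev p m ρ ≤ b.ev p m ρ := by
  simp [tr, le, not, ev, Nat.sub_eq_zero_iff_le]
@[simp] theorem tr_eq {a b : Tm} : (eq a b).tr p m ρ ↔ a.ev p m ρ = b.ev p m ρ := by
  simp [eq, le_antisymm_iff]
@[simp] theorem tr_ex {k : ℕ} {a : Tm} :
    (ex k a).tr p m ρ ↔ ∃ i < p 3, a.tr p m (Function.update ρ k i) := by
  simp [tr, ex, ev, Finset.sum_eq_zero_iff]
@[simp] theorem tr_get {a : ℕ} {i j : Tm} :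
    (get a i j).tr p m ρ ↔ m a (i.ev p m ρ) (j.ev p m ρ) ≠ 0 := Iff.rfl
@[simp] theorem tr_vec {a : ℕ} {i : Tm} : (vec a i).tr p m ρ ↔ m a (i.ev p m ρ) 0 ≠ 0 := Iff.rfl
@[simp] theorem tr_lit {c : ℕ} : (lit c).tr p m ρ ↔ c ≠ 0 := Iff.rfl
@[simp] theorem tr_cell {a : ℕ} : (cell a).tr p m ρ ↔ m a 0 0 ≠ 0 := Iff.rfl
@[simp] theorem ev_cell {a : ℕ} : (cell a).ev p m ρ = m a 0 0 := rfl
@[simp] theorem ev_vec {a : ℕ} {i : Tm} : (vec a i).ev p m ρ = m a (i.ev p m ρ) 0 := rfl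
@[simp] theorem ev_lit {c : ℕ} : (lit c).ev p m ρ = c := rfl
@[simp] theorem ev_par {x : Fin 4} : (par x).ev p m ρ = p x := rfl
@[simp] theorem ev_var {k : ℕ} : (var k).ev p m ρ = ρ k := rfl
@[simp] theorem ev_get {a : ℕ} {i j : Tm} :
    (get a i j).ev p m ρ = m a (i.ev p m ρ) (j.ev p m ρ) := rfl
@[simp] theorem ev_add {a b : Tm} : (add a b).ev p m ρ = a.ev p m ρ + b.ev p m ρ := rfl
@[simp] theorem ev_sub {a b : Tm} : (sub a b).ev p m ρ = a.ev p m ρ - b.ev p m ρ := rfl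
@[simp] theorem ev_sum {k : ℕ} {a : Tm} :
    (sum k a).ev p m ρ = ∑ i ∈ Finset.range (p 3), a.ev p m (Function.update ρ k i) := rfl

open Classical in
@[simp] theorem ev_ite {c a b : Tm} :
    (ite c a b).ev p m ρ = if c.tr p m ρ then a.ev p m ρ else b.ev p m ρ := by
  simp only [ev, tr]
  congr

open Classical in
@[simp] theorem ev_count {k : ℕ} {a : Tm} : (count k a).ev p m ρ =
    ((Finset.range (p 3)).filter fun i => a.tr p m (Function.update ρ k i)).card := by
  simp [count]

/-- `l` is the least number `< N` with the property `φ`, or at least `N` if there is none. -/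
structure IsLeast (N : ℕ) (φ : ℕ → Prop) (l : ℕ) : Prop where
  holds : l < N → φ l
  min : ∀ k < N, φ k → l ≤ k

/-- The value of `least k k' a` is the least number that passes the test, provided that the test
does not depend on the auxiliary variable `k'`. -/
theorem ev_least {k k' : ℕ} {a : Tm} (hk : k ≠ k') (φ : ℕ → Prop)
    (hφ : ∀ i l, i < p 3 → l < p 3 →
      (a.tr p m (Function.update (Function.update ρ k' l) k i) ↔ φ i)) :
    IsLeast (p 3) φ ((least k k' a).ev p m ρ) := by
  classical
  have hk' : ¬(k' = k) := fun h => hk h.symm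
  have h : (least k k' a).ev p m ρ =
      ((Finset.range (p 3)).filter fun l => ∀ i < p 3, i ≤ l → ¬φ i).card := by
    rw [least, ev_count]
    congr 1
    refine Finset.filter_congr fun l hl => ?_
    have hl := Finset.mem_range.mp hl
    simp only [tr_not, tr_ex, tr_and, tr_le, ev_var, Function.update_self,
      Function.update_of_ne hk', not_exists, not_and]
    exact ⟨fun h i hi hil hφi => h i hi hil ((hφ i l hi hl).mpr hφi),
      fun h i hi hil ha => h i hi hil ((hφ i l hi hl).mp ha)⟩
  rw [h]
  by_cases hex : ∃ i < p 3, φ i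
  · have hs := Nat.find_spec hex
    have hset : (Finset.range (p 3)).filter (fun l => ∀ i < p 3, i ≤ l → ¬φ i) =
        Finset.range (Nat.find hex) := by
      ext l
      simp only [Finset.mem_filter, Finset.mem_range]
      constructor
      · rintro ⟨h1, h2⟩
        by_contra hlt
        exact h2 _ hs.1 (not_lt.mp hlt) hs.2
      · intro hl
        exact ⟨hl.trans hs.1, fun i hi hil hφi =>
          Nat.find_min hex (hil.trans_lt hl) ⟨hi, hφi⟩⟩
    rw [hset, Finset.card_range]
    exact ⟨fun _ => hs.2, fun k hk hφk => Nat.find_min' hex ⟨hk, hφk⟩⟩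
  · push Not at hex
    rw [Finset.filter_true_of_mem (fun l _ i hi _ => hex i hi), Finset.card_range]
    exact ⟨fun h => absurd h (lt_irrefl _), fun k hk h => absurd h (hex k hk)⟩

end Tm

/-- The arrays that a command may write to. -/
def Cmd.writes : Cmd → List ℕ
  | fill a _ => [a]
  | seq c₁ c₂ => c₁.writes ++ c₂.writes
  | cond _ c => c.writes
  | loop _ c => c.writes

/-- The invariant rule for `loopN`. -/
theorem loopN_induct {α : Type*} {g : ℕ → α → α} {N : ℕ} (I : ℕ → α → Prop)
    (h : ∀ i < N, ∀ s, I i s → I (i + 1) (g i s)) {s : α} (h0 : I 0 s) : I N (loopN g N s) := by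
  induction N with
  | zero => exact h0
  | succ N ih => exact h N (by omega) _ (ih fun i hi => h i (by omega))

/-- A loop each round of which reaches a stable state or decreases the measure `μ` by `δ`. -/
theorem loopN_progress {α : Type*} {g : ℕ → α → α} {N δ : ℕ} (I Done : α → Prop) (μ : α → ℕ)
    (hI : ∀ i < N, ∀ s, I s → I (g i s))
    (hstay : ∀ i < N, ∀ s, I s → Done s → Done (g i s))
    (hprog : ∀ i < N, ∀ s, I s → Done (g i s) ∨ μ (g i s) + δ ≤ μ s) {s : α} (h0 : I s) :
    Done (loopN g N s) ∨ μ (loopN g N s) + N * δ ≤ μ s := by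
  suffices h : I (loopN g N s) ∧ (Done (loopN g N s) ∨ μ (loopN g N s) + N * δ ≤ μ s) from h.2
  induction N with
  | zero => exact ⟨h0, Or.inr (by simp [loopN])⟩
  | succ N ih =>
    obtain ⟨h1, h2⟩ := ih (fun i hi => hI i (by omega)) (fun i hi => hstay i (by omega))
      (fun i hi => hprog i (by omega))
    refine ⟨hI N (by omega) _ h1, ?_⟩
    rcases h2 with h2 | h2
    · exact Or.inl (hstay N (by omega) _ h1 h2)
    · refine (hprog N (by omega) _ h1).imp id fun h3 => ?_
      rw [Nat.succ_mul]
      simp only [loopN]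
      omega

/-- A command does not change the arrays to which it does not write. -/
theorem Cmd.exec_frame {p : Fin 4 → ℕ} (c : Cmd) {a : ℕ} (ha : a ∉ c.writes) :
    ∀ (ρ : ℕ → ℕ) (m : Mem), c.exec p ρ m a = m a := by
  induction c with
  | fill a' e =>
    intro ρ m
    have : a ≠ a' := by simpa [writes] using ha
    simp [exec, this]
  | seq c₁ c₂ ih₁ ih₂ =>
    intro ρ m
    simp only [writes, List.mem_append, not_or] at ha
    rw [exec, ih₂ ha.2, ih₁ ha.1]
  | cond e c ih =>
    intro ρ m
    rw [exec]
    split_ifs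
    · exact ih ha ρ m
    · rfl
  | loop k c ih =>
    intro ρ m
    exact loopN_induct (fun _ s => s a = m a) (fun i _ s h => (ih ha _ s).trans h) rfl

/-- The command `c`, repeated `N ^ k` times. -/
def Cmd.rep : ℕ → Cmd → Cmd
  | 0, c => c
  | k + 1, c => .loop (30 + k) (c.rep k)

theorem Cmd.rep_writes (k : ℕ) (c : Cmd) : (c.rep k).writes = c.writes := by
  induction k with
  | zero => rfl
  | succ k ih => exact ih

/-- If each run of `c` reaches a stable state or decreases `μ`, and `μ` is less than `N ^ k` at
first, then a stable state is reached by `N ^ k` runs. -/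
theorem Cmd.rep_spec {p : Fin 4 → ℕ} {c : Cmd} (I Done : Mem → Prop) (μ : Mem → ℕ)
    (hI : ∀ ρ s, I s → I (c.exec p ρ s)) (hstay : ∀ ρ s, I s → Done s → Done (c.exec p ρ s))
    (hprog : ∀ ρ s, I s → Done (c.exec p ρ s) ∨ μ (c.exec p ρ s) + 1 ≤ μ s) (k : ℕ) (ρ : ℕ → ℕ)
    (s : Mem) (hs : I s) (hμ : μ s < p 3 ^ k) :
    I ((c.rep k).exec p ρ s) ∧ Done ((c.rep k).exec p ρ s) := by
  suffices h : (∀ ρ s, I s → I ((c.rep k).exec p ρ s)) ∧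
      (∀ ρ s, I s → Done s → Done ((c.rep k).exec p ρ s)) ∧
      (∀ ρ s, I s → Done ((c.rep k).exec p ρ s) ∨ μ ((c.rep k).exec p ρ s) + p 3 ^ k ≤ μ s) from
    ⟨h.1 ρ s hs, (h.2.2 ρ s hs).resolve_right (by omega)⟩
  clear hμ
  induction k with
  | zero => exact ⟨hI, hstay, fun ρ s hs => by rw [pow_zero]; exact hprog ρ s hs⟩
  | succ k ih =>
    obtain ⟨h1, h2, h3⟩ := ih
    refine ⟨fun ρ s hs => ?_, fun ρ s hs hd => ?_, fun ρ s hs => ?_⟩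
    · exact loopN_induct (fun _ => I) (fun i _ s hs => h1 _ s hs) hs
    · exact (loopN_induct (fun _ s => I s ∧ Done s)
        (fun i _ s hs => ⟨h1 _ s hs.1, h2 _ s hs.1 hs.2⟩) ⟨hs, hd⟩).2
    · rw [pow_succ']
      exact loopN_progress I Done μ (fun i _ s hs => h1 _ s hs) (fun i _ s hs => h2 _ s hs)
        (fun i _ s hs => h3 _ s hs) hs

/-- The relation on the numbers `< N` held by array `a`. -/
def rel (m : Mem) (N a : ℕ) : ℕ → ℕ → Prop := fun i j => i < N ∧ j < N ∧ m a i j ≠ 0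

/-- The set of numbers `< N` held by the first column of array `a`. -/
def col (m : Mem) (N a : ℕ) : Finset ℕ := (Finset.range N).filter fun i => m a i 0 ≠ 0

theorem mem_col {m : Mem} {N a i : ℕ} : i ∈ col m N a ↔ i < N ∧ m a i 0 ≠ 0 := by
  simp [col]

section Fill

variable {p : Fin 4 → ℕ} {m : Mem} {ρ : ℕ → ℕ} {a : ℕ} {e : Tm}

theorem exec_fill {i j : ℕ} (hi : i < p 3) (hj : j < p 3) :
    (Cmd.fill a e).exec p ρ m a i j = e.ev p m (Function.update (Function.update ρ 0 i) 1 j) := by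
  simp [Cmd.exec, hi, hj]

theorem rel_fill (i j : ℕ) : rel ((Cmd.fill a e).exec p ρ m) (p 3) a i j ↔
    i < p 3 ∧ j < p 3 ∧ e.tr p m (Function.update (Function.update ρ 0 i) 1 j) := by
  unfold rel
  constructor
  · rintro ⟨h1, h2, h3⟩
    exact ⟨h1, h2, by rwa [exec_fill h1 h2] at h3⟩
  · rintro ⟨h1, h2, h3⟩
    exact ⟨h1, h2, by rwa [exec_fill h1 h2]⟩

theorem mem_col_fill (hN : 0 < p 3) (i : ℕ) : i ∈ col ((Cmd.fill a e).exec p ρ m) (p 3) a ↔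
    i < p 3 ∧ e.tr p m (Function.update (Function.update ρ 0 i) 1 0) := by
  rw [mem_col]
  constructor
  · rintro ⟨h1, h2⟩
    exact ⟨h1, by rwa [exec_fill h1 hN] at h2⟩
  · rintro ⟨h1, h2⟩
    exact ⟨h1, by rwa [exec_fill h1 hN]⟩

end Fill

/-- The array `a` becomes the reflexive transitive closure of the relation given by `e`. -/
def closure (a : ℕ) (e : Tm) : Cmd :=
  .seq (.fill 10 e) (.seq (.fill a (.eq (.var 0) (.var 1)))
    ((Cmd.fill a (.or (.get a (.var 0) (.var 1))
      (.ex 20 (.and (.get a (.var 0) (.var 20)) (.get 10 (.var 20) (.var 1)))))).rep 3))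

/-- The closure is reached, as each of the `N ^ 3` steps adds a pair or changes nothing. -/
theorem closure_spec {p : Fin 4 → ℕ} {ρ : ℕ → ℕ} {m : Mem} {a : ℕ} {e : Tm} (ha : a ≠ 10)
    (hN : 2 ≤ p 3) (r : ℕ → ℕ → Prop)
    (hr : ∀ i j, r i j ↔ i < p 3 ∧ j < p 3 ∧
      e.tr p m (Function.update (Function.update ρ 0 i) 1 j)) (x y : ℕ) :
    rel ((closure a e).exec p ρ m) (p 3) a x y ↔ x < p 3 ∧ y < p 3 ∧ Conn r x y := by
  classical
  set N := p 3 with hNdef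
  let I : Mem → Prop := fun s => (∀ i j, rel s N 10 i j ↔ r i j) ∧
    (∀ i < N, rel s N a i i) ∧ ∀ i j, rel s N a i j → Conn r i j
  let Done : Mem → Prop := fun s => ∀ i j k, rel s N a i j → r j k → rel s N a i k
  let μ : Mem → ℕ := fun s => (((Finset.range N) ×ˢ (Finset.range N)).filter fun q =>
    ¬rel s N a q.1 q.2).card
  let body : Cmd := .fill a (.or (.get a (.var 0) (.var 1))
      (.ex 20 (.and (.get a (.var 0) (.var 20)) (.get 10 (.var 20) (.var 1)))))
  have hbody : ∀ ρ s, I s → ∀ i j, rel (body.exec p ρ s) N a i j ↔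
      rel s N a i j ∨ ∃ k, rel s N a i k ∧ r k j := by
    intro ρ s hs i j
    rw [rel_fill]
    simp only [Tm.tr_or, Tm.tr_get, Tm.ev_var, Function.update_apply, Tm.tr_ex, Tm.tr_and, if_true,
      show ((0 : ℕ) = 1) = False by simp, show ((0 : ℕ) = 20) = False by simp,
      show ((1 : ℕ) = 20) = False by simp, if_false]
    constructor
    · rintro ⟨hi, hj, h | ⟨k, hk, h1, h2⟩⟩
      · exact Or.inl ⟨hi, hj, h⟩
      · exact Or.inr ⟨k, ⟨hi, hk, h1⟩, (hs.1 k j).mp ⟨hk, hj, h2⟩⟩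
    · rintro (⟨hi, hj, h⟩ | ⟨k, ⟨hi, hk, h1⟩, h2⟩)
      · exact ⟨hi, hj, Or.inl h⟩
      · obtain ⟨-, hj, h2⟩ := (hs.1 k j).mpr h2
        exact ⟨hi, hj, Or.inr ⟨k, hk, h1, h2⟩⟩
  have hI : ∀ ρ s, I s → I (body.exec p ρ s) := by
    intro ρ s hs
    refine ⟨fun i j => ?_, fun i hi => (hbody ρ s hs i i).mpr (Or.inl (hs.2.1 i hi)),
      fun i j hij => ?_⟩
    · rw [← hs.1 i j, rel, rel, Cmd.exec_frame _ (by simp [body, Cmd.writes, ha.symm])]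
    · rcases (hbody ρ s hs i j).mp hij with h | ⟨k, h, h'⟩
      · exact hs.2.2 i j h
      · exact (hs.2.2 i k h).tail h'
  have hstay : ∀ ρ s, I s → Done s → Done (body.exec p ρ s) := by
    intro ρ s hs hd i j k hij hjk
    refine (hbody ρ s hs i k).mpr (Or.inl ?_)
    rcases (hbody ρ s hs i j).mp hij with h | ⟨l, h, h'⟩
    · exact hd i j k h hjk
    · exact hd i j k (hd i l j h h') hjk
  have hprog : ∀ ρ s, I s → Done (body.exec p ρ s) ∨ μ (body.exec p ρ s) + 1 ≤ μ s := by
    intro ρ s hs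
    by_cases hd : Done s
    · exact Or.inl (hstay ρ s hs hd)
    · right
      simp only [Done, not_forall] at hd
      obtain ⟨i, j, k, hij, hjk, hik⟩ := hd
      refine Finset.card_lt_card ⟨fun q hq => ?_, fun hsub => ?_⟩
      · simp only [Finset.mem_filter] at hq ⊢
        exact ⟨hq.1, fun h => hq.2 ((hbody ρ s hs _ _).mpr (Or.inl h))⟩
      · have h1 : rel (body.exec p ρ s) N a i k := (hbody ρ s hs i k).mpr (Or.inr ⟨j, hij, hjk⟩)
        have h2 : (i, k) ∈ ((Finset.range N) ×ˢ (Finset.range N)).filter fun q =>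
            ¬rel s N a q.1 q.2 := Finset.mem_filter.mpr ⟨Finset.mem_product.mpr
          ⟨Finset.mem_range.mpr h1.1, Finset.mem_range.mpr h1.2.1⟩, hik⟩
        exact (Finset.mem_filter.mp (hsub h2)).2 h1
  set s₀ := (Cmd.fill a (.eq (.var 0) (.var 1))).exec p ρ ((Cmd.fill 10 e).exec p ρ m) with hs₀
  have hI₀ : I s₀ := by
    have h : ∀ i j, rel s₀ N a i j ↔ i < N ∧ j < N ∧ i = j := by
      intro i j
      rw [hs₀, rel_fill]
      simp [N]
    refine ⟨fun i j => ?_, fun i hi => (h i i).mpr ⟨hi, hi, rfl⟩, fun i j hij => ?_⟩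
    · rw [hr, ← rel_fill (a := 10), rel, rel, hs₀,
        Cmd.exec_frame _ (by simp [Cmd.writes, ha.symm])]
    · rw [((h i j).mp hij).2.2]
  obtain ⟨hI', hdone⟩ : I ((closure a e).exec p ρ m) ∧ Done ((closure a e).exec p ρ m) := by
    refine Cmd.rep_spec (c := body) I Done μ hI hstay hprog 3 ρ s₀ hI₀ ?_
    have h1 : μ s₀ ≤ N * N := by
      refine (Finset.card_filter_le _ _).trans ?_
      simp
    have h2 : N * N < N ^ 3 := by rw [pow_succ, pow_two]; nlinarith
    exact h1.trans_lt h2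
  constructor
  · exact fun h => ⟨h.1, h.2.1, hI'.2.2 x y h⟩
  · rintro ⟨hx, hy, h⟩
    clear hy
    induction h with
    | refl => exact hI'.2.1 x hx
    | tail _ h' ih => exact hdone _ _ _ ih h'

theorem closure_writes (a : ℕ) (e : Tm) : (closure a e).writes = [10, a, a] := rfl

/-! ### The local search -/

theorem update_zero_one (ρ : ℕ → ℕ) (i j : ℕ) :
    Function.update (Function.update ρ 0 i) 1 j 0 = i := by simp

/-- The degree of vertex `v` in the forest. -/
def degT (v : Tm) : Tm := .count 21 (.get 6 v (.var 21))

/-- The current level. -/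
def lvl : Tm := .add (.cell 24) (.var 9)

/-- `v` is a vertex of degree at most the level. -/
def lowT (v : Tm) : Tm := .and (.vec 5 v) (.le (degT v) lvl)

/-- `v` is a vertex of degree less than the level. -/
def outT (v : Tm) : Tm := .and (.vec 5 v) (.lt (degT v) lvl)

section

variable {p : Fin 4 → ℕ} {m : Mem} {ρ : ℕ → ℕ} {v : Tm}

theorem ev_degT (hv : ∀ i, v.ev p m (Function.update ρ 21 i) = v.ev p m ρ)
    (h : v.ev p m ρ < p 3) :
    (degT v).ev p m ρ = deg (rel m (p 3) 6) (p 3) (v.ev p m ρ) := by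
  classical
  rw [degT, Tm.ev_count, deg]
  congr 1
  refine Finset.filter_congr fun i hi => ?_
  simp only [Tm.tr_get, hv, Tm.ev_var, Function.update_self, rel, h, Finset.mem_range.mp hi,
    true_and]

theorem tr_lowT (hv : ∀ i, v.ev p m (Function.update ρ 21 i) = v.ev p m ρ)
    (h : v.ev p m ρ < p 3) : (lowT v).tr p m ρ ↔
      v.ev p m ρ ∈ col m (p 3) 5 ∧
        deg (rel m (p 3) 6) (p 3) (v.ev p m ρ) ≤ m 24 0 0 + ρ 9 := by
  simp [lowT, ev_degT hv h, lvl, mem_col, h]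

theorem tr_outT (hv : ∀ i, v.ev p m (Function.update ρ 21 i) = v.ev p m ρ)
    (h : v.ev p m ρ < p 3) : (outT v).tr p m ρ ↔
      v.ev p m ρ ∈ col m (p 3) 5 ∧
        deg (rel m (p 3) 6) (p 3) (v.ev p m ρ) < m 24 0 0 + ρ 9 := by
  simp [outT, ev_degT hv h, lvl, mem_col, h]

end

/-- The edge `xy` of the graph leads to a low vertex in another component of the forest without
its high vertices. -/
def candT (x y : Tm) : Tm := .and (.get 0 x y) (.and (outT y) (.not (.get 11 x y)))

/-- The edge `vz` of the forest may be exchanged for the edge found before. -/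
def exitT (v z : Tm) : Tm :=
  .and (.get 6 v z) (.and (.not (lowT v)) (.and (.get 11 (.cell 13) z) (.get 12 v (.cell 14))))

/-- The addition of the edge found, after deletion of an edge of the cycle, if there is one. -/
def exchangeC : Cmd :=
  .seq (closure 12 (.and (.get 6 (.var 0) (.var 1))
    (.and (.not (.get 11 (.cell 13) (.var 0))) (.not (.get 11 (.cell 13) (.var 1))))))
  (.seq (.fill 15 (.least 20 22 (.ex 23 (exitT (.var 20) (.var 23)))))
  (.seq (.fill 16 (.least 20 22 (exitT (.cell 15) (.var 20))))
  (.fill 6 (.or (.and (.get 6 (.var 0) (.var 1))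
      (.and (.not (.and (.eq (.var 0) (.cell 15)) (.eq (.var 1) (.cell 16))))
        (.not (.and (.eq (.var 0) (.cell 16)) (.eq (.var 1) (.cell 15))))))
    (.or (.and (.eq (.var 0) (.cell 13)) (.eq (.var 1) (.cell 14)))
      (.and (.eq (.var 0) (.cell 14)) (.eq (.var 1) (.cell 13))))))))

/-- One step of the local search at the current level. -/
def stepC : Cmd :=
  .seq (closure 11 (.and (.get 6 (.var 0) (.var 1)) (.and (lowT (.var 0)) (lowT (.var 1)))))
  (.seq (.fill 13 (.least 20 22 (.and (outT (.var 20)) (.ex 23 (candT (.var 20) (.var 23))))))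
  (.seq (.fill 14 (.least 20 22 (candT (.cell 13) (.var 20))))
  (.cond (.lt (.cell 13) (.par 3)) exchangeC)))

/-- `xy` is an edge of the graph on `X` which joins vertices of degree less than `l` and different
components of the forest `T` without the vertices of degree more than `l`. -/
def Cand (G T : ℕ → ℕ → Prop) (X : Finset ℕ) (n l x y : ℕ) : Prop :=
  (x ∈ X ∧ deg T n x < l) ∧ G x y ∧ (y ∈ X ∧ deg T n y < l) ∧
    ¬Conn (Res T fun v => v ∈ X ∧ deg T n v ≤ l) x y

/-- `vz` is an edge of the forest on the path from `x` to `y`, and `v` has degree more than `l`. -/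
def Exit (T : ℕ → ℕ → Prop) (X : Finset ℕ) (n l x y v z : ℕ) : Prop :=
  T v z ∧ ¬(v ∈ X ∧ deg T n v ≤ l) ∧ Conn (Res T fun v => v ∈ X ∧ deg T n v ≤ l) x z ∧
    Conn (Res T fun u => ¬Conn (Res T fun v => v ∈ X ∧ deg T n v ≤ l) x u) v y

/-- The possible results of a step of the local search. -/
def StepRel (G T T' : ℕ → ℕ → Prop) (X : Finset ℕ) (n l : ℕ) : Prop :=
  ((∀ x y, ¬Cand G T X n l x y) ∧ T' = T) ∨ ∃ x y, Cand G T X n l x y ∧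
    ((∃ v z, Exit T X n l x y v z ∧ T' = addE (delE T v z) x y) ∨
      ((∀ v z, ¬Exit T X n l x y v z) ∧ T' = addE T x y))

/-- Given an edge `xy` in the cells `13` and `14`, and the components of the forest on its low
vertices in array `11`, the command adds the edge, in exchange for an exit edge if there is one. -/
theorem exchangeC_spec {p : Fin 4 → ℕ} {ρ : ℕ → ℕ} {m : Mem} (hN : 2 ≤ p 3) (x y l : ℕ)
    (hx : m 13 0 0 = x) (hy : m 14 0 0 = y) (hxN : x < p 3) (hyN : y < p 3)
    (hl : m 24 0 0 + ρ 9 = l) (T : ℕ → ℕ → Prop) (hT : rel m (p 3) 6 = T) (X : Finset ℕ)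
    (hX : col m (p 3) 5 = X)
    (h11 : ∀ a b, rel m (p 3) 11 a b ↔ a < p 3 ∧ b < p 3 ∧
      Conn (Res T fun v => v ∈ X ∧ deg T (p 3) v ≤ l) a b) :
    (∃ v z, Exit T X (p 3) l x y v z ∧
      rel (exchangeC.exec p ρ m) (p 3) 6 = addE (delE T v z) x y) ∨
    ((∀ v z, ¬Exit T X (p 3) l x y v z) ∧ rel (exchangeC.exec p ρ m) (p 3) 6 = addE T x y) := by
  set N := p 3 with hNdef
  set P : ℕ → Prop := fun v => v ∈ X ∧ deg T N v ≤ l with hP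
  have hTN : ∀ {a b}, T a b → a < N ∧ b < N := by
    rintro a b hab; rw [← hT] at hab; exact ⟨hab.1, hab.2.1⟩
  have hT6 : ∀ {a b}, a < N → b < N → (m 6 a b ≠ 0 ↔ T a b) := by
    intro a b ha hb; rw [← hT]; simp [rel, ha, hb]
  have h11' : ∀ {b}, b < N → (m 11 x b ≠ 0 ↔ Conn (Res T P) x b) := by
    intro b hb
    have := h11 x b
    simpa only [rel, hxN, hb, true_and] using this
  obtain ⟨m₁, hm₁⟩ : ∃ m₁, m₁ = (closure 12 (.and (.get 6 (.var 0) (.var 1))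
    (.and (.not (.get 11 (.cell 13) (.var 0)))
      (.not (.get 11 (.cell 13) (.var 1)))))).exec p ρ m := ⟨_, rfl⟩
  have fr₁ : ∀ a, a ≠ 10 → a ≠ 12 → m₁ a = m a := fun a h1 h2 => by
    rw [hm₁]; exact Cmd.exec_frame _ (by simp [closure_writes, h1, h2]) ρ m
  have h12 : ∀ {a}, a < N → (m₁ 12 a y ≠ 0 ↔ Conn (Res T fun u => ¬Conn (Res T P) x u) a y) := by
    intro a ha
    have := closure_spec (p := p) (ρ := ρ) (m := m) (a := 12)
      (e := (.and (.get 6 (.var 0) (.var 1)) (.and (.not (.get 11 (.cell 13) (.var 0)))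
      (.not (.get 11 (.cell 13) (.var 1)))))) (by norm_num) hN
      (Res T fun u => ¬Conn (Res T P) x u) ?_ a y
    · rw [← hm₁] at this
      simpa only [rel, ha, hyN, true_and, ← hNdef] using this
    · intro i j
      constructor
      · rintro ⟨h1, h2, h3⟩
        obtain ⟨hi, hj⟩ := hTN h1
        refine ⟨hi, hj, ?_⟩
        simp only [Tm.tr_and, Tm.tr_not, Tm.tr_get, Tm.ev_var, Tm.ev_cell, Function.update_self,
          update_zero_one, hx, hT6 hi hj, h11' hi, h11' hj]
        exact ⟨h1, h2, h3⟩
      · rintro ⟨hi, hj, h⟩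
        simp only [Tm.tr_and, Tm.tr_not, Tm.tr_get, Tm.ev_var, Tm.ev_cell, Function.update_self,
          update_zero_one, hx, hT6 hi hj, h11' hi, h11' hj] at h
        exact h
  have hexit : ∀ (ρ' : ℕ → ℕ) (m' : Mem) (v z : Tm), ρ' 9 = ρ 9 →
      (∀ a, a ≠ 10 → a ≠ 12 → a ≠ 15 → a ≠ 16 → m' a = m a) → m' 12 = m₁ 12 →
      (∀ i, v.ev p m' (Function.update ρ' 21 i) = v.ev p m' ρ') →
      v.ev p m' ρ' < N → z.ev p m' ρ' < N →
      ((exitT v z).tr p m' ρ' ↔ Exit T X N l x y (v.ev p m' ρ') (z.ev p m' ρ')) := by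
    intro ρ' m' v z hρ hm' hm12 hv hvN hzN
    have e1 : rel m' N 6 = T := by rw [← hT]; unfold rel; rw [hm' 6] <;> norm_num
    have e2 : col m' N 5 = X := by rw [← hX]; unfold col; rw [hm' 5] <;> norm_num
    have e3 : m' 24 0 0 + ρ' 9 = l := by rw [hm' 24, hρ, hl] <;> norm_num
    simp only [exitT, Tm.tr_and, Tm.tr_not, Tm.tr_get, tr_lowT hv hvN, e1, e2, e3, Tm.ev_cell,
      hm' 13 (by norm_num) (by norm_num) (by norm_num) (by norm_num),
      hm' 14 (by norm_num) (by norm_num) (by norm_num) (by norm_num),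
      hm' 6 (by norm_num) (by norm_num) (by norm_num) (by norm_num),
      hm' 11 (by norm_num) (by norm_num) (by norm_num) (by norm_num), hx, hy, hm12,
      hT6 hvN hzN, h11' hzN, h12 hvN, Exit, hP, ← hNdef]
  obtain ⟨m₂, hm₂⟩ : ∃ m₂, m₂ = (Cmd.fill 15 (.least 20 22
    (.ex 23 (exitT (.var 20) (.var 23))))).exec p ρ m₁ := ⟨_, rfl⟩
  have fr₂ : ∀ a, a ≠ 15 → m₂ a = m₁ a := fun a h1 => by
    rw [hm₂]; exact Cmd.exec_frame _ (by simp [Cmd.writes, h1]) ρ m₁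
  have h15 : Tm.IsLeast N (fun v => ∃ z < N, Exit T X N l x y v z) (m₂ 15 0 0) := by
    rw [hm₂, exec_fill (by omega) (by omega)]
    refine Tm.ev_least (by norm_num) _ fun i _ hi _ => ?_
    rw [Tm.tr_ex]
    refine exists_congr fun z => and_congr_right fun hz => ?_
    rw [hexit _ m₁ _ _ (by simp) (fun a h1 h2 _ _ => fr₁ a h1 h2) rfl
      (by simp) (by simpa using hi)
      (by simpa using hz)]
    simp
  obtain ⟨m₃, hm₃⟩ : ∃ m₃, m₃ = (Cmd.fill 16 (.least 20 22
    (exitT (.cell 15) (.var 20)))).exec p ρ m₂ := ⟨_, rfl⟩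
  have fr₃ : ∀ a, a ≠ 16 → m₃ a = m₂ a := fun a h1 => by
    rw [hm₃]; exact Cmd.exec_frame _ (by simp [Cmd.writes, h1]) ρ m₂
  have h16 : m₂ 15 0 0 < N → Tm.IsLeast N (fun z => Exit T X N l x y (m₂ 15 0 0) z)
      (m₃ 16 0 0) := by
    intro hlt
    rw [hm₃, exec_fill (by omega) (by omega)]
    refine Tm.ev_least (by norm_num) _ fun i _ hi _ => ?_
    rw [hexit _ m₂ _ _ (by simp)
      (fun a h1 h2 h3 _ => (fr₂ a h3).trans (fr₁ a h1 h2)) (fr₂ 12 (by norm_num))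
      (by simp) (by simpa using hlt)
      (by simpa using hi)]
    simp
  have hfin : ∀ a b, rel (exchangeC.exec p ρ m) N 6 a b ↔ a < N ∧ b < N ∧
      ((T a b ∧ ¬(a = m₂ 15 0 0 ∧ b = m₃ 16 0 0) ∧ ¬(a = m₃ 16 0 0 ∧ b = m₂ 15 0 0)) ∨
        (a = x ∧ b = y) ∨ (a = y ∧ b = x)) := by
    intro a b
    have : exchangeC.exec p ρ m = (Cmd.fill 6 (.or (.and (.get 6 (.var 0) (.var 1))
      (.and (.not (.and (.eq (.var 0) (.cell 15)) (.eq (.var 1) (.cell 16))))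
        (.not (.and (.eq (.var 0) (.cell 16)) (.eq (.var 1) (.cell 15))))))
      (.or (.and (.eq (.var 0) (.cell 13)) (.eq (.var 1) (.cell 14)))
      (.and (.eq (.var 0) (.cell 14)) (.eq (.var 1) (.cell 13)))))).exec p ρ m₃ := by
      rw [hm₃, hm₂, hm₁]; rfl
    rw [this, rel_fill]
    refine and_congr_right fun ha => and_congr_right fun hb => ?_
    simp only [Tm.tr_or, Tm.tr_and, Tm.tr_not, Tm.tr_get, Tm.tr_eq, Tm.ev_var, Tm.ev_cell,
      Function.update_self, update_zero_one]
    rw [fr₃ 15 (by norm_num), fr₃ 6 (by norm_num), fr₃ 13 (by norm_num), fr₃ 14 (by norm_num),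
      fr₂ 6 (by norm_num), fr₂ 13 (by norm_num), fr₂ 14 (by norm_num),
      fr₁ 6 (by norm_num) (by norm_num), fr₁ 13 (by norm_num) (by norm_num),
      fr₁ 14 (by norm_num) (by norm_num), hx, hy, hT6 ha hb]
  by_cases hv : m₂ 15 0 0 < N
  · left
    obtain ⟨z, hz, hexz⟩ := h15.holds hv
    have h16' := h16 hv
    have hzN : m₃ 16 0 0 < N := (h16'.min z hz hexz).trans_lt hz
    refine ⟨m₂ 15 0 0, m₃ 16 0 0, h16'.holds hzN, ?_⟩
    funext a b
    rw [eq_iff_iff, hfin]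
    simp only [addE, delE]
    constructor
    · exact fun h => h.2.2
    · intro h
      refine ⟨?_, ?_, h⟩ <;> rcases h with h | ⟨rfl, rfl⟩ | ⟨rfl, rfl⟩
      · exact (hTN h.1).1
      · exact hxN
      · exact hyN
      · exact (hTN h.1).2
      · exact hyN
      · exact hxN
  · right
    refine ⟨fun v z h => ?_, ?_⟩
    · obtain ⟨hvN, hzN⟩ := hTN h.1
      exact hv ((h15.min v hvN ⟨z, hzN, h⟩).trans_lt hvN)
    · funext a b
      rw [eq_iff_iff, hfin]
      simp only [addE]
      constructor
      · rintro ⟨-, -, ⟨h, -⟩ | h⟩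
        · exact Or.inl h
        · exact Or.inr h
      · intro h
        refine ⟨?_, ?_, ?_⟩
        · rcases h with h | ⟨rfl, rfl⟩ | ⟨rfl, rfl⟩
          · exact (hTN h).1
          · exact hxN
          · exact hyN
        · rcases h with h | ⟨rfl, rfl⟩ | ⟨rfl, rfl⟩
          · exact (hTN h).2
          · exact hyN
          · exact hxN
        · refine h.imp (fun h => ⟨h, fun h' => ?_, fun h' => ?_⟩) id
          · have := (hTN h).1; omega
          · have := (hTN h).2; omega

/-- A step does nothing if there is no candidate edge, and otherwise it adds one, in exchange for an
exit edge if there is one. -/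
theorem stepC_spec {p : Fin 4 → ℕ} {ρ : ℕ → ℕ} {m : Mem} (hN : 2 ≤ p 3) :
    StepRel (rel m (p 3) 0) (rel m (p 3) 6) (rel (stepC.exec p ρ m) (p 3) 6) (col m (p 3) 5) (p 3)
      (m 24 0 0 + ρ 9) := by
  obtain ⟨l, hl⟩ : ∃ l, m 24 0 0 + ρ 9 = l := ⟨_, rfl⟩
  obtain ⟨T, hT⟩ : ∃ T, rel m (p 3) 6 = T := ⟨_, rfl⟩
  obtain ⟨X, hX⟩ : ∃ X, col m (p 3) 5 = X := ⟨_, rfl⟩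
  obtain ⟨G, hG⟩ : ∃ G, rel m (p 3) 0 = G := ⟨_, rfl⟩
  rw [hl, hT, hX, hG]
  set N := p 3 with hNdef
  have hTN : ∀ {a b}, T a b → a < N ∧ b < N := by
    rintro a b hab; rw [← hT] at hab; exact ⟨hab.1, hab.2.1⟩
  have hT6 : ∀ {a b}, a < N → b < N → (m 6 a b ≠ 0 ↔ T a b) := by
    intro a b ha hb; rw [← hT]; simp [rel, ha, hb]
  have hG0 : ∀ {a b}, a < N → b < N → (m 0 a b ≠ 0 ↔ G a b) := by
    intro a b ha hb; rw [← hG]; simp [rel, ha, hb]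
  have hGN : ∀ {a b}, G a b → a < N ∧ b < N := by
    rintro a b hab; rw [← hG] at hab; exact ⟨hab.1, hab.2.1⟩
  obtain ⟨m₁, hm₁⟩ : ∃ m₁, m₁ = (closure 11 (.and (.get 6 (.var 0) (.var 1))
    (.and (lowT (.var 0)) (lowT (.var 1))))).exec p ρ m := ⟨_, rfl⟩
  have fr₁ : ∀ a, a ≠ 10 → a ≠ 11 → m₁ a = m a := fun a h1 h2 => by
    rw [hm₁]; exact Cmd.exec_frame _ (by simp [closure_writes, h1, h2]) ρ m
  have h11 : ∀ a b, rel m₁ N 11 a b ↔ a < N ∧ b < N ∧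
      Conn (Res T fun v => v ∈ X ∧ deg T N v ≤ l) a b := by
    intro a b
    rw [hm₁]
    refine closure_spec (by norm_num) hN _ (fun i j => ?_) a b
    rw [← hNdef]
    by_cases hi : i < N
    · by_cases hj : j < N
      · simp only [hi, hj, true_and, Tm.tr_and, Tm.tr_get, Tm.ev_var]
        rw [tr_lowT (by simp)
            (by simpa using hi),
          tr_lowT (by simp) (by simpa using hj)]
        simp only [Tm.ev_var, Function.update_self,
          Function.update_of_ne (show (0 : ℕ) ≠ 1 by norm_num),
          Function.update_of_ne (show (9 : ℕ) ≠ 1 by norm_num),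
          Function.update_of_ne (show (9 : ℕ) ≠ 0 by norm_num), hT6 hi hj, hT, hX, hl,
          Res, ← hNdef]
      · exact ⟨fun h => absurd (hTN h.1).2 hj, fun h => absurd h.2.1 hj⟩
    · exact ⟨fun h => absurd (hTN h.1).1 hi, fun h => absurd h.1 hi⟩
  have houtT : ∀ (ρ' : ℕ → ℕ) (m' : Mem) (v : Tm), ρ' 9 = ρ 9 →
      (∀ a, a ≠ 10 → a ≠ 11 → a ≠ 13 → a ≠ 14 → m' a = m a) →
      (∀ i, v.ev p m' (Function.update ρ' 21 i) = v.ev p m' ρ') →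
      v.ev p m' ρ' < N →
      ((outT v).tr p m' ρ' ↔ v.ev p m' ρ' ∈ X ∧ deg T N (v.ev p m' ρ') < l) := by
    intro ρ' m' v hρ hm' hv hvN
    have e1 : rel m' (p 3) 6 = T := by rw [← hT]; unfold rel; rw [hm' 6] <;> norm_num
    have e2 : col m' (p 3) 5 = X := by rw [← hX]; unfold col; rw [hm' 5] <;> norm_num
    have e3 : m' 24 0 0 + ρ' 9 = l := by rw [hm' 24, hρ, hl] <;> norm_num
    rw [tr_outT hv hvN, e1, e2, e3]
  have hcand : ∀ (ρ' : ℕ → ℕ) (m' : Mem) (x y : Tm), ρ' 9 = ρ 9 →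
      (∀ a, a ≠ 10 → a ≠ 11 → a ≠ 13 → a ≠ 14 → m' a = m a) → m' 11 = m₁ 11 →
      (∀ i, y.ev p m' (Function.update ρ' 21 i) = y.ev p m' ρ') →
      x.ev p m' ρ' < N → y.ev p m' ρ' < N →
      ((candT x y).tr p m' ρ' ↔ G (x.ev p m' ρ') (y.ev p m' ρ') ∧
        (y.ev p m' ρ' ∈ X ∧ deg T N (y.ev p m' ρ') < l) ∧
        ¬Conn (Res T fun v => v ∈ X ∧ deg T N v ≤ l) (x.ev p m' ρ') (y.ev p m' ρ')) := by
    intro ρ' m' x y hρ hm' hm11 hy hxN hyN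
    have h := h11 (x.ev p m' ρ') (y.ev p m' ρ')
    simp only [rel, hxN, hyN, true_and] at h
    simp only [candT, Tm.tr_and, Tm.tr_not, Tm.tr_get, houtT ρ' m' y hρ hm' hy hyN, hm11, h,
      hm' 0 (by norm_num) (by norm_num) (by norm_num) (by norm_num), hG0 hxN hyN]
  obtain ⟨m₂, hm₂⟩ : ∃ m₂, m₂ = (Cmd.fill 13 (.least 20 22 (.and (outT (.var 20))
    (.ex 23 (candT (.var 20) (.var 23)))))).exec p ρ m₁ := ⟨_, rfl⟩
  have fr₂ : ∀ a, a ≠ 13 → m₂ a = m₁ a := fun a h1 => by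
    rw [hm₂]; exact Cmd.exec_frame _ (by simp [Cmd.writes, h1]) ρ m₁
  have h13 : Tm.IsLeast N (fun x => ∃ y < N, Cand G T X N l x y) (m₂ 13 0 0) := by
    rw [hm₂, exec_fill (by omega) (by omega)]
    refine Tm.ev_least (by norm_num) _ fun i _ hi _ => ?_
    rw [Tm.tr_and, Tm.tr_ex, houtT _ m₁ _ (by simp)
      (fun a h1 h2 _ _ => fr₁ a h1 h2) (by simp)
      (by simpa using hi)]
    simp only [Tm.ev_var, Function.update_self]
    rw [← exists_and_left]
    refine exists_congr fun z => ?_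
    rw [and_left_comm]
    refine and_congr_right fun hz => ?_
    rw [hcand _ m₁ _ _ (by simp) (fun a h1 h2 _ _ => fr₁ a h1 h2) rfl
      (by simp) (by simpa using hi)
      (by simpa using hz)]
    simp [Cand]
  obtain ⟨m₃, hm₃⟩ : ∃ m₃, m₃ = (Cmd.fill 14 (.least 20 22
    (candT (.cell 13) (.var 20)))).exec p ρ m₂ := ⟨_, rfl⟩
  have fr₃ : ∀ a, a ≠ 14 → m₃ a = m₂ a := fun a h1 => by
    rw [hm₃]; exact Cmd.exec_frame _ (by simp [Cmd.writes, h1]) ρ m₂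
  have fr : ∀ a, a ≠ 10 → a ≠ 11 → a ≠ 13 → a ≠ 14 → m₃ a = m a := fun a h1 h2 h3 h4 =>
    (fr₃ a h4).trans ((fr₂ a h3).trans (fr₁ a h1 h2))
  have hexec : stepC.exec p ρ m =
      (Cmd.cond (.lt (.cell 13) (.par 3)) exchangeC).exec p ρ m₃ := by
    rw [hm₃, hm₂, hm₁]; rfl
  by_cases hx : m₂ 13 0 0 < N
  · right
    obtain ⟨y, hy, hcxy⟩ := h13.holds hx
    have h14 : Tm.IsLeast N (fun y => Cand G T X N l (m₂ 13 0 0) y) (m₃ 14 0 0) := by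
      rw [hm₃, exec_fill (by omega) (by omega)]
      refine Tm.ev_least (by norm_num) _ fun i _ hi _ => ?_
      rw [hcand _ m₂ _ _ (by simp)
        (fun a h1 h2 h3 _ => (fr₂ a h3).trans (fr₁ a h1 h2)) (fr₂ 11 (by norm_num))
        (by simp) (by simpa using hx)
        (by simpa using hi)]
      simp only [Tm.ev_cell, Tm.ev_var, Function.update_self, Cand]
      exact ⟨fun h => ⟨hcxy.1, h⟩, fun h => h.2⟩
    have hyN : m₃ 14 0 0 < N := (h14.min y hy hcxy).trans_lt hy
    refine ⟨m₂ 13 0 0, m₃ 14 0 0, h14.holds hyN, ?_⟩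
    have he : stepC.exec p ρ m = exchangeC.exec p ρ m₃ := by
      rw [hexec, Cmd.exec, if_pos]
      change Tm.tr p m₃ _ ρ
      rw [Tm.tr_lt, Tm.ev_cell, fr₃ 13 (by norm_num)]
      exact hx
    rw [he]
    refine exchangeC_spec hN _ _ l (by rw [fr₃ 13 (by norm_num)]) rfl hx hyN
      (by rw [fr 24, hl] <;> norm_num) T ?_ X ?_ ?_
    · rw [← hT]; unfold rel; rw [fr 6] <;> norm_num
    · rw [← hX]; unfold col; rw [fr 5] <;> norm_num
    · intro a b
      rw [← h11, rel, rel, fr₃ 11 (by norm_num), fr₂ 11 (by norm_num)]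
  · left
    refine ⟨fun x y h => ?_, ?_⟩
    · obtain ⟨hxN, hyN⟩ := hGN h.2.1
      exact hx ((h13.min x hxN ⟨y, hyN, h⟩).trans_lt hxN)
    · rw [hexec, Cmd.exec, if_neg]
      · rw [← hT]; unfold rel; rw [fr 6] <;> norm_num
      · change ¬Tm.tr p m₃ _ ρ
        rw [Tm.tr_lt, Tm.ev_cell, fr₃ 13 (by norm_num)]
        exact hx

theorem stepC_frame {p : Fin 4 → ℕ} {ρ : ℕ → ℕ} {m : Mem} {a : ℕ}
    (ha : a ∉ [6, 10, 11, 12, 13, 14, 15, 16]) : stepC.exec p ρ m a = m a :=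
  Cmd.exec_frame _ (by
    simp only [List.mem_cons, List.not_mem_nil, or_false, not_or] at ha
    simp [stepC, exchangeC, Cmd.writes, closure_writes, ha]) ρ m

/-! ### Termination of the local search -/

/-- `T` is a forest in the graph `G` on `X` with degrees at most `D`. -/
structure ForestInv (G : ℕ → ℕ → Prop) (X : Finset ℕ) (N D : ℕ) (T : ℕ → ℕ → Prop) : Prop where
  symm : Symm T
  acy : Acy T
  sub : ∀ a b, T a b → G a b
  left : ∀ a b, T a b → a ∈ X
  right : ∀ a b, T a b → b ∈ X
  deg_le : ∀ v, deg T N v ≤ D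

/-- The measure of progress of the local search: the number of components and the potential. -/
noncomputable def searchMeasure (d L N : ℕ) (T : ℕ → ℕ → Prop) : ℕ :=
  (reps T (Finset.range N)).card * (2 * 3 ^ L + 1) + pot d N T

theorem searchMeasure_le {d L N : ℕ} {T : ℕ → ℕ → Prop} (hd : ∀ v, deg T N v ≤ d + L) :
    searchMeasure d L N T ≤ N * (3 * 3 ^ L + 1) := by
  have h1 : (reps T (Finset.range N)).card ≤ N :=
    by classical exact (Finset.card_filter_le _ _).trans (by simp)
  have h2 : pot d N T ≤ N * 3 ^ L := by
    unfold pot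
    refine (Finset.sum_le_card_nsmul _ _ (3 ^ L) fun v _ => ?_).trans (by simp)
    exact Nat.pow_le_pow_right (by norm_num) (by have := hd v; omega)
  have := Nat.mul_le_mul_right (2 * 3 ^ L + 1) h1
  unfold searchMeasure
  nlinarith

section

variable {G T T' : ℕ → ℕ → Prop} {X : Finset ℕ} {N d L l : ℕ}

theorem ForestInv.lt (h : ForestInv G X N (d + L) T) (hX : X ⊆ Finset.range N) (a b : ℕ)
    (hab : T a b) : a < N := Finset.mem_range.mp (hX (h.left a b hab))

/-- If there is no exit edge, then the ends of the candidate edge are not connected. -/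
theorem not_conn_of_no_exit (hT : ForestInv G X N (d + L) T) {x y : ℕ}
    (hc : Cand G T X N l x y) (he : ∀ v z, ¬Exit T X N l x y v z) : ¬Conn T x y := by
  intro h
  obtain ⟨v, z, h1, h2, h3, h4⟩ := exists_exit_edge (P := fun v => v ∈ X ∧ deg T N v ≤ l)
    ⟨hc.1.1, hc.1.2.le⟩ hc.2.2.2 hT.symm h
  exact he v z ⟨h2, h1, h3, h4⟩

/-- A step keeps a forest with degrees at most `d + L`, because the ends of the new edge had degrees
less than the level. -/
theorem StepRel.forestInv (h : StepRel G T T' X N l) (hG : Symm G) (hX : X ⊆ Finset.range N)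
    (hl : l ≤ d + L) (hT : ForestInv G X N (d + L) T) : ForestInv G X N (d + L) T' := by
  -- Adding a candidate edge to a subforest in which it closes no cycle keeps the invariant.
  have key : ∀ T₀ x y, Symm T₀ → Acy T₀ → (∀ a b, T₀ a b → T a b) → Cand G T X N l x y →
      ¬Conn T₀ x y → ForestInv G X N (d + L) (addE T₀ x y) := by
    intro T₀ x y hs ha hsub hc hn
    have hx := Finset.mem_range.mp (hX hc.1.1)
    have hy := Finset.mem_range.mp (hX hc.2.2.1.1)
    refine ⟨hs.addE x y, ha.addE hs hn, ?_, ?_, ?_, fun v => ?_⟩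
    · rintro a b (h | ⟨rfl, rfl⟩ | ⟨rfl, rfl⟩)
      · exact hT.sub a b (hsub a b h)
      · exact hc.2.1
      · exact hG _ _ hc.2.1
    · rintro a b (h | ⟨rfl, rfl⟩ | ⟨rfl, rfl⟩)
      · exact hT.left a b (hsub a b h)
      · exact hc.1.1
      · exact hc.2.2.1.1
    · rintro a b (h | ⟨rfl, rfl⟩ | ⟨rfl, rfl⟩)
      · exact hT.right a b (hsub a b h)
      · exact hc.2.2.1.1
      · exact hc.1.1
    · rw [deg_addE hx hy (fun e => hn (e ▸ .refl)) (fun h => hn (.single h))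
        (fun h => hn (.single (hs _ _ h)))]
      have := (deg_mono hsub N v).trans (hT.deg_le v)
      have h1 := (deg_mono hsub N x).trans_lt hc.1.2
      have h2 := (deg_mono hsub N y).trans_lt hc.2.2.1.2
      split_ifs with hv
      · rcases hv with rfl | rfl <;> omega
      · omega
  rcases h with ⟨-, rfl⟩ | ⟨x, y, hc, ⟨v, z, he, rfl⟩ | ⟨he, rfl⟩⟩
  · exact hT
  · exact key _ x y (hT.symm.delE v z) (hT.acy.delE v z) (fun _ _ h => h.1) hc
      (not_conn_delE hT.symm he.2.1 he.2.2.1 he.2.2.2 hT.acy he.1)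
  · exact key T x y hT.symm hT.acy (fun _ _ h => h) hc (not_conn_of_no_exit hT hc he)

/-- A step that changes the forest decreases the measure: an exchange decreases the potential, and a
new edge decreases the number of components, which outweighs its effect on the potential. -/
theorem StepRel.progress (h : StepRel G T T' X N l) (hX : X ⊆ Finset.range N)
    (hd : d ≤ l) (hl : l ≤ d + L) (hT : ForestInv G X N (d + L) T) :
    ((∀ x y, ¬Cand G T X N l x y) ∧ T' = T) ∨
      searchMeasure d L N T' < searchMeasure d L N T := by
  rcases h with h | ⟨x, y, hc, ⟨v, z, he, rfl⟩ | ⟨he, rfl⟩⟩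
  · exact Or.inl h
  all_goals
    right
    have hx := Finset.mem_range.mp (hX hc.1.1)
    have hy := Finset.mem_range.mp (hX hc.2.2.1.1)
    have hxy : x ≠ y := fun e => hc.2.2.2 (e ▸ .refl)
  · have hn := not_conn_delE hT.symm he.2.1 he.2.2.1 he.2.2.2 hT.acy he.1
    have h1 := pot_exchange_lt (d := d) hT.symm hT.acy.irrefl (hT.lt hX) hd hx hy hxy
      (fun h => hn (.single h)) hc.1.2 hc.2.2.1.2 he.1 (by
        by_contra hlt
        exact he.2.1 ⟨hT.left _ _ he.1, not_lt.mp hlt⟩)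
    have h2 : (reps (addE (delE T v z) x y) (Finset.range N)).card ≤
        (reps T (Finset.range N)).card :=
      Finset.card_le_card (reps_anti
        (fun a b h => conn_exchange hT.symm he.2.1 he.2.2.1 he.2.2.2 h) _)
    have := Nat.mul_le_mul_right (2 * 3 ^ L + 1) h2
    unfold searchMeasure
    omega
  · have hn := not_conn_of_no_exit hT hc he
    have h1 := pot_addE (d := d) hx hy hxy (fun h => hn (.single h))
      (fun h => hn (.single (hT.symm _ _ h)))
    have h2 := card_reps_addE_lt hT.symm (Finset.mem_range.mpr hx) (Finset.mem_range.mpr hy) hn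
    have h3 := Nat.mul_le_mul_right (2 * 3 ^ L + 1) h2
    have h4 : 3 ^ (deg T N x + 1 - d) ≤ 3 ^ L :=
      Nat.pow_le_pow_right (by norm_num) (by have := hc.1.2; omega)
    have h5 : 3 ^ (deg T N y + 1 - d) ≤ 3 ^ L :=
      Nat.pow_le_pow_right (by norm_num) (by have := hc.2.2.1.2; omega)
    rw [Nat.add_mul, one_mul] at h3
    have h6 : 0 < 3 ^ (deg T N x - d) := by positivity
    have h7 : 0 < 3 ^ (deg T N y - d) := by positivity
    unfold searchMeasure
    omega

end

/-- A step of the local search at each level. -/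
def sweepC : Cmd := .loop 9 (.cond (.le (.var 9) (.cell 7)) stepC)

/-- The local search, from the empty forest. -/
def searchC : Cmd := .seq (.fill 6 (.lit 0)) (sweepC.rep 7)

theorem searchC_frame {p : Fin 4 → ℕ} {ρ : ℕ → ℕ} {m : Mem} {a : ℕ}
    (ha : a ∉ [6, 10, 11, 12, 13, 14, 15, 16]) : searchC.exec p ρ m a = m a :=
  Cmd.exec_frame _ (by
    simp only [List.mem_cons, List.not_mem_nil, or_false, not_or] at ha
    simp [searchC, Cmd.rep_writes, sweepC, stepC, exchangeC, Cmd.writes, closure_writes, ha]) ρ m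

theorem rel_congr {m m' : Mem} {N a : ℕ} (h : m a = m' a) : rel m N a = rel m' N a := by
  unfold rel; rw [h]

theorem col_congr {m m' : Mem} {N a : ℕ} (h : m a = m' a) : col m N a = col m' N a := by
  unfold col; rw [h]

/-- The local search ends in a forest which is locally optimal at all levels `d, …, d + L`. The
measure is `O(N * 3 ^ L) = O(N ^ 3)` at first, so that `N ^ 7` sweeps suffice for all `N ≥ 2`. -/
theorem searchC_spec {p : Fin 4 → ℕ} {ρ : ℕ → ℕ} {m : Mem} (hN : 2 ≤ p 3)
    (G : ℕ → ℕ → Prop) (hG : rel m (p 3) 0 = G) (hGs : Symm G) (X : Finset ℕ)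
    (hX : col m (p 3) 5 = X) (d L : ℕ) (hd : m 24 0 0 = d) (hL : m 7 0 0 = L)
    (hLN : L < p 3) (hL2 : 2 ^ L ≤ 2 * p 3) :
    ForestInv G X (p 3) (d + L) (rel (searchC.exec p ρ m) (p 3) 6) ∧
      ∀ j ≤ L, LocalOpt G (rel (searchC.exec p ρ m) (p 3) 6) X (p 3) (d + j) := by
  set N := p 3
  have hXN : X ⊆ Finset.range N := by rw [← hX]; exact Finset.filter_subset _ _
  let I : Mem → Prop := fun s => rel s N 0 = G ∧ col s N 5 = X ∧ s 24 0 0 = d ∧ s 7 0 0 = L ∧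
    ForestInv G X N (d + L) (rel s N 6)
  let Done : Mem → Prop := fun s => ∀ j ≤ L, ∀ x y, ¬Cand G (rel s N 6) X N (d + j) x y
  let μ : Mem → ℕ := fun s => searchMeasure d L N (rel s N 6)
  have hsweep : ∀ ρ s, I s → I (sweepC.exec p ρ s) ∧
      (Done s → rel (sweepC.exec p ρ s) N 6 = rel s N 6) ∧
      ((rel (sweepC.exec p ρ s) N 6 = rel s N 6 ∧ Done s) ∨ μ (sweepC.exec p ρ s) < μ s) := by
    intro ρ s hs
    have : I (sweepC.exec p ρ s) ∧ (Done s → rel (sweepC.exec p ρ s) N 6 = rel s N 6) ∧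
        ((rel (sweepC.exec p ρ s) N 6 = rel s N 6 ∧
        ∀ j < N, j ≤ L → ∀ x y, ¬Cand G (rel s N 6) X N (d + j) x y) ∨
        μ (sweepC.exec p ρ s) < μ s) := by
      refine loopN_induct (fun i s' => I s' ∧ (Done s → rel s' N 6 = rel s N 6) ∧
        ((rel s' N 6 = rel s N 6 ∧
        ∀ j < i, j ≤ L → ∀ x y, ¬Cand G (rel s N 6) X N (d + j) x y) ∨ μ s' < μ s)) ?_
        ⟨hs, fun _ => rfl, Or.inl ⟨rfl, by simp⟩⟩
      rintro i hi s' ⟨⟨i1, i2, i3, i4, i5⟩, hst, h⟩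
      have hcond : (Tm.le (.var 9) (.cell 7)).ev p s' (Function.update ρ 9 i) ≠ 0 ↔ i ≤ L := by
        rw [← Tm.tr_iff]
        simp [i4]
      simp only [Cmd.exec, hcond]
      split_ifs with hiL
      · have hrel := stepC_spec (p := p) (ρ := Function.update ρ 9 i) (m := s') hN
        simp only [Function.update_self, i3] at hrel
        rw [show rel s' (p 3) 0 = G from i1, show col s' (p 3) 5 = X from i2] at hrel
        have fr : ∀ a, a ∉ [6, 10, 11, 12, 13, 14, 15, 16] →
            stepC.exec p (Function.update ρ 9 i) s' a = s' a := fun a ha => stepC_frame ha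
        refine ⟨⟨?_, ?_, ?_, ?_, ?_⟩, fun hd => ?_, ?_⟩
        · rw [← i1]; exact rel_congr (fr 0 (by decide))
        · rw [← i2]; exact col_congr (fr 5 (by decide))
        · rw [fr 24 (by decide), i3]
        · rw [fr 7 (by decide), i4]
        · exact hrel.forestInv hGs hXN (by omega) i5
        · -- At a local optimum there is no candidate edge, so the step changes nothing.
          rcases hrel with ⟨-, h1⟩ | ⟨x, y, hc, -⟩
          · exact h1.trans (hst hd)
          · rw [hst hd] at hc
            exact absurd hc (hd i hiL x y)
        · rcases hrel.progress hXN (by omega) (by omega) i5 with ⟨h1, h2⟩ | h1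
          · rcases h with ⟨h3, h4⟩ | h3
            · refine Or.inl ⟨h2.trans h3, fun j hj hjL => ?_⟩
              rcases Nat.lt_succ_iff_lt_or_eq.mp hj with h5 | rfl
              · exact h4 j h5 hjL
              · rw [← h3]; exact h1
            · refine Or.inr (lt_of_le_of_lt (le_of_eq ?_) h3)
              exact congrArg (searchMeasure d L N) h2
          · right
            rcases h with ⟨h3, -⟩ | h3
            · exact h1.trans_eq (congrArg (searchMeasure d L N) h3)
            · exact h1.trans h3
      · refine ⟨⟨i1, i2, i3, i4, i5⟩, hst, h.imp (fun h => ⟨h.1, fun j hj hjL => ?_⟩) id⟩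
        exact h.2 j (by omega) hjL
    refine ⟨this.1, this.2.1, this.2.2.imp (fun h => ⟨h.1, fun j hj => h.2 j (by omega) hj⟩) id⟩
  obtain ⟨m₁, hm₁⟩ : ∃ m₁, m₁ = (Cmd.fill 6 (.lit 0)).exec p ρ m := ⟨_, rfl⟩
  have fr₁ : ∀ a, a ≠ 6 → m₁ a = m a := fun a h1 => by
    rw [hm₁]; exact Cmd.exec_frame _ (by simp [Cmd.writes, h1]) ρ m
  have hT₁ : ∀ a b, ¬rel m₁ N 6 a b := by
    intro a b h
    rw [hm₁, rel_fill] at h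
    simp at h
  have hdeg₁ : ∀ v, deg (rel m₁ N 6) N v = 0 := by
    intro v; simp [deg, hT₁]
  have hI₁ : I m₁ := by
    refine ⟨?_, ?_, ?_, ?_, ⟨fun a b h => absurd h (hT₁ a b), fun a b h => absurd h (hT₁ a b),
      fun a b h => absurd h (hT₁ a b), fun a b h => absurd h (hT₁ a b),
      fun a b h => absurd h (hT₁ a b), fun v => by rw [hdeg₁]; omega⟩⟩
    · rw [← hG]; exact rel_congr (fr₁ 0 (by norm_num))
    · rw [← hX]; exact col_congr (fr₁ 5 (by norm_num))
    · rw [fr₁ 24 (by norm_num), hd]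
    · rw [fr₁ 7 (by norm_num), hL]
  have hμ : μ m₁ < N ^ 7 := by
    have h1 := searchMeasure_le (d := d) (L := L) (N := N) (T := rel m₁ N 6)
      (fun v => by rw [hdeg₁]; omega)
    have h2 : 3 ^ L ≤ (2 * N) ^ 2 := by
      calc 3 ^ L ≤ 4 ^ L := Nat.pow_le_pow_left (by norm_num) L
        _ = (2 ^ L) ^ 2 := by rw [← pow_mul, mul_comm, pow_mul]; norm_num
        _ ≤ (2 * N) ^ 2 := Nat.pow_le_pow_left hL2 2
    have h3 : N * (3 * 3 ^ L + 1) ≤ N * (3 * (2 * N) ^ 2 + 1) := Nat.mul_le_mul_left _ (by omega)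
    have h4 : N * (3 * (2 * N) ^ 2 + 1) ≤ 13 * N ^ 3 := by
      have : N ≤ N ^ 3 := Nat.le_self_pow (by norm_num) N
      nlinarith
    have h5 : 2 ^ 4 ≤ N ^ 4 := Nat.pow_le_pow_left hN 4
    have h6 : N ^ 7 = N ^ 4 * N ^ 3 := by ring
    have h7 : 0 < N ^ 3 := by positivity
    rw [h6]
    have h8 := Nat.mul_le_mul_right (N ^ 3) h5
    change searchMeasure d L N (rel m₁ N 6) < _
    omega
  have hfin := Cmd.rep_spec I Done μ (fun ρ s hs => (hsweep ρ s hs).1)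
    (fun ρ s hs hd => ?_) (fun ρ s hs => ?_) 7 ρ m₁ hI₁ hμ
  · have he : searchC.exec p ρ m = (sweepC.rep 7).exec p ρ m₁ := by rw [hm₁]; rfl
    rw [he]
    refine ⟨hfin.1.2.2.2.2, fun j hj x y hxy hx hy hdx hdy => ?_⟩
    by_contra hn
    exact hfin.2 j hj x y ⟨⟨hx, hdx⟩, hxy, ⟨hy, hdy⟩, hn⟩
  · change ∀ j ≤ L, ∀ x y, ¬Cand G (rel (sweepC.exec p ρ s) N 6) X N (d + j) x y
    rw [(hsweep ρ s hs).2.1 hd]; exact hd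
  · rcases (hsweep ρ s hs).2.2 with h | h
    · left
      change ∀ j ≤ L, ∀ x y, ¬Cand G (rel (sweepC.exec p ρ s) N 6) X N (d + j) x y
      rw [h.1]; exact h.2
    · exact Or.inr h

/-! ### Removal of redundant components -/

/-- The parts of the memory that stay fixed during the main loop: the graph `G`, the set `U`, the
table of remainders, the bound `M` on residues, the first level `d` and the number `L`, for the
levels `d, …, d + L`. -/
structure Env (N : ℕ) (m : Mem) (G : ℕ → ℕ → Prop) (U : Finset ℕ) (d L M : ℕ) : Prop where
  graph : rel m N 0 = G
  terms : col m N 4 = U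
  levels : m 7 0 0 = L
  bound : m 23 0 0 = M
  base : m 24 0 0 = d
  mods : ∀ q < N, ∀ e < N, m 9 q e = e % q

theorem Env.congr {N : ℕ} {m m' : Mem} {G : ℕ → ℕ → Prop} {U : Finset ℕ} {d L M : ℕ}
    (h : Env N m G U d L M) (hm : ∀ a ∈ [0, 4, 7, 9, 23, 24], m' a = m a) :
    Env N m' G U d L M where
  graph := (rel_congr (hm 0 (by simp))).trans h.graph
  terms := (col_congr (hm 4 (by simp))).trans h.terms
  levels := by rw [hm 7 (by simp), h.levels]
  bound := by rw [hm 23 (by simp), h.bound]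
  base := by rw [hm 24 (by simp), h.base]
  mods := by rw [hm 9 (by simp)]; exact h.mods

open Classical in
/-- The component of `c` in `G[X] - W`, named by its least vertex `c`, has no vertex of `U` and is
not needed for any of the residue sets. -/
def Redundant (G : ℕ → ℕ → Prop) (X : Finset ℕ) (W : ℕ → Prop) (U : Finset ℕ) (N M c : ℕ) :
    Prop :=
  c ∈ reps (Res G fun v => v ∈ X ∧ ¬W v) (X.filter fun v => ¬W v) ∧
    (∀ u ∈ U, ¬Conn (Res G fun v => v ∈ X ∧ ¬W v) c u) ∧
    ∀ lab, IsLabel G X W lab → ∀ S ∈ residueSets N M, ¬Needed G X W S lab c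

/-- All labellings agree on the vertices that matter, hence on the needed components. -/
theorem IsLabel.needed_congr {G : ℕ → ℕ → Prop} (hG : Symm G) {X : Finset ℕ} {W S : ℕ → Prop}
    {lab lab' : ℕ → ℕ} (h : IsLabel G X W lab) (h' : IsLabel G X W lab') {c : ℕ}
    (hn : Needed G X W S lab c) : Needed G X W S lab' c := by
  have : Allowed X W S lab c = Allowed X W S lab' c := by
    funext u
    refine propext (and_congr_right fun hu => or_congr_right ?_)
    refine and_congr_right fun hW => ?_
    obtain ⟨h1, h2⟩ := h u hu hW
    rw [h'.eq_of_conn hG h1 (h2.symm hG.res)]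
  unfold Needed
  rw [← this]
  exact hn

/-- The degree of `v` is less than the level. -/
def ltLvl (v : Tm) : Tm := .lt (degT v) lvl

/-- The number `e` has one of the three residues in the variables `12`, `13` and `14` modulo the
number in variable `11`. -/
def selT (e : Tm) : Tm :=
  .or (.eq (.get 9 (.var 11) e) (.var 12))
    (.or (.eq (.get 9 (.var 11) e) (.var 13)) (.eq (.get 9 (.var 11) e) (.var 14)))

/-- The vertex `v` may be used to replace the component of `c`. -/
def allowedT (v : Tm) : Tm := .and (.vec 5 v)
  (.or (.and (.not (ltLvl v)) (selT v))
    (.and (ltLvl v) (.and (selT (.vec 18 v)) (.lt (.vec 18 v) (.var 10)))))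

/-- The vertex `w` of high degree is adjacent to the component of `c`. -/
def touchT (w : Tm) : Tm := .and (.vec 5 w) (.and (.not (ltLvl w))
  (.ex 23 (.and (.get 11 (.var 10) (.var 23)) (.get 0 w (.var 23)))))

/-- The component of `c` is needed. -/
def neededT : Tm := .and (selT (.var 10)) (.ex 20 (.ex 22 (.and (selT (.var 20))
  (.and (selT (.var 22)) (.and (touchT (.var 20)) (.and (touchT (.var 22))
    (.not (.get 12 (.var 20) (.var 22)))))))))

/-- The test whether the component of `c` is needed for one residue set. Numbers above the bound in
array `23` are skipped, and the flag in array `19` keeps earlier results. -/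
def needC : Cmd :=
  .cond (.and (.le (.var 11) (.cell 23)) (.and (.le (.var 12) (.cell 23))
      (.and (.le (.var 13) (.cell 23)) (.le (.var 14) (.cell 23)))))
    (.seq (closure 12 (.and (.get 0 (.var 0) (.var 1))
        (.and (allowedT (.var 0)) (allowedT (.var 1)))))
      (.fill 19 (.or (.cell 19) neededT)))

/-- Removal of the component of `c`, if it is redundant. -/
def dropC : Cmd :=
  .seq (closure 11 (.and (.get 0 (.var 0) (.var 1)) (.and (outT (.var 0)) (outT (.var 1)))))
  (.seq (.fill 18 (.least 20 22 (.get 11 (.var 0) (.var 20))))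
  (.seq (.fill 19 (.lit 0))
  (.seq (.loop 11 (.loop 12 (.loop 13 (.loop 14 needC))))
  (.cond (.and (outT (.var 10)) (.and (.eq (.vec 18 (.var 10)) (.var 10))
      (.and (.not (.ex 20 (.and (.vec 4 (.var 20)) (.get 11 (.var 10) (.var 20)))))
        (.not (.cell 19)))))
    (.fill 5 (.and (.vec 5 (.var 0)) (.not (.get 11 (.var 10) (.var 0)))))))))

section

variable {p : Fin 4 → ℕ} {m : Mem} {ρ : ℕ → ℕ} {G T : ℕ → ℕ → Prop} {X U : Finset ℕ}
  {d L M l : ℕ}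

theorem tr_ltLvl (hT : rel m (p 3) 6 = T) (hl : m 24 0 0 + ρ 9 = l) {k : ℕ} (hk : k ≠ 21)
    (h : ρ k < p 3) : (ltLvl (.var k)).tr p m ρ ↔ deg T (p 3) (ρ k) < l := by
  rw [ltLvl, Tm.tr_lt, ev_degT (by simp [hk]) (by simpa using h), hT]
  simp [lvl, hl]

theorem tr_selT (hE : Env (p 3) m G U d L M) (hq : ρ 11 < p 3) {e : Tm} (he : e.ev p m ρ < p 3) :
    (selT e).tr p m ρ ↔ e.ev p m ρ % ρ 11 = ρ 12 ∨ e.ev p m ρ % ρ 11 = ρ 13 ∨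
      e.ev p m ρ % ρ 11 = ρ 14 := by
  simp [selT, hE.mods _ hq _ he]

theorem tr_allowedT (hE : Env (p 3) m G U d L M) (hT : rel m (p 3) 6 = T)
    (hX : col m (p 3) 5 = X) (hl : d + ρ 9 = l) (hq : ρ 11 < p 3)
    (hlab : ∀ u < p 3, m 18 u 0 < p 3) {W : ℕ → Prop} (hW : ∀ v, W v ↔ l ≤ deg T (p 3) v)
    {k : ℕ} (hk : k ≠ 21) (h : ρ k < p 3) :
    (allowedT (.var k)).tr p m ρ ↔ Allowed X W
      (fun e => e % ρ 11 = ρ 12 ∨ e % ρ 11 = ρ 13 ∨ e % ρ 11 = ρ 14) (fun u => m 18 u 0) (ρ 10)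
      (ρ k) := by
  obtain rfl : W = fun v => l ≤ deg T (p 3) v := funext fun v => propext (hW v)
  have hl' : m 24 0 0 + ρ 9 = l := by rw [hE.base, hl]
  simp only [allowedT, Tm.tr_and, Tm.tr_or, Tm.tr_not, tr_ltLvl hT hl' hk h, Tm.tr_vec, Tm.tr_lt,
    Tm.ev_var, Allowed, ← hX, mem_col, h, true_and, not_le, not_lt]
  rw [tr_selT hE hq (by simpa using h), tr_selT hE hq (by simpa using hlab _ h)]
  simp

theorem tr_touchT (hE : Env (p 3) m G U d L M) (hT : rel m (p 3) 6 = T)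
    (hX : col m (p 3) 5 = X) (hl : d + ρ 9 = l)
    {W : ℕ → Prop} (hW : ∀ v, W v ↔ l ≤ deg T (p 3) v)
    (h11 : ∀ a b, rel m (p 3) 11 a b ↔ a < p 3 ∧ b < p 3 ∧
      Conn (Res G fun v => v ∈ X ∧ ¬W v) a b)
    (hc : ρ 10 < p 3) {k : ℕ} (hk : k ≠ 21) (hk' : k ≠ 23) (h : ρ k < p 3) :
    (touchT (.var k)).tr p m ρ ↔ Touches G X W (ρ 10) (ρ k) := by
  obtain rfl : W = fun v => l ≤ deg T (p 3) v := funext fun v => propext (hW v)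
  have hl' : m 24 0 0 + ρ 9 = l := by rw [hE.base, hl]
  simp only [touchT, Tm.tr_and, Tm.tr_not, tr_ltLvl hT hl' hk h, Tm.tr_vec, Tm.tr_ex, Tm.tr_get,
    Tm.ev_var, Touches, ← hX, mem_col, h, true_and, not_lt, Function.update_self,
    Function.update_of_ne hk', Function.update_of_ne (show (10 : ℕ) ≠ 23 by norm_num)]
  refine and_congr_right fun _ => and_congr_right fun _ => ?_
  constructor
  · rintro ⟨u, hu, h1, h2⟩
    refine ⟨u, ?_, ?_⟩
    · have := ((h11 (ρ 10) u).mp ⟨hc, hu, h1⟩).2.2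
      simpa only [← hX, mem_col] using this
    · rw [← hE.graph]; exact ⟨h, hu, h2⟩
  · rintro ⟨u, h1, h2⟩
    rw [← hE.graph] at h2
    refine ⟨u, h2.2.1, ((h11 (ρ 10) u).mpr ⟨hc, h2.2.1, ?_⟩).2.2, h2.2.2⟩
    simpa only [← hX, mem_col] using h1

/-- The flag in array `19` gets set if the component of the vertex in variable `10` is needed for
the residue set given by the variables `11` to `14`. -/
theorem needC_spec (hN : 2 ≤ p 3) (hE : Env (p 3) m G U d L M) (hT : rel m (p 3) 6 = T)
    (hX : col m (p 3) 5 = X) (hl : d + ρ 9 = l)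
    {W : ℕ → Prop} (hW : ∀ v, W v ↔ l ≤ deg T (p 3) v)
    (h11 : ∀ a b, rel m (p 3) 11 a b ↔ a < p 3 ∧ b < p 3 ∧
      Conn (Res G fun v => v ∈ X ∧ ¬W v) a b)
    (hlab : ∀ u < p 3, m 18 u 0 < p 3) (hc : ρ 10 < p 3) (hq : ρ 11 < p 3) :
    needC.exec p ρ m 19 0 0 ≠ 0 ↔ m 19 0 0 ≠ 0 ∨
      ((ρ 11 ≤ M ∧ ρ 12 ≤ M ∧ ρ 13 ≤ M ∧ ρ 14 ≤ M) ∧ Needed G X W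
        (fun e => e % ρ 11 = ρ 12 ∨ e % ρ 11 = ρ 13 ∨ e % ρ 11 = ρ 14) (fun u => m 18 u 0)
        (ρ 10)) := by
  rw [needC, Cmd.exec]
  have hb : (Tm.and (.le (.var 11) (.cell 23)) (.and (.le (.var 12) (.cell 23))
      (.and (.le (.var 13) (.cell 23)) (.le (.var 14) (.cell 23))))).ev p m ρ ≠ 0 ↔
      ρ 11 ≤ M ∧ ρ 12 ≤ M ∧ ρ 13 ≤ M ∧ ρ 14 ≤ M := by
    rw [← Tm.tr_iff]; simp [hE.bound]
  simp only [hb]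
  split_ifs with hM
  swap
  · simp only [hM, false_and, or_false]
  simp only [hM, and_self, true_and]
  set S : ℕ → Prop := fun e => e % ρ 11 = ρ 12 ∨ e % ρ 11 = ρ 13 ∨ e % ρ 11 = ρ 14
  set lab : ℕ → ℕ := fun u => m 18 u 0
  rw [Cmd.exec]
  obtain ⟨m₁, hm₁⟩ : ∃ m₁, m₁ = (closure 12 (.and (.get 0 (.var 0) (.var 1))
    (.and (allowedT (.var 0)) (allowedT (.var 1))))).exec p ρ m := ⟨_, rfl⟩
  rw [← hm₁]
  have fr : ∀ a, a ≠ 10 → a ≠ 12 → m₁ a = m a := fun a h1 h2 => by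
    rw [hm₁]; exact Cmd.exec_frame _ (by simp [closure_writes, h1, h2]) ρ m
  have h12 : ∀ a b, rel m₁ (p 3) 12 a b ↔ a < p 3 ∧ b < p 3 ∧
      Conn (Res G (Allowed X W S lab (ρ 10))) a b := by
    intro a b
    rw [hm₁]
    refine closure_spec (by norm_num) hN _ (fun i j => ?_) a b
    have key : ∀ i j, i < p 3 → j < p 3 →
        ((Tm.and (.get 0 (.var 0) (.var 1)) (.and (allowedT (.var 0)) (allowedT (.var 1)))).tr p m
          (Function.update (Function.update ρ 0 i) 1 j) ↔ m 0 i j ≠ 0 ∧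
            Allowed X W S lab (ρ 10) i ∧ Allowed X W S lab (ρ 10) j) := by
      intro i j hi hj
      rw [Tm.tr_and, Tm.tr_and, tr_allowedT hE hT hX (l := l) (by simpa using hl)
        (by simpa using hq) hlab hW (by norm_num) (by simpa using hi), tr_allowedT hE hT hX (l := l)
        (by simpa using hl) (by simpa using hq) hlab hW (by norm_num) (by simpa using hj)]
      simp [S, lab]
    constructor
    · rintro ⟨h1, h2⟩
      rw [← hE.graph] at h1
      exact ⟨h1.1, h1.2.1, (key i j h1.1 h1.2.1).mpr ⟨h1.2.2, h2⟩⟩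
    · rintro ⟨hi, hj, h⟩
      obtain ⟨h1, h2⟩ := (key i j hi hj).mp h
      exact ⟨by rw [← hE.graph]; exact ⟨hi, hj, h1⟩, h2⟩
  have hE₁ : Env (p 3) m₁ G U d L M := hE.congr fun a ha => fr a
    (by rintro rfl; simp at ha) (by rintro rfl; simp at ha)
  have hT₁ : rel m₁ (p 3) 6 = T := (rel_congr (fr 6 (by norm_num) (by norm_num))).trans hT
  have hX₁ : col m₁ (p 3) 5 = X := (col_congr (fr 5 (by norm_num) (by norm_num))).trans hX
  have h11₁ : ∀ a b, rel m₁ (p 3) 11 a b ↔ a < p 3 ∧ b < p 3 ∧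
      Conn (Res G fun v => v ∈ X ∧ ¬W v) a b := by
    rw [rel_congr (fr 11 (by norm_num) (by norm_num))]; exact h11
  rw [exec_fill (by omega) (by omega)]
  rw [← Tm.tr_iff, Tm.tr_or, Tm.tr_cell, fr 19 (by norm_num) (by norm_num)]
  refine or_congr_right ?_
  rw [neededT, Tm.tr_and, tr_selT hE₁ (by simpa using hq) (by simpa using hc)]
  refine and_congr (by simp [S]) ?_
  rw [Tm.tr_ex]
  have key : ∀ w w', w < p 3 → w' < p 3 → ((Tm.and (selT (.var 20))
      (.and (selT (.var 22)) (.and (touchT (.var 20)) (.and (touchT (.var 22))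
      (.not (.get 12 (.var 20) (.var 22))))))).tr p m₁ (Function.update (Function.update
        (Function.update (Function.update ρ 0 0) 1 0) 20 w) 22 w') ↔
      S w ∧ S w' ∧ Touches G X W (ρ 10) w ∧ Touches G X W (ρ 10) w' ∧
        ¬Conn (Res G (Allowed X W S lab (ρ 10))) w w') := by
    intro w w' hw hw'
    have h := h12 w w'
    simp only [rel, hw, hw', true_and] at h
    simp only [Tm.tr_and, Tm.tr_not]
    rw [tr_selT hE₁ (by simpa using hq) (by simpa using hw),
      tr_selT hE₁ (by simpa using hq) (by simpa using hw'),
      tr_touchT hE₁ hT₁ hX₁ (l := l) (by simpa using hl) hW h11₁ (by simpa using hc) (by norm_num)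
        (by norm_num) (by simpa using hw),
      tr_touchT hE₁ hT₁ hX₁ (l := l) (by simpa using hl) hW h11₁ (by simpa using hc) (by norm_num)
        (by norm_num) (by simpa using hw'), ← h]
    simp [S]
  have hlt : ∀ {w}, Touches G X W (ρ 10) w → w < p 3 := by
    intro w hw
    have := hw.1
    rw [← hX, mem_col] at this
    exact this.1
  constructor
  · rintro ⟨w, hw, h⟩
    obtain ⟨w', hw', h⟩ := Tm.tr_ex.mp h
    exact ⟨w, w', (key w w' hw hw').mp h⟩
  · rintro ⟨w, w', h⟩
    have hw := hlt h.2.2.1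
    have hw' := hlt h.2.2.2.1
    exact ⟨w, hw, Tm.tr_ex.mpr ⟨w', hw', (key w w' hw hw').mpr h⟩⟩

/-- A loop whose body may set the flag in array `a`. -/
theorem loop_flag {c : Cmd} {a k : ℕ} (I : Mem → Prop) (Q : ℕ → Prop)
    (hc : ∀ i < p 3, ∀ s, I s → I (c.exec p (Function.update ρ k i) s) ∧
      (c.exec p (Function.update ρ k i) s a 0 0 ≠ 0 ↔ s a 0 0 ≠ 0 ∨ Q i)) (hm : I m) :
    I ((Cmd.loop k c).exec p ρ m) ∧
      ((Cmd.loop k c).exec p ρ m a 0 0 ≠ 0 ↔ m a 0 0 ≠ 0 ∨ ∃ i < p 3, Q i) := by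
  refine loopN_induct (fun i s => I s ∧ (s a 0 0 ≠ 0 ↔ m a 0 0 ≠ 0 ∨ ∃ j < i, Q j)) ?_
    ⟨hm, by simp⟩
  rintro i hi s ⟨h1, h2⟩
  obtain ⟨h3, h4⟩ := hc i hi s h1
  refine ⟨h3, ?_⟩
  rw [h4, h2, or_assoc]
  refine or_congr_right ⟨?_, ?_⟩
  · rintro (⟨j, hj, h⟩ | h)
    · exact ⟨j, by omega, h⟩
    · exact ⟨i, by omega, h⟩
  · rintro ⟨j, hj, h⟩
    rcases Nat.lt_succ_iff_lt_or_eq.mp hj with h5 | rfl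
    · exact Or.inl ⟨j, h5, h⟩
    · exact Or.inr h

theorem needC_writes : needC.writes = [10, 12, 12, 19] := rfl

open Classical in
/-- The component of the vertex in variable `10` is removed from `X` if it is redundant, and nothing
is removed otherwise. -/
theorem dropC_spec (hN : 2 ≤ p 3) (hG : Symm G) (hE : Env (p 3) m G U d L M)
    (hT : rel m (p 3) 6 = T)
    (hX : col m (p 3) 5 = X) (hl : d + ρ 9 = l) (hc : ρ 10 < p 3) {W : ℕ → Prop}
    (hW : ∀ v, W v ↔ l ≤ deg T (p 3) v) :
    col (dropC.exec p ρ m) (p 3) 5 =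
      if Redundant G X W U (p 3) M (ρ 10) then
        X.filter fun v => ¬Conn (Res G fun v => v ∈ X ∧ ¬W v) (ρ 10) v
      else X := by
  set r := Res G fun v => v ∈ X ∧ ¬W v with hr
  have hrs : Symm r := hG.res
  have hXN : ∀ {v}, v ∈ X → v < p 3 := fun hv => by
    rw [← hX, mem_col] at hv; exact hv.1
  obtain ⟨m₁, hm₁⟩ : ∃ m₁, m₁ = (closure 11 (.and (.get 0 (.var 0) (.var 1))
    (.and (outT (.var 0)) (outT (.var 1))))).exec p ρ m := ⟨_, rfl⟩
  have fr₁ : ∀ a, a ≠ 10 → a ≠ 11 → m₁ a = m a := fun a h1 h2 => by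
    rw [hm₁]; exact Cmd.exec_frame _ (by simp [closure_writes, h1, h2]) ρ m
  have hout : ∀ (m' : Mem) (ρ' : ℕ → ℕ) k, k ≠ 21 → ρ' 9 = ρ 9 → m' 24 = m 24 →
      rel m' (p 3) 6 = T → col m' (p 3) 5 = X → ρ' k < p 3 →
      ((outT (.var k)).tr p m' ρ' ↔ ρ' k ∈ X ∧ ¬W (ρ' k)) := by
    intro m' ρ' k hk h9 h24 h6 h5 h
    rw [tr_outT (by simp [hk]) (by simpa using h), h6, h5, h24, h9, hE.base, hl]
    simp [hW]
  have h11 : ∀ a b, rel m₁ (p 3) 11 a b ↔ a < p 3 ∧ b < p 3 ∧ Conn r a b := by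
    intro a b
    rw [hm₁]
    refine closure_spec (by norm_num) hN _ (fun i j => ?_) a b
    have key : ∀ i j, i < p 3 → j < p 3 →
        ((Tm.and (.get 0 (.var 0) (.var 1)) (.and (outT (.var 0)) (outT (.var 1)))).tr p m
          (Function.update (Function.update ρ 0 i) 1 j) ↔ m 0 i j ≠ 0 ∧
            (i ∈ X ∧ ¬W i) ∧ (j ∈ X ∧ ¬W j)) := by
      intro i j hi hj
      rw [Tm.tr_and, Tm.tr_and, hout m _ 0 (by norm_num) (by simp) rfl hT hX (by simpa using hi),
        hout m _ 1 (by norm_num) (by simp) rfl hT hX (by simpa using hj)]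
      simp
    constructor
    · rintro ⟨h1, h2⟩
      rw [← hE.graph] at h1
      exact ⟨h1.1, h1.2.1, (key i j h1.1 h1.2.1).mpr ⟨h1.2.2, h2⟩⟩
    · rintro ⟨hi, hj, h⟩
      obtain ⟨h1, h2⟩ := (key i j hi hj).mp h
      exact ⟨by rw [← hE.graph]; exact ⟨hi, hj, h1⟩, h2⟩
  obtain ⟨m₂, hm₂⟩ : ∃ m₂, m₂ = (Cmd.fill 18 (.least 20 22
    (.get 11 (.var 0) (.var 20)))).exec p ρ m₁ := ⟨_, rfl⟩
  have fr₂ : ∀ a, a ≠ 18 → m₂ a = m₁ a := fun a h1 => by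
    rw [hm₂]; exact Cmd.exec_frame _ (by simp [Cmd.writes, h1]) ρ m₁
  set lab : ℕ → ℕ := fun u => m₂ 18 u 0 with hlabdef
  have h18 : ∀ u < p 3, Tm.IsLeast (p 3) (fun y => Conn r u y) (lab u) := by
    intro u hu
    rw [hlabdef]
    simp only [hm₂]
    rw [exec_fill hu (by omega)]
    refine Tm.ev_least (by norm_num) _ fun i k hi _ => ?_
    have := h11 u i
    simp only [rel, hu, hi, true_and] at this
    simpa using this
  have hlabN : ∀ u < p 3, lab u < p 3 := fun u hu => ((h18 u hu).min u hu .refl).trans_lt hu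
  have hlabc : ∀ u < p 3, Conn r u (lab u) := fun u hu => (h18 u hu).holds (hlabN u hu)
  have hlab : IsLabel G X W lab := by
    intro u hu hWu
    have huN := hXN hu
    refine ⟨Finset.mem_filter.mpr ⟨?_, fun y hy hyc => ?_⟩, hlabc u huN⟩
    · exact Finset.mem_filter.mpr ((hlabc u huN).of_res_right ⟨hu, hWu⟩)
    · exact (h18 u huN).min y (hXN (Finset.mem_filter.mp hy).1) ((hlabc u huN).trans hyc)
  have hreps : ∀ c < p 3, c ∈ reps r (X.filter fun v => ¬W v) ↔ (c ∈ X ∧ ¬W c) ∧ lab c = c := by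
    intro c hc
    constructor
    · intro h
      have hcX := Finset.mem_filter.mp (Finset.mem_filter.mp h).1
      exact ⟨hcX, hlab.eq_of_conn hG h .refl⟩
    · rintro ⟨h1, h2⟩
      rw [← h2]
      exact (hlab c h1.1 h1.2).1
  obtain ⟨m₃, hm₃⟩ : ∃ m₃, m₃ = (Cmd.fill 19 (.lit 0)).exec p ρ m₂ := ⟨_, rfl⟩
  have fr₃ : ∀ a, a ≠ 19 → m₃ a = m₂ a := fun a h1 => by
    rw [hm₃]; exact Cmd.exec_frame _ (by simp [Cmd.writes, h1]) ρ m₂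
  have h19₃ : m₃ 19 0 0 = 0 := by rw [hm₃, exec_fill (by omega) (by omega), Tm.ev_lit]
  have frm : ∀ a, a ≠ 10 → a ≠ 11 → a ≠ 18 → a ≠ 19 → m₃ a = m a := fun a h1 h2 h3 h4 =>
    (fr₃ a h4).trans ((fr₂ a h3).trans (fr₁ a h1 h2))
  obtain ⟨m₄, hm₄⟩ : ∃ m₄, m₄ = (Cmd.loop 11 (.loop 12 (.loop 13 (.loop 14
    needC)))).exec p ρ m₃ := ⟨_, rfl⟩
  let I : Mem → Prop := fun s => ∀ a, a ≠ 10 → a ≠ 12 → a ≠ 19 → s a = m₃ a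
  have hIn : ∀ ρ' s, I s → I (needC.exec p ρ' s) := fun ρ' s hs a h1 h2 h3 => by
    rw [Cmd.exec_frame _ (by simp [needC_writes, h1, h2, h3])]
    exact hs a h1 h2 h3
  have hloop : I m₄ ∧ (m₄ 19 0 0 ≠ 0 ↔ m₃ 19 0 0 ≠ 0 ∨ ∃ q < p 3, ∃ y₁ < p 3, ∃ y₂ < p 3,
      ∃ y₃ < p 3, (q ≤ M ∧ y₁ ≤ M ∧ y₂ ≤ M ∧ y₃ ≤ M) ∧ Needed G X W
        (fun e => e % q = y₁ ∨ e % q = y₂ ∨ e % q = y₃) lab (ρ 10)) := by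
    rw [hm₄]
    refine loop_flag I _ (fun q hq s hs => ?_) (fun _ _ _ _ => rfl)
    refine loop_flag I _ (fun y₁ hy₁ s hs => ?_) hs
    refine loop_flag I _ (fun y₂ hy₂ s hs => ?_) hs
    refine loop_flag I _ (fun y₃ hy₃ s hs => ?_) hs
    refine ⟨hIn _ _ hs, ?_⟩
    have hfr : ∀ a, a ≠ 10 → a ≠ 11 → a ≠ 12 → a ≠ 18 → a ≠ 19 → s a = m a :=
      fun a h1 h2 h3 h4 h5 => (hs a h1 h3 h5).trans (frm a h1 h2 h4 h5)
    have h18s : s 18 = m₂ 18 := (hs 18 (by norm_num) (by norm_num) (by norm_num)).trans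
      (fr₃ 18 (by norm_num))
    have h11s : s 11 = m₁ 11 := (hs 11 (by norm_num) (by norm_num) (by norm_num)).trans
      ((fr₃ 11 (by norm_num)).trans (fr₂ 11 (by norm_num)))
    have := needC_spec (p := p) (m := s) (ρ := Function.update (Function.update (Function.update
      (Function.update ρ 11 q) 12 y₁) 13 y₂) 14 y₃) (G := G) (T := T) (X := X) (U := U)
      (d := d) (L := L) (M := M) (l := l) (W := W) hN
      (hE.congr fun a ha => hfr a (by rintro rfl; simp at ha) (by rintro rfl; simp at ha)
        (by rintro rfl; simp at ha) (by rintro rfl; simp at ha) (by rintro rfl; simp at ha))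
      (by rw [← hT]; exact rel_congr (hfr 6 (by norm_num) (by norm_num) (by norm_num)
        (by norm_num) (by norm_num)))
      (by rw [← hX]; exact col_congr (hfr 5 (by norm_num) (by norm_num) (by norm_num)
        (by norm_num) (by norm_num))) (by simpa using hl) hW
      (by rw [rel_congr h11s]; exact h11) (by rw [h18s]; exact hlabN) (by simpa using hc)
      (by simpa using hq)
    rw [this]
    simp only [h18s, Function.update_self,
      Function.update_of_ne (show (10 : ℕ) ≠ 14 by norm_num),
      Function.update_of_ne (show (10 : ℕ) ≠ 13 by norm_num),
      Function.update_of_ne (show (10 : ℕ) ≠ 12 by norm_num),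
      Function.update_of_ne (show (10 : ℕ) ≠ 11 by norm_num),
      Function.update_of_ne (show (11 : ℕ) ≠ 14 by norm_num),
      Function.update_of_ne (show (11 : ℕ) ≠ 13 by norm_num),
      Function.update_of_ne (show (11 : ℕ) ≠ 12 by norm_num),
      Function.update_of_ne (show (12 : ℕ) ≠ 14 by norm_num),
      Function.update_of_ne (show (12 : ℕ) ≠ 13 by norm_num),
      Function.update_of_ne (show (13 : ℕ) ≠ 14 by norm_num)]
    rfl
  obtain ⟨hI₄, h19⟩ := hloop
  have fr₄ : ∀ a, a ≠ 10 → a ≠ 11 → a ≠ 12 → a ≠ 18 → a ≠ 19 → m₄ a = m a :=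
    fun a h1 h2 h3 h4 h5 => (hI₄ a h1 h3 h5).trans (frm a h1 h2 h4 h5)
  have h18₄ : m₄ 18 = m₂ 18 := (hI₄ 18 (by norm_num) (by norm_num) (by norm_num)).trans
    (fr₃ 18 (by norm_num))
  have h11₄ : ∀ {a b}, a < p 3 → b < p 3 → (m₄ 11 a b ≠ 0 ↔ Conn r a b) := by
    intro a b ha hb
    rw [(hI₄ 11 (by norm_num) (by norm_num) (by norm_num)).trans
      ((fr₃ 11 (by norm_num)).trans (fr₂ 11 (by norm_num)))]
    have := h11 a b
    simpa only [rel, ha, hb, true_and] using this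
  have hT₄ : rel m₄ (p 3) 6 = T := by
    rw [← hT]; exact rel_congr (fr₄ 6 (by norm_num) (by norm_num) (by norm_num)
      (by norm_num) (by norm_num))
  have hX₄ : col m₄ (p 3) 5 = X := by
    rw [← hX]; exact col_congr (fr₄ 5 (by norm_num) (by norm_num) (by norm_num)
      (by norm_num) (by norm_num))
  have hU₄ : col m₄ (p 3) 4 = U := by
    rw [← hE.terms]; exact col_congr (fr₄ 4 (by norm_num) (by norm_num) (by norm_num)
      (by norm_num) (by norm_num))
  have hcond : (Tm.and (outT (.var 10)) (.and (.eq (.vec 18 (.var 10)) (.var 10))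
      (.and (.not (.ex 20 (.and (.vec 4 (.var 20)) (.get 11 (.var 10) (.var 20)))))
        (.not (.cell 19))))).tr p m₄ ρ ↔ Redundant G X W U (p 3) M (ρ 10) := by
    rw [Tm.tr_and, Tm.tr_and, Tm.tr_and, hout m₄ ρ 10 (by norm_num) rfl (fr₄ 24 (by norm_num)
      (by norm_num) (by norm_num) (by norm_num) (by norm_num)) hT₄ hX₄ hc, ← and_assoc]
    refine and_congr ?_ (and_congr ?_ ?_)
    · rw [hreps _ hc]
      simp [h18₄, lab]
    · simp only [Tm.tr_not, Tm.tr_ex, Tm.tr_and, Tm.tr_vec, Tm.tr_get, Tm.ev_var,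
        Function.update_self, Function.update_of_ne (show (10 : ℕ) ≠ 20 by norm_num)]
      constructor
      · intro h u hu hcu
        rw [← hU₄, mem_col] at hu
        exact h ⟨u, hu.1, hu.2, (h11₄ hc hu.1).mpr hcu⟩
      · rintro h ⟨u, hu, h1, h2⟩
        exact h u (by rw [← hU₄, mem_col]; exact ⟨hu, h1⟩) ((h11₄ hc hu).mp h2)
    · rw [Tm.tr_not, Tm.tr_cell, h19]
      simp only [h19₃, ne_eq, not_true_eq_false, false_or]
      constructor
      · rintro h lab' hlab' S ⟨q, hq, y₁, hy₁, y₂, hy₂, y₃, hy₃, hM, rfl⟩ hn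
        exact h ⟨q, hq, y₁, hy₁, y₂, hy₂, y₃, hy₃, hM, hlab'.needed_congr hG hlab hn⟩
      · rintro h ⟨q, hq, y₁, hy₁, y₂, hy₂, y₃, hy₃, hM, hn⟩
        exact h lab hlab _ ⟨q, hq, y₁, hy₁, y₂, hy₂, y₃, hy₃, hM, rfl⟩ hn
  have hexec : dropC.exec p ρ m = (Cmd.cond (.and (outT (.var 10))
      (.and (.eq (.vec 18 (.var 10)) (.var 10))
      (.and (.not (.ex 20 (.and (.vec 4 (.var 20)) (.get 11 (.var 10) (.var 20)))))
        (.not (.cell 19))))) (.fill 5 (.and (.vec 5 (.var 0))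
        (.not (.get 11 (.var 10) (.var 0)))))).exec p ρ m₄ := by
    rw [hm₄, hm₃, hm₂, hm₁]; rfl
  rw [hexec, Cmd.exec]
  split_ifs with h1 h2 h2
  · ext v
    rw [mem_col_fill (by omega)]
    simp only [Tm.tr_and, Tm.tr_vec, Tm.tr_not, Tm.tr_get, Tm.ev_var, Finset.mem_filter]
    rw [← hX₄, mem_col]
    simp only [update_zero_one, Function.update_of_ne (show (10 : ℕ) ≠ 1 by norm_num),
      Function.update_of_ne (show (10 : ℕ) ≠ 0 by norm_num), and_assoc]
    refine and_congr_right fun hv => and_congr_right fun _ => not_congr ?_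
    exact h11₄ hc hv
  · exact absurd (hcond.mp h1) h2
  · exact absurd (hcond.mpr h2) h1
  · exact hX₄

end

/-! ### The rounds of the algorithm -/

/-- Restriction to the vertices in `X` does not change the connectivity of vertices of `U` after
removal of at most `f` vertices. -/
structure Keeps (G : ℕ → ℕ → Prop) (U : Finset ℕ) (n f : ℕ) (X : Finset ℕ) : Prop where
  sub : X ⊆ Finset.range n
  terms : U ⊆ X
  conn : ∀ F : Finset ℕ, F.card ≤ f → ∀ a ∈ U, ∀ b ∈ U, Conn (Res G fun v => v ∉ F) a b →
    Conn (Res G fun v => v ∈ X ∧ v ∉ F) a b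

section

variable {G T : ℕ → ℕ → Prop} {X U : Finset ℕ} {n f d L M l : ℕ}

open Classical in
theorem Redundant.mem {W : ℕ → Prop} {N c : ℕ} (h : Redundant G X W U N M c) : c ∈ X :=
  (Finset.mem_filter.mp (Finset.mem_filter.mp h.1).1).1

theorem exists_isLabel (G : ℕ → ℕ → Prop) (X : Finset ℕ) (W : ℕ → Prop) :
    ∃ lab, IsLabel G X W lab := by
  classical
  have h : ∀ u, ∃ c, u ∈ X → ¬W u →
      c ∈ reps (Res G fun v => v ∈ X ∧ ¬W v) (X.filter fun v => ¬W v) ∧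
        Conn (Res G fun v => v ∈ X ∧ ¬W v) u c := by
    intro u
    by_cases hu : u ∈ X ∧ ¬W u
    · obtain ⟨c, hc⟩ := exists_rep (r := Res G fun v => v ∈ X ∧ ¬W v)
        (A := X.filter fun v => ¬W v) (Finset.mem_filter.mpr hu)
      exact ⟨c, fun _ _ => hc⟩
    · exact ⟨0, fun h1 h2 => absurd ⟨h1, h2⟩ hu⟩
  choose lab hlab using h
  exact ⟨lab, fun u hu hW => by convert hlab u hu hW⟩

open Classical in
/-- Redundant components can be removed from `X`. -/
theorem Keeps.drop (hK : Keeps G U n f X) (hG : Symm G) (hL : n < 2 ^ L)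
    (hM : n + 1 ≤ M ∨ 2 * (3 * f * L + 1) ^ 2 ≤ M) {W : ℕ → Prop} {c : ℕ}
    (hr : Redundant G X W U (n + 2) M c) :
    Keeps G U n f (X.filter fun v => ¬Conn (Res G fun v => v ∈ X ∧ ¬W v) c v) where
  sub := (Finset.filter_subset _ _).trans hK.sub
  terms := fun u hu => Finset.mem_filter.mpr ⟨hK.terms hu, hr.2.1 u hu⟩
  conn := by
    intro F hF a ha b hb hab
    obtain ⟨lab, hlab⟩ := exists_isLabel G X W
    have h := conn_drop hG hK.sub hlab hr.1 (residueSets (n + 2) M)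
      (fun F a b c h1 h2 h3 h4 h5 h6 h7 h8 => exists_residueSet hL hM F a b c h1 h2 h3 h4 h5 h6
        h7 h8) (hr.2.2 lab hlab) F hF (hr.2.1 a ha) (hr.2.1 b hb) (hK.conn F hF a ha b hb hab)
    simpa only [Finset.mem_filter] using h

/-- The result of a successful round: the new set `B`, and a forest of small degree on `V` whose
components contain all edges of `G[X]` that avoid `B`. -/
structure Sol (G : ℕ → ℕ → Prop) (U : Finset ℕ) (n f D : ℕ) (B V : Finset ℕ) (T : ℕ → ℕ → Prop) :
    Prop where
  forest : ForestInv G V (n + 2) D T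
  half : 2 * B.card ≤ U.card
  exists_keeps : ∃ X, Keeps G U n f X ∧ B ⊆ X ∧ V ⊆ X ∧ (∀ x ∈ X, x ∈ B ∨ x ∈ V) ∧
    ∀ x ∈ X, ∀ y ∈ X, G x y → x ∉ B → y ∉ B → Conn T x y

open Classical in
/-- If `T` is locally optimal at level `l`, and few vertices have degree at least `l`, then these
vertices and the components of `T` on the vertices of degree at most `l` form a solution. -/
theorem LocalOpt.sol {D : ℕ} (hK : Keeps G U n f X) (hF : ForestInv G X (n + 2) D T)
    (hopt : LocalOpt G T X (n + 2) l)
    (hhalf : 2 * (X.filter fun v => l ≤ deg T (n + 2) v).card ≤ U.card) :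
    Sol G U n f D (X.filter fun v => l ≤ deg T (n + 2) v)
      (X.filter fun v => deg T (n + 2) v ≤ l)
      (Res T fun v => v ∈ X ∧ deg T (n + 2) v ≤ l) where
  forest := ⟨hF.symm.res, hF.acy.anti fun _ _ h => h.1, fun a b h => hF.sub a b h.1,
    fun a b h => Finset.mem_filter.mpr h.2.1, fun a b h => Finset.mem_filter.mpr h.2.2,
    fun v => (deg_mono (fun _ _ h => h.1) _ v).trans (hF.deg_le v)⟩
  half := hhalf
  exists_keeps := by
    refine ⟨X, hK, Finset.filter_subset _ _, Finset.filter_subset _ _, fun x hx => ?_,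
      fun x hx y hy hxy hxB hyB => ?_⟩
    · simp only [Finset.mem_filter, hx, true_and]
      exact le_total _ _
    · simp only [Finset.mem_filter, hx, hy, true_and, not_le] at hxB hyB
      exact hopt x y hxy hx hy hxB hyB

/-- There are few components with a vertex of `U`. -/
theorem card_reps_with_terms (hG : Symm G) (W : ℕ → Prop) (R : Finset ℕ)
    (hR : ∀ c ∈ R, ∀ c' ∈ R, Conn (Res G W) c c' → c = c')
    (hU : ∀ c ∈ R, ∃ u ∈ U, Conn (Res G W) c u) : R.card ≤ U.card := by
  choose! g hg hc using hU
  refine Finset.card_le_card_of_injOn g hg fun c hcR c' hcR' h => ?_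
  refine hR c hcR c' hcR' ((hc c hcR).trans ?_)
  rw [h]
  exact (hc c' hcR').symm hG.res

open Classical in
/-- If no level of the local optimum gives a small enough set `B`, then the numbers of vertices of
high degree decrease slowly from some level to the next, hence there are so many components that
one of them is redundant. -/
theorem exists_redundant {N D : ℕ} (hG : Symm G) (hX : X ⊆ Finset.range n) (hnN : n ≤ N)
    (hF : ForestInv G X N D T) (hopt : ∀ j ≤ L, LocalOpt G T X N (d + j)) (hL : n < 2 ^ L)
    (hd : d = 2 * ((Finset.range N).filter fun q => q ≤ M).card ^ 4 + 8)
    (hlarge : ∀ j ≤ L, U.card < 2 * (X.filter fun v => d + j ≤ deg T N v).card) :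
    ∃ j ≤ L, ∃ c < N, Redundant G X (fun v => d + j ≤ deg T N v) U N M c := by
  set w : ℕ → ℕ := fun j => (X.filter fun v => d + j ≤ deg T N v).card with hw
  have hXN : X ⊆ Finset.range N := hX.trans (Finset.range_subset_range.mpr hnN)
  -- Otherwise `w` would decrease from at most `n` to less than one in `L` steps.
  have hslow : ∃ j < L, w j ≤ 2 * w (j + 1) := by
    by_contra! hlt
    have h1 : ∀ j ≤ L, 2 ^ j * w j ≤ w 0 := by
      intro j
      induction j with
      | zero => simp
      | succ j ih =>
        intro hj
        have h1 := ih (by omega)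
        have h2 := Nat.mul_le_mul_left (2 ^ j) (hlt j (by omega)).le
        rw [pow_succ, mul_assoc]
        exact h2.trans h1
    have h2 := h1 L le_rfl
    have h3 : 1 ≤ w L := by
      have h : U.card < 2 * w L := hlarge L le_rfl
      omega
    have h4 : w 0 ≤ n := (Finset.card_filter_le _ _).trans
      ((Finset.card_le_card hX).trans (by simp))
    have h5 := Nat.le_mul_of_pos_right (2 ^ L) h3
    omega
  obtain ⟨j, hj, hwj⟩ := hslow
  refine ⟨j, hj.le, ?_⟩
  set l := d + j with hl
  set W : ℕ → Prop := fun v => l ≤ deg T N v with hW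
  set R := reps (Res G fun v => v ∈ X ∧ ¬W v) (X.filter fun v => ¬W v) with hR
  have hcard : ((Finset.range N).filter fun q => q ≤ M).card ^ 4 * w j + U.card < R.card := by
    set K := ((Finset.range N).filter fun q => q ≤ M).card ^ 4
    have h1 := card_reps_remove_high (l := l) hXN hF.symm hF.acy hF.left
    have h2 := card_reps_le_of_localOpt hF.symm (hopt j hj.le)
    have h3 : (X.filter fun v => l < deg T N v).card = w (j + 1) := by
      rw [hw]; simp only [hl, Nat.lt_iff_add_one_le, add_assoc]
    have h4 : (reps (Res G fun v => v ∈ X ∧ deg T N v < l) (X.filter fun v => deg T N v < l)) =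
        R := by
      rw [hR]; simp only [hW, not_le]
    rw [h3] at h1 h2
    rw [h4] at h2
    have h5 : U.card < 2 * w j := hlarge j hj.le
    change _ + w (j + 1) ≤ _ + w j at h2
    rw [← hl] at h2
    have h6 : (2 * K + 9) * w (j + 1) ≤ (l + 1) * w (j + 1) :=
      Nat.mul_le_mul_right _ (by omega)
    have h7 : K * w j ≤ K * (2 * w (j + 1)) := Nat.mul_le_mul_left _ hwj
    nlinarith
  obtain ⟨lab, hlab⟩ := exists_isLabel G X W
  set A := (Finset.range N).filter fun q => q ≤ M
  let S : ℕ × ℕ × ℕ × ℕ → ℕ → Prop := fun q e =>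
    e % q.1 = q.2.1 ∨ e % q.1 = q.2.2.1 ∨ e % q.1 = q.2.2.2
  -- `R₁` are the components with a vertex of `U`, and `R₂` those needed for some residue set.
  set R₁ := R.filter fun c => ∃ u ∈ U, Conn (Res G fun v => v ∈ X ∧ ¬W v) c u
  set R₂ := (A ×ˢ A ×ˢ A ×ˢ A).biUnion fun q => R.filter fun c => Needed G X W (S q) lab c
  have hR₁ : R₁.card ≤ U.card := card_reps_with_terms hG _ R₁
    (fun c hc c' hc' h => rep_unique hG.res (Finset.mem_filter.mp hc).1
      (Finset.mem_filter.mp hc').1 h) (fun c hc => (Finset.mem_filter.mp hc).2)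
  have hR₂ : R₂.card ≤ A.card ^ 4 * w j := by
    have h : (A ×ˢ A ×ˢ A ×ˢ A).card = A.card ^ 4 := by
      simp only [Finset.card_product]; ring
    rw [← h]
    refine Finset.card_biUnion_le_card_mul _ _ _ fun q _ => ?_
    convert card_needed_le hG hlab
  have hne : ∃ c ∈ R, c ∉ R₁ ∪ R₂ := by
    refine Finset.exists_mem_notMem_of_card_lt_card ?_
    have := Finset.card_union_le R₁ R₂
    omega
  obtain ⟨c, hcR, hc⟩ := hne
  rw [Finset.mem_union, not_or] at hc
  have hcX := (Finset.mem_filter.mp (Finset.mem_filter.mp hcR).1).1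
  refine ⟨c, Finset.mem_range.mp (hXN hcX), by convert hcR, fun u hu hcu => hc.1 ?_, ?_⟩
  · exact Finset.mem_filter.mpr ⟨hcR, u, hu, hcu⟩
  · rintro lab' hlab' _ ⟨q, hq, y₁, hy₁, y₂, hy₂, y₃, hy₃, hM, rfl⟩ hn
    refine hc.2 (Finset.mem_biUnion.mpr ⟨(q, y₁, y₂, y₃), ?_, ?_⟩)
    · simp only [A, Finset.mem_product, Finset.mem_filter, Finset.mem_range]
      tauto
    · exact Finset.mem_filter.mpr ⟨hcR, hlab'.needed_congr hG hlab hn⟩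

end

/-- Removal of redundant components at all levels. -/
def dropAllC : Cmd := .loop 9 (.cond (.le (.var 9) (.cell 7)) (.loop 10 dropC))

/-- Recording of the result, if it is good enough at some level. -/
def recordC : Cmd := .loop 9 (.cond (.le (.var 9) (.cell 7))
  (.cond (.le (.add (.count 20 (.and (.vec 5 (.var 20)) (.not (ltLvl (.var 20)))))
      (.count 20 (.and (.vec 5 (.var 20)) (.not (ltLvl (.var 20))))))
      (.count 20 (.vec 4 (.var 20))))
    (.seq (.fill 20 (.and (.vec 5 (.var 0)) (.not (ltLvl (.var 0)))))
    (.seq (.fill 21 (lowT (.var 0)))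
      (.fill 22 (.and (.get 6 (.var 0) (.var 1)) (.and (lowT (.var 0)) (lowT (.var 1)))))))))

/-- A round: local search, recording and removal of redundant components. -/
def roundC : Cmd := .seq searchC (.seq recordC dropAllC)

section

variable {p : Fin 4 → ℕ} {m : Mem} {ρ : ℕ → ℕ} {G T : ℕ → ℕ → Prop} {X U : Finset ℕ}
  {n f d L M : ℕ}

theorem dropC_writes : dropC.writes = [10, 11, 11, 18, 19, 10, 12, 12, 19, 5] := rfl

theorem dropAllC_writes : dropAllC.writes = [10, 11, 11, 18, 19, 10, 12, 12, 19, 5] := rfl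

theorem recordC_writes : recordC.writes = [20, 21, 22] := rfl

theorem dropC_frame {a : ℕ} (ha : a ∉ [5, 10, 11, 12, 18, 19]) : dropC.exec p ρ m a = m a :=
  Cmd.exec_frame _ (by rw [dropC_writes]; simp at ha ⊢; tauto) ρ m

/-- The removal of components keeps the invariant. If nothing is removed, then there is no redundant
component at any level. -/
theorem dropAllC_spec (hN : p 3 = n + 2) (hG : Symm G) (hE : Env (p 3) m G U d L M)
    (hT : rel m (p 3) 6 = T) (hX : col m (p 3) 5 = X) (hL : n < 2 ^ L)
    (hM : n + 1 ≤ M ∨ 2 * (3 * f * L + 1) ^ 2 ≤ M) (hLN : L < p 3) (hK : Keeps G U n f X) :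
    Keeps G U n f (col (dropAllC.exec p ρ m) (p 3) 5) ∧
      col (dropAllC.exec p ρ m) (p 3) 5 ⊆ X ∧
      (col (dropAllC.exec p ρ m) (p 3) 5 = X → ∀ j ≤ L, ∀ c < p 3,
        ¬Redundant G X (fun v => d + j ≤ deg T (p 3) v) U (p 3) M c) := by
  classical
  let I : Mem → Prop := fun s => Env (p 3) s G U d L M ∧ rel s (p 3) 6 = T ∧
    Keeps G U n f (col s (p 3) 5) ∧ col s (p 3) 5 ⊆ X
  have hdrop : ∀ ρ' s, I s → ρ' 10 < p 3 → I (dropC.exec p ρ' s) ∧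
      col (dropC.exec p ρ' s) (p 3) 5 ⊆ col s (p 3) 5 ∧
      (col (dropC.exec p ρ' s) (p 3) 5 = X →
        ¬Redundant G X (fun v => d + ρ' 9 ≤ deg T (p 3) v) U (p 3) M (ρ' 10)) := by
    rintro ρ' s ⟨i1, i2, i3, i4⟩ hc
    have hs := dropC_spec (p := p) (m := s) (ρ := ρ') (by omega) hG i1 i2 rfl rfl hc
      (W := fun v => d + ρ' 9 ≤ deg T (p 3) v) (fun _ => Iff.rfl)
    have hE' : Env (p 3) (dropC.exec p ρ' s) G U d L M := i1.congr fun a ha =>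
      dropC_frame (by rintro h; fin_cases ha <;> simp at h)
    have hT' : rel (dropC.exec p ρ' s) (p 3) 6 = T := by
      rw [← i2]; exact rel_congr (dropC_frame (by simp))
    split_ifs at hs with hr
    · refine ⟨⟨hE', hT', ?_, ?_⟩, ?_, fun h => ?_⟩
      · rw [hs]
        exact i3.drop hG hL hM (by rw [← hN]; exact hr)
      · rw [hs]
        exact (Finset.filter_subset _ _).trans i4
      · rw [hs]
        exact Finset.filter_subset _ _
      · -- The vertex `c` itself has been removed.
        exfalso
        have hcX := i4 hr.mem
        rw [← h, hs] at hcX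
        exact (Finset.mem_filter.mp hcX).2 .refl
    · refine ⟨⟨hE', hT', by rw [hs]; exact i3, by rw [hs]; exact i4⟩, hs.subset, fun h => ?_⟩
      rw [hs] at h
      rw [← h]
      exact hr
  have hinner : ∀ ρ' s, I s → I ((Cmd.loop 10 dropC).exec p ρ' s) ∧
      col ((Cmd.loop 10 dropC).exec p ρ' s) (p 3) 5 ⊆ col s (p 3) 5 ∧
      (col ((Cmd.loop 10 dropC).exec p ρ' s) (p 3) 5 = X → ∀ c < p 3,
        ¬Redundant G X (fun v => d + ρ' 9 ≤ deg T (p 3) v) U (p 3) M c) := by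
    intro ρ' s hs
    refine loopN_induct (fun i s' => I s' ∧ col s' (p 3) 5 ⊆ col s (p 3) 5 ∧
      (col s' (p 3) 5 = X → ∀ c < i,
        ¬Redundant G X (fun v => d + ρ' 9 ≤ deg T (p 3) v) U (p 3) M c)) ?_
      ⟨hs, subset_rfl, by simp⟩
    rintro i hi s' ⟨h1, h2, h3⟩
    obtain ⟨h4, h5, h6⟩ := hdrop (Function.update ρ' 10 i) s' h1 (by simpa using hi)
    refine ⟨h4, h5.trans h2, fun h c hc => ?_⟩
    rcases Nat.lt_succ_iff_lt_or_eq.mp hc with hc | rfl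
    · exact h3 (h1.2.2.2.antisymm (h ▸ h5)) c hc
    · simpa using h6 h
  have hall : I (dropAllC.exec p ρ m) ∧
      (col (dropAllC.exec p ρ m) (p 3) 5 = X → ∀ j < p 3, j ≤ L → ∀ c < p 3,
        ¬Redundant G X (fun v => d + j ≤ deg T (p 3) v) U (p 3) M c) := by
    refine loopN_induct (fun i s' => I s' ∧
      (col s' (p 3) 5 = X → ∀ j < i, j ≤ L → ∀ c < p 3,
        ¬Redundant G X (fun v => d + j ≤ deg T (p 3) v) U (p 3) M c)) ?_
      ⟨⟨hE, hT, by rw [hX]; exact hK, hX.subset⟩, by simp⟩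
    rintro i hi s' ⟨h1, h3⟩
    have hcond : (Tm.le (.var 9) (.cell 7)).ev p s' (Function.update ρ 9 i) ≠ 0 ↔ i ≤ L := by
      rw [← Tm.tr_iff]
      simp [h1.1.levels]
    rw [Cmd.exec]
    simp only [hcond]
    split_ifs with hiL
    · obtain ⟨h4, h5, h6⟩ := hinner (Function.update ρ 9 i) s' h1
      refine ⟨h4, fun h j hj hjL => ?_⟩
      rcases Nat.lt_succ_iff_lt_or_eq.mp hj with hj | rfl
      · exact h3 (h1.2.2.2.antisymm (h ▸ h5)) j hj hjL
      · simpa using h6 h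
    · exact ⟨h1, fun h j hj hjL => h3 h j (by omega) hjL⟩
  exact ⟨hall.1.2.2.1, hall.1.2.2.2, fun h j hj => hall.2 h j (by omega) hj⟩

open Classical in
/-- A solution gets recorded if some level is successful, and a solution recorded before is kept or
replaced by another one. -/
theorem recordC_spec (hN : p 3 = n + 2) (hE : Env (p 3) m G U d L M)
    (hT : rel m (p 3) 6 = T) (hX : col m (p 3) 5 = X) (hLN : L < p 3) (hK : Keeps G U n f X)
    (hF : ForestInv G X (p 3) (d + L) T) (hopt : ∀ j ≤ L, LocalOpt G T X (p 3) (d + j))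
    (h : Sol G U n f (d + L) (col m (p 3) 20) (col m (p 3) 21) (rel m (p 3) 22) ∨
      ∃ j ≤ L, 2 * (X.filter fun v => d + j ≤ deg T (p 3) v).card ≤ U.card) :
    Sol G U n f (d + L) (col (recordC.exec p ρ m) (p 3) 20) (col (recordC.exec p ρ m) (p 3) 21)
      (rel (recordC.exec p ρ m) (p 3) 22) := by
  let J : Mem → Prop := fun s =>
    Sol G U n f (d + L) (col s (p 3) 20) (col s (p 3) 21) (rel s (p 3) 22)
  have hloop : (∀ a, a ∉ [20, 21, 22] → recordC.exec p ρ m a = m a) ∧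
      (J m ∨ (∃ j < p 3, j ≤ L ∧ 2 * (X.filter fun v => d + j ≤ deg T (p 3) v).card ≤ U.card) →
        J (recordC.exec p ρ m)) := by
    refine loopN_induct (fun i s => (∀ a, a ∉ [20, 21, 22] → s a = m a) ∧
      (J m ∨ (∃ j < i, j ≤ L ∧ 2 * (X.filter fun v => d + j ≤ deg T (p 3) v).card ≤ U.card) →
        J s)) ?_ ⟨fun _ _ => rfl, by simp⟩
    rintro i hi s ⟨hs, hJ⟩
    have hEs : Env (p 3) s G U d L M := hE.congr fun a ha => hs a (by
      intro h; fin_cases ha <;> simp at h)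
    have hTs : rel s (p 3) 6 = T := by rw [← hT]; exact rel_congr (hs 6 (by simp))
    have hXs : col s (p 3) 5 = X := by rw [← hX]; exact col_congr (hs 5 (by simp))
    have hcond : (Tm.le (.var 9) (.cell 7)).ev p s (Function.update ρ 9 i) ≠ 0 ↔ i ≤ L := by
      rw [← Tm.tr_iff]
      simp [hEs.levels]
    rw [Cmd.exec]
    simp only [hcond]
    split_ifs with hiL
    swap
    · refine ⟨hs, fun h => hJ (h.imp id ?_)⟩
      rintro ⟨j, hj, hjL, h⟩
      exact ⟨j, by omega, hjL, h⟩
    rw [Cmd.exec]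
    have hW : (Tm.count 20 (.and (.vec 5 (.var 20)) (.not (ltLvl (.var 20))))).ev p s
        (Function.update ρ 9 i) = (X.filter fun v => d + i ≤ deg T (p 3) v).card := by
      rw [Tm.ev_count, ← hXs, col, Finset.filter_filter]
      congr 1
      refine Finset.filter_congr fun v hv => ?_
      rw [Tm.tr_and, Tm.tr_not, tr_ltLvl hTs (l := d + i) (by simp [hEs.base]) (by norm_num)
        (by simpa using hv)]
      simp
    have hU : (Tm.count 20 (.vec 4 (.var 20))).ev p s (Function.update ρ 9 i) = U.card := by
      rw [Tm.ev_count, ← hEs.terms, col]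
      congr 1
      refine Finset.filter_congr fun v hv => ?_
      simp
    have hcond' : (Tm.le (.add (.count 20 (.and (.vec 5 (.var 20)) (.not (ltLvl (.var 20)))))
      (.count 20 (.and (.vec 5 (.var 20)) (.not (ltLvl (.var 20))))))
      (.count 20 (.vec 4 (.var 20)))).ev p s (Function.update ρ 9 i) ≠ 0 ↔
        2 * (X.filter fun v => d + i ≤ deg T (p 3) v).card ≤ U.card := by
      rw [← Tm.tr_iff, Tm.tr_le, Tm.ev_add, hW, hU, two_mul]
    simp only [hcond']
    split_ifs with hhalf
    swap
    · refine ⟨hs, fun h => hJ (h.imp id ?_)⟩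
      rintro ⟨j, hj, hjL, h'⟩
      rcases Nat.lt_succ_iff_lt_or_eq.mp hj with hj | rfl
      · exact ⟨j, hj, hjL, h'⟩
      · exact absurd h' hhalf
    have hsol := LocalOpt.sol (l := d + i) hK (by rw [← hN]; exact hF)
      (by rw [← hN]; exact hopt i hiL) (by rw [← hN]; exact hhalf)
    rw [← hN] at hsol
    constructor
    · intro a ha
      rw [Cmd.exec_frame _ (by simpa [Cmd.writes] using ha)]
      exact hs a ha
    · rintro -
      simp only [J]
      obtain ⟨s₁, hs₁⟩ : ∃ s₁, s₁ = (Cmd.fill 20 (.and (.vec 5 (.var 0))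
        (.not (ltLvl (.var 0))))).exec p (Function.update ρ 9 i) s := ⟨_, rfl⟩
      obtain ⟨s₂, hs₂⟩ : ∃ s₂, s₂ = (Cmd.fill 21 (lowT (.var 0))).exec p
        (Function.update ρ 9 i) s₁ := ⟨_, rfl⟩
      have hexec : ∀ c, (Cmd.seq (.fill 20 (.and (.vec 5 (.var 0)) (.not (ltLvl (.var 0)))))
          (.seq (.fill 21 (lowT (.var 0))) c)).exec p (Function.update ρ 9 i) s =
          c.exec p (Function.update ρ 9 i) s₂ := fun c => by rw [hs₂, hs₁]; rfl
      rw [hexec]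
      have fr₁ : ∀ a, a ≠ 20 → s₁ a = s a := fun a h => by
        rw [hs₁]; exact Cmd.exec_frame _ (by simpa [Cmd.writes] using h) _ _
      have fr₂ : ∀ a, a ≠ 21 → s₂ a = s₁ a := fun a h => by
        rw [hs₂]; exact Cmd.exec_frame _ (by simpa [Cmd.writes] using h) _ _
      have h20 : col s₁ (p 3) 20 = X.filter fun v => d + i ≤ deg T (p 3) v := by
        ext v
        rw [hs₁, mem_col_fill (by omega), Finset.mem_filter, ← hXs, mem_col, and_assoc]
        refine and_congr_right fun hv => ?_
        rw [Tm.tr_and, Tm.tr_not, tr_ltLvl hTs (l := d + i) (by simp [hEs.base]) (by norm_num)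
          (by simpa using hv)]
        simp
      have hT₁ : rel s₁ (p 3) 6 = T := by rw [← hTs]; exact rel_congr (fr₁ 6 (by norm_num))
      have hX₁ : col s₁ (p 3) 5 = X := by rw [← hXs]; exact col_congr (fr₁ 5 (by norm_num))
      have h21 : col s₂ (p 3) 21 = X.filter fun v => deg T (p 3) v ≤ d + i := by
        ext v
        rw [hs₂, mem_col_fill (by omega), Finset.mem_filter]
        constructor
        · rintro ⟨hv, h⟩
          rw [tr_lowT (by simp) (by simpa using hv), hT₁, hX₁, fr₁ 24 (by norm_num),
            hEs.base] at h
          simpa using h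
        · intro h
          have hv : v < p 3 := by
            have := h.1
            rw [← hX₁, mem_col] at this
            exact this.1
          refine ⟨hv, ?_⟩
          rw [tr_lowT (by simp) (by simpa using hv), hT₁, hX₁, fr₁ 24 (by norm_num), hEs.base]
          simpa using h
      have hT₂ : rel s₂ (p 3) 6 = T := by rw [← hT₁]; exact rel_congr (fr₂ 6 (by norm_num))
      have hX₂ : col s₂ (p 3) 5 = X := by rw [← hX₁]; exact col_congr (fr₂ 5 (by norm_num))
      have h24 : s₂ 24 0 0 = d := by
        rw [fr₂ 24 (by norm_num), fr₁ 24 (by norm_num), hEs.base]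
      have key : ∀ a b, a < p 3 → b < p 3 → ((Tm.and (.get 6 (.var 0) (.var 1))
          (.and (lowT (.var 0)) (lowT (.var 1)))).tr p s₂ (Function.update (Function.update
            (Function.update ρ 9 i) 0 a) 1 b) ↔ s₂ 6 a b ≠ 0 ∧
              (a ∈ X ∧ deg T (p 3) a ≤ d + i) ∧ (b ∈ X ∧ deg T (p 3) b ≤ d + i)) := by
        intro a b ha hb
        rw [Tm.tr_and, Tm.tr_and, tr_lowT (by simp) (by simpa using ha), tr_lowT (by simp)
          (by simpa using hb), hT₂, hX₂, h24]
        simp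
      have h22 : rel ((Cmd.fill 22 (.and (.get 6 (.var 0) (.var 1)) (.and (lowT (.var 0))
          (lowT (.var 1))))).exec p (Function.update ρ 9 i) s₂) (p 3) 22 =
          Res T fun v => v ∈ X ∧ deg T (p 3) v ≤ d + i := by
        funext a b
        rw [eq_iff_iff, rel_fill]
        constructor
        · rintro ⟨ha, hb, h⟩
          obtain ⟨h1, h2⟩ := (key a b ha hb).mp h
          exact ⟨by rw [← hT₂]; exact ⟨ha, hb, h1⟩, h2⟩
        · rintro ⟨h1, h2⟩
          rw [← hT₂] at h1
          exact ⟨h1.1, h1.2.1, (key a b h1.1 h1.2.1).mpr ⟨h1.2.2, h2⟩⟩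
      have e20 : col ((Cmd.fill 22 (.and (.get 6 (.var 0) (.var 1)) (.and (lowT (.var 0))
          (lowT (.var 1))))).exec p (Function.update ρ 9 i) s₂) (p 3) 20 = col s₁ (p 3) 20 :=
        col_congr ((Cmd.exec_frame _ (by simp [Cmd.writes]) _ _).trans (fr₂ 20 (by norm_num)))
      have e21 : col ((Cmd.fill 22 (.and (.get 6 (.var 0) (.var 1)) (.and (lowT (.var 0))
          (lowT (.var 1))))).exec p (Function.update ρ 9 i) s₂) (p 3) 21 = col s₂ (p 3) 21 :=
        col_congr (Cmd.exec_frame _ (by simp [Cmd.writes]) _ _)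
      rw [e20, e21, h20, h21, h22]
      exact hsol
  refine hloop.2 (h.imp id ?_)
  rintro ⟨j, hj, h⟩
  exact ⟨j, by omega, hj, h⟩

/-- After `N` rounds a solution has been recorded, as each unsuccessful round makes `X` smaller. -/
theorem rounds_spec (hN : p 3 = n + 2) (hG : Symm G) (hE : Env (p 3) m G U d L M)
    (hX : Keeps G U n f (col m (p 3) 5)) (hL : n < 2 ^ L) (hL' : 2 ^ L ≤ 2 * p 3)
    (hM : n + 1 ≤ M ∨ 2 * (3 * f * L + 1) ^ 2 ≤ M) (hLN : L < p 3)
    (hd : d = 2 * ((Finset.range (p 3)).filter fun q => q ≤ M).card ^ 4 + 8) :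
    Sol G U n f (d + L) (col ((roundC.rep 1).exec p ρ m) (p 3) 20)
      (col ((roundC.rep 1).exec p ρ m) (p 3) 21) (rel ((roundC.rep 1).exec p ρ m) (p 3) 22) := by
  classical
  let I : Mem → Prop := fun s => Env (p 3) s G U d L M ∧ Keeps G U n f (col s (p 3) 5)
  let J : Mem → Prop := fun s =>
    Sol G U n f (d + L) (col s (p 3) 20) (col s (p 3) 21) (rel s (p 3) 22)
  have hround : ∀ ρ s, I s → I (roundC.exec p ρ s) ∧ (J s → J (roundC.exec p ρ s)) ∧
      (J (roundC.exec p ρ s) ∨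
        (col (roundC.exec p ρ s) (p 3) 5).card + 1 ≤ (col s (p 3) 5).card) := by
    rintro ρ s ⟨i1, i2⟩
    obtain ⟨s₁, hs₁⟩ : ∃ s₁, s₁ = searchC.exec p ρ s := ⟨_, rfl⟩
    obtain ⟨s₂, hs₂⟩ : ∃ s₂, s₂ = recordC.exec p ρ s₁ := ⟨_, rfl⟩
    obtain ⟨s₃, hs₃⟩ : ∃ s₃, s₃ = dropAllC.exec p ρ s₂ := ⟨_, rfl⟩
    have hexec : roundC.exec p ρ s = s₃ := by rw [hs₃, hs₂, hs₁]; rfl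
    rw [hexec]
    have fr₁ : ∀ a, a ∉ [6, 10, 11, 12, 13, 14, 15, 16] → s₁ a = s a := fun a h => by
      rw [hs₁]; exact searchC_frame h
    have fr₂ : ∀ a, a ∉ [20, 21, 22] → s₂ a = s₁ a := fun a h => by
      rw [hs₂]; exact Cmd.exec_frame _ (by rw [recordC_writes]; exact h) _ _
    have fr₃ : ∀ a, a ∉ [5, 10, 11, 12, 18, 19] → s₃ a = s₂ a := fun a h => by
      rw [hs₃]
      exact Cmd.exec_frame _ (by rw [dropAllC_writes]; simp at h ⊢; tauto) _ _
    have hsearch := searchC_spec (p := p) (ρ := ρ) (m := s) (by omega) G i1.graph hG _ rfl d L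
      i1.base i1.levels hLN hL'
    rw [← hs₁] at hsearch
    have hE₁ : Env (p 3) s₁ G U d L M := i1.congr fun a ha => fr₁ a (by
      intro h; fin_cases ha <;> simp at h)
    have hE₂ : Env (p 3) s₂ G U d L M := hE₁.congr fun a ha => fr₂ a (by
      intro h; fin_cases ha <;> simp at h)
    have hE₃ : Env (p 3) s₃ G U d L M := hE₂.congr fun a ha => fr₃ a (by
      intro h; fin_cases ha <;> simp at h)
    have hX₁ : col s₁ (p 3) 5 = col s (p 3) 5 := col_congr (fr₁ 5 (by simp))
    have hX₂ : col s₂ (p 3) 5 = col s (p 3) 5 := (col_congr (fr₂ 5 (by simp))).trans hX₁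
    have hT₂ : rel s₂ (p 3) 6 = rel s₁ (p 3) 6 := rel_congr (fr₂ 6 (by simp))
    have hrec := recordC_spec (p := p) (ρ := ρ) (m := s₁) hN hE₁ rfl hX₁ hLN i2 hsearch.1
      hsearch.2
    rw [← hs₂] at hrec
    have hdrop := dropAllC_spec (p := p) (ρ := ρ) (m := s₂) hN hG hE₂ hT₂ hX₂ hL hM hLN i2
    rw [← hs₃] at hdrop
    have hJ₁ : J s → J s₁ := fun h => by
      simp only [J]
      rw [col_congr (fr₁ 20 (by simp)), col_congr (fr₁ 21 (by simp)),
        rel_congr (fr₁ 22 (by simp))]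
      exact h
    have hJ₃ : J s₂ → J s₃ := fun h => by
      simp only [J]
      rw [col_congr (fr₃ 20 (by simp)), col_congr (fr₃ 21 (by simp)),
        rel_congr (fr₃ 22 (by simp))]
      exact h
    refine ⟨⟨hE₃, hdrop.1⟩, fun h => hJ₃ (hrec (Or.inl (hJ₁ h))), ?_⟩
    by_cases hsucc : ∃ j ≤ L, 2 * ((col s (p 3) 5).filter fun v =>
        d + j ≤ deg (rel s₁ (p 3) 6) (p 3) v).card ≤ U.card
    · exact Or.inl (hJ₃ (hrec (Or.inr hsucc)))
    · push Not at hsucc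
      obtain ⟨j, hj, c, hc, hr⟩ := exists_redundant hG i2.sub (by omega) hsearch.1 hsearch.2 hL hd
        hsucc
      refine Or.inr (Finset.card_lt_card (hdrop.2.1.ssubset_of_ne fun h => ?_))
      exact hdrop.2.2 h j hj c hc hr
  refine (Cmd.rep_spec I J (fun s => (col s (p 3) 5).card) (fun ρ s hs => (hround ρ s hs).1)
    (fun ρ s hs => (hround ρ s hs).2.1) (fun ρ s hs => (hround ρ s hs).2.2) 1 ρ m ⟨hE, hX⟩ ?_).2
  have := Finset.card_le_card hX.sub
  rw [Finset.card_range] at this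
  rw [pow_one]
  omega

end

/-! ### Initialization -/

/-- Initialization of `U` and `X`. -/
def initSetsC : Cmd := .seq (.fill 4 (.get 1 (.lit 0) (.var 0))) (.fill 5 (.lt (.var 0) (.par 0)))

/-- The least `L` with `n < 2 ^ L`, by repeated doubling. -/
def initLevelsC : Cmd := .seq (.fill 7 (.lit 0)) (.seq (.fill 8 (.lit 1))
  (.loop 2 (.cond (.le (.cell 8) (.par 0)) (.seq (.fill 8 (.add (.cell 8) (.cell 8)))
    (.fill 7 (.add (.cell 7) (.lit 1)))))))

/-- The table of remainders, by repeated subtraction. -/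
def initModsC : Cmd := .loop 2 (.fill 9 (.ite (.or (.lt (.var 1) (.var 0)) (.eq (.var 0) (.lit 0)))
  (.var 1) (.get 9 (.var 0) (.sub (.var 1) (.var 0)))))

/-- The sum of `a` over all values of variable `k` up to the bound on residues. -/
def sumLe (k : ℕ) (a : Tm) : Tm := .sum k (.ite (.le (.var k) (.cell 23)) a (.lit 0))

/-- The bound on residues and the first level. -/
def initBoundsC : Cmd :=
  .seq (.fill 25 (.add (.sum 20 (.ite (.lt (.var 20) (.cell 7))
    (.add (.par 1) (.add (.par 1) (.par 1))) (.lit 0))) (.lit 1)))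
  (.seq (.fill 23 (.ite (.lt (.cell 25) (.par 3)) (.sum 20 (.ite (.lt (.var 20) (.cell 25))
    (.add (.cell 25) (.cell 25)) (.lit 0))) (.par 3)))
  (.fill 24 (.add (sumLe 20 (sumLe 21 (sumLe 22 (sumLe 23 (.lit 2))))) (.lit 8))))

/-- The initialization. -/
def initC : Cmd := .seq initSetsC (.seq initLevelsC (.seq initModsC initBoundsC))

/-- The bound on residues: `2 * t ^ 2` for `t = 3 * f * L + 1`, where `t` primes can be found, or
`N` if that is not small. -/
def residueBound (N f L : ℕ) : ℕ :=
  if 3 * f * L + 1 < N then 2 * (3 * f * L + 1) ^ 2 else N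

/-- The first level: more than twice the number of choices of a modulus and three residues up to
the bound `M`. -/
def baseLevel (N M : ℕ) : ℕ := 2 * ((Finset.range N).filter fun q => q ≤ M).card ^ 4 + 8

section

variable {p : Fin 4 → ℕ} {m : Mem} {ρ : ℕ → ℕ}

/-- Iterated sums multiply, which replaces the missing multiplication. -/
theorem ev_sumLe {k : ℕ} {a : Tm} {c : ℕ} (h : ∀ i, a.ev p m (Function.update ρ k i) = c) :
    (sumLe k a).ev p m ρ = ((Finset.range (p 3)).filter fun q => q ≤ m 23 0 0).card * c := by
  simp [sumLe, h, ← Finset.sum_filter]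

theorem ev_sum_lt {k : ℕ} {a b : Tm} {c t : ℕ} (h : ∀ i, a.ev p m (Function.update ρ k i) = c)
    (ht : ∀ i, b.ev p m (Function.update ρ k i) = t) (htN : t ≤ p 3) :
    (Tm.sum k (.ite (.lt (.var k) b) a (.lit 0))).ev p m ρ = t * c := by
  simp only [Tm.ev_sum, Tm.ev_ite, Tm.tr_lt, Tm.ev_var, Function.update_self, ht, h, Tm.ev_lit,
    ← Finset.sum_filter, Finset.sum_const, smul_eq_mul]
  congr 1
  have : (Finset.range (p 3)).filter (fun i => i < t) = Finset.range t := by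
    ext i
    simp only [Finset.mem_filter, Finset.mem_range]
    omega
  rw [this, Finset.card_range]

theorem initSetsC_spec (hN : p 3 = p 0 + 2) :
    col (initSetsC.exec p ρ m) (p 3) 5 = Finset.range (p 0) ∧
      col (initSetsC.exec p ρ m) (p 3) 4 = (Finset.range (p 3)).filter fun v => m 1 0 v ≠ 0 := by
  have hexec : initSetsC.exec p ρ m = (Cmd.fill 5 (.lt (.var 0) (.par 0))).exec p ρ
      ((Cmd.fill 4 (.get 1 (.lit 0) (.var 0))).exec p ρ m) := rfl
  rw [hexec]
  constructor
  · ext v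
    rw [mem_col_fill (by omega), Finset.mem_range]
    simp
    omega
  · rw [col_congr (m' := (Cmd.fill 4 (.get 1 (.lit 0) (.var 0))).exec p ρ m)
      (Cmd.exec_frame _ (by simp [Cmd.writes]) _ _)]
    ext v
    rw [mem_col_fill (by omega), Finset.mem_filter, Finset.mem_range]
    simp

/-- The loop ends with the least `L` such that `n < 2 ^ L`. -/
theorem initLevelsC_spec (hN : p 3 = p 0 + 2) :
    p 0 < 2 ^ initLevelsC.exec p ρ m 7 0 0 ∧
      (initLevelsC.exec p ρ m 7 0 0 = 0 ∨ 2 ^ (initLevelsC.exec p ρ m 7 0 0 - 1) ≤ p 0) := by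
  have h : initLevelsC.exec p ρ m 8 0 0 = 2 ^ initLevelsC.exec p ρ m 7 0 0 ∧
      (initLevelsC.exec p ρ m 7 0 0 = 0 ∨ 2 ^ (initLevelsC.exec p ρ m 7 0 0 - 1) ≤ p 0) ∧
      (p 0 < initLevelsC.exec p ρ m 8 0 0 ∨ p 3 ≤ initLevelsC.exec p ρ m 7 0 0) := by
    refine loopN_induct (fun i (s : Mem) => s 8 0 0 = 2 ^ s 7 0 0 ∧
      (s 7 0 0 = 0 ∨ 2 ^ (s 7 0 0 - 1) ≤ p 0) ∧ (p 0 < s 8 0 0 ∨ i ≤ s 7 0 0)) ?_ ?_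
    · rintro i hi s ⟨h1, h2, h3⟩
      rw [Cmd.exec]
      have hcond : (Tm.le (.cell 8) (.par 0)).ev p s (Function.update ρ 2 i) ≠ 0 ↔
          s 8 0 0 ≤ p 0 := by
        rw [← Tm.tr_iff]; simp
      simp only [hcond]
      split_ifs with hle
      · have h0 : 0 < p 3 := by omega
        simp only [Cmd.exec, h0, and_self, Tm.ev_add, Tm.ev_cell, Tm.ev_lit,
          show ((8 : ℕ) = 7) = False by simp, show ((7 : ℕ) = 8) = False by simp, false_and,
          if_false, if_true, Nat.add_sub_cancel]
        refine ⟨by rw [h1, pow_succ]; ring, Or.inr (h1 ▸ hle), Or.inr ?_⟩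
        omega
      · exact ⟨h1, h2, Or.inl (by omega)⟩
    · have h0 : 0 < p 3 := by omega
      simp [Cmd.exec, h0]
  obtain ⟨h1, h2, h3⟩ := h
  refine ⟨?_, h2⟩
  rw [← h1]
  rcases h3 with h3 | h3
  · exact h3
  · have := (Nat.lt_two_pow_self (n := initLevelsC.exec p ρ m 7 0 0))
    omega

theorem initModsC_spec : ∀ q < p 3, ∀ e < p 3, initModsC.exec p ρ m 9 q e = e % q := by
  refine loopN_induct (fun i (s : Mem) => ∀ q < p 3, ∀ e < i, s 9 q e = e % q) ?_ (by simp)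
  intro i hi s hs q hq e he
  rw [exec_fill hq (by omega)]
  simp only [Tm.ev_ite, Tm.tr_or, Tm.tr_lt, Tm.tr_eq, Tm.ev_var, Tm.ev_lit, Tm.ev_get, Tm.ev_sub,
    update_zero_one, Function.update_self]
  split_ifs with h
  · rcases h with h | rfl
    · exact (Nat.mod_eq_of_lt h).symm
    · simp
  · rw [hs q hq _ (by omega), ← Nat.mod_eq_sub_mod (by omega)]

theorem initBoundsC_spec {L f : ℕ} (hN : p 3 = p 0 + 2) (hf : p 1 = f) (hL : m 7 0 0 = L)
    (hLN : L ≤ p 3) : initBoundsC.exec p ρ m 23 0 0 = residueBound (p 3) f L ∧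
      initBoundsC.exec p ρ m 24 0 0 = baseLevel (p 3) (residueBound (p 3) f L) := by
  obtain ⟨m₁, hm₁⟩ : ∃ m₁, m₁ = (Cmd.fill 25 (.add (.sum 20 (.ite (.lt (.var 20) (.cell 7))
    (.add (.par 1) (.add (.par 1) (.par 1))) (.lit 0))) (.lit 1))).exec p ρ m := ⟨_, rfl⟩
  obtain ⟨m₂, hm₂⟩ : ∃ m₂, m₂ = (Cmd.fill 23 (.ite (.lt (.cell 25) (.par 3))
    (.sum 20 (.ite (.lt (.var 20) (.cell 25))
    (.add (.cell 25) (.cell 25)) (.lit 0))) (.par 3))).exec p ρ m₁ := ⟨_, rfl⟩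
  have h25 : m₁ 25 0 0 = 3 * f * L + 1 := by
    rw [hm₁, exec_fill (by omega) (by omega), Tm.ev_add, ev_sum_lt (c := 3 * f) (t := L) _ _ hLN]
    · simp; ring
    · intro i; simp [hf]; ring
    · simp [hL]
  have h23 : m₂ 23 0 0 = residueBound (p 3) f L := by
    rw [hm₂, exec_fill (by omega) (by omega), Tm.ev_ite, residueBound]
    simp only [Tm.tr_lt, Tm.ev_cell, h25, Tm.ev_par]
    split_ifs with h
    · rw [ev_sum_lt (c := 2 * (3 * f * L + 1)) (t := 3 * f * L + 1) _ _ h.le]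
      · ring
      · intro i; simp [h25]; ring
      · simp [h25]
    · rfl
  have hexec : initBoundsC.exec p ρ m = (Cmd.fill 24 (.add (sumLe 20 (sumLe 21 (sumLe 22
      (sumLe 23 (.lit 2))))) (.lit 8))).exec p ρ m₂ := by rw [hm₂, hm₁]; rfl
  rw [hexec]
  constructor
  · rw [Cmd.exec_frame _ (by simp [Cmd.writes]), h23]
  · rw [exec_fill (by omega) (by omega), Tm.ev_add, baseLevel, ← h23]
    rw [ev_sumLe fun i => ev_sumLe fun i => ev_sumLe fun i => ev_sumLe (c := 2) fun i => rfl,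
      Tm.ev_lit]
    ring

/-- The initialization establishes the environment, and `X` is the set of all vertices. -/
theorem initC_spec {n f : ℕ} (hn : p 0 = n) (hN : p 3 = n + 2) (hf : p 1 = f)
    {G : ℕ → ℕ → Prop} (hG : rel m (p 3) 0 = G) {U : Finset ℕ}
    (hU : (Finset.range (p 3)).filter (fun v => m 1 0 v ≠ 0) = U) :
    ∃ L, n < 2 ^ L ∧ (L = 0 ∨ 2 ^ (L - 1) ≤ n) ∧ Env (p 3) (initC.exec p ρ m) G U
      (baseLevel (p 3) (residueBound (p 3) f L)) L (residueBound (p 3) f L) ∧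
      col (initC.exec p ρ m) (p 3) 5 = Finset.range n := by
  subst hn
  obtain ⟨m₁, hm₁⟩ : ∃ m₁, m₁ = initSetsC.exec p ρ m := ⟨_, rfl⟩
  obtain ⟨m₂, hm₂⟩ : ∃ m₂, m₂ = initLevelsC.exec p ρ m₁ := ⟨_, rfl⟩
  obtain ⟨m₃, hm₃⟩ : ∃ m₃, m₃ = initModsC.exec p ρ m₂ := ⟨_, rfl⟩
  have hexec : initC.exec p ρ m = initBoundsC.exec p ρ m₃ := by rw [hm₃, hm₂, hm₁]; rfl
  have fr₁ : ∀ a, a ∉ [4, 5] → m₁ a = m a := fun a h => by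
    rw [hm₁]; exact Cmd.exec_frame _ h _ _
  have fr₂ : ∀ a, a ∉ [7, 8] → m₂ a = m₁ a := fun a h => by
    rw [hm₂]; exact Cmd.exec_frame _ (by
      simp only [initLevelsC, Cmd.writes, List.mem_append, List.mem_cons] at h ⊢; tauto) _ _
  have fr₃ : ∀ a, a ∉ [9] → m₃ a = m₂ a := fun a h => by
    rw [hm₃]; exact Cmd.exec_frame _ h _ _
  have fr₄ : ∀ a, a ∉ [25, 23, 24] → initC.exec p ρ m a = m₃ a := fun a h => by
    rw [hexec]; exact Cmd.exec_frame _ h _ _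
  have hsets := initSetsC_spec (m := m) (ρ := ρ) hN
  rw [← hm₁] at hsets
  have hlev := initLevelsC_spec (m := m₁) (ρ := ρ) hN
  rw [← hm₂] at hlev
  have hmods := initModsC_spec (p := p) (m := m₂) (ρ := ρ)
  rw [← hm₃] at hmods
  obtain ⟨L, hL⟩ : ∃ L, m₂ 7 0 0 = L := ⟨_, rfl⟩
  rw [hL] at hlev
  have hLN : L ≤ p 3 := by
    rcases hlev.2 with h | h
    · omega
    · have := (Nat.lt_two_pow_self (n := L - 1))
      omega
  have hb := initBoundsC_spec (m := m₃) (ρ := ρ) (L := L) hN hf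
    (by rw [fr₃ 7 (by simp), hL]) hLN
  rw [← hexec] at hb
  refine ⟨L, hlev.1, hlev.2, ⟨?_, ?_, ?_, hb.1, hb.2, ?_⟩, ?_⟩
  · rw [← hG]
    refine rel_congr ?_
    rw [fr₄ 0 (by simp), fr₃ 0 (by simp), fr₂ 0 (by simp), fr₁ 0 (by simp)]
  · rw [← hU, ← hsets.2]
    refine col_congr ?_
    rw [fr₄ 4 (by simp), fr₃ 4 (by simp), fr₂ 4 (by simp)]
  · rw [fr₄ 7 (by simp), fr₃ 7 (by simp), hL]
  · rw [fr₄ 9 (by simp)]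
    exact hmods
  · rw [← hsets.1]
    refine col_congr ?_
    rw [fr₄ 5 (by simp), fr₃ 5 (by simp), fr₂ 5 (by simp)]

end

/-! ### Output -/

/-- The output in the format of `Holds`: the forest in array `22` is split into its components,
which are numbered in the order of their least vertices. -/
def outputC : Cmd :=
  .seq (closure 11 (.get 22 (.var 0) (.var 1)))
  (.seq (.fill 18 (.least 20 22 (.get 11 (.var 0) (.var 20))))
  (.seq (.fill 27 (.and (.vec 21 (.var 0)) (.eq (.vec 18 (.var 0)) (.var 0))))
  (.seq (.fill 28 (.count 20 (.and (.vec 27 (.var 20)) (.lt (.var 20) (.vec 18 (.var 0))))))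
  (.seq (.fill 1 (.ite (.vec 20 (.var 1)) (.lit 1) (.lit 0)))
  (.seq (.fill 2 (.ite (.and (.vec 21 (.var 1)) (.eq (.vec 28 (.var 1)) (.var 0)))
    (.lit 1) (.lit 0)))
  (.fill 3 (.ite (.get 22 (.var 0) (.var 1)) (.lit 1) (.lit 0))))))))

open Classical in
/-- The memory holds `B`, the components of the forest `T` on `V`, and `T`. Here `lab v` is the
least vertex of the component of `v`, and the components are numbered in the order of their least
vertices. -/
structure Output (N : ℕ) (m : Mem) (B V : Finset ℕ) (T : ℕ → ℕ → Prop) (lab : ℕ → ℕ) : Prop where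
  lab_mem : ∀ v ∈ V, lab v ∈ reps T V
  conn : ∀ v ∈ V, Conn T v (lab v)
  set : ∀ v < N, m 1 0 v = if v ∈ B then 1 else 0
  parts : ∀ j < N, ∀ v < N, m 2 j v =
    if v ∈ V ∧ ((reps T V).filter fun c => c < lab v).card = j then 1 else 0
  trees : ∀ u < N, ∀ v < N, m 3 u v = if T u v then 1 else 0

/-- The recorded solution is written into the output arrays, and the number of components is the
number of marks in array `27`. -/
theorem outputC_spec {p : Fin 4 → ℕ} {m : Mem} {ρ : ℕ → ℕ} (hN : 2 ≤ p 3) {B V : Finset ℕ}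
    {T : ℕ → ℕ → Prop} (hB : col m (p 3) 20 = B) (hV : col m (p 3) 21 = V)
    (hT : rel m (p 3) 22 = T) (hTs : Symm T) (hTV : ∀ a b, T a b → a ∈ V) :
    (∃ lab, Output (p 3) (outputC.exec p ρ m) B V T lab) ∧
      (Tm.count 20 (.vec 27 (.var 20))).ev p (outputC.exec p ρ m) ρ = (reps T V).card := by
  classical
  have hVN : ∀ {v}, v ∈ V → v < p 3 := fun hv => by
    rw [← hV, mem_col] at hv; exact hv.1
  have hconnV : ∀ {u v}, Conn T u v → u ∈ V → v ∈ V := by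
    intro u v h hu
    induction h with
    | refl => exact hu
    | tail _ h _ => exact hTV _ _ (hTs _ _ h)
  obtain ⟨m₁, hm₁⟩ : ∃ m₁, m₁ = (closure 11 (.get 22 (.var 0) (.var 1))).exec p ρ m := ⟨_, rfl⟩
  obtain ⟨m₂, hm₂⟩ : ∃ m₂, m₂ = (Cmd.fill 18 (.least 20 22
    (.get 11 (.var 0) (.var 20)))).exec p ρ m₁ := ⟨_, rfl⟩
  obtain ⟨m₃, hm₃⟩ : ∃ m₃, m₃ = (Cmd.fill 27 (.and (.vec 21 (.var 0))
    (.eq (.vec 18 (.var 0)) (.var 0)))).exec p ρ m₂ := ⟨_, rfl⟩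
  obtain ⟨m₄, hm₄⟩ : ∃ m₄, m₄ = (Cmd.fill 28 (.count 20 (.and (.vec 27 (.var 20))
    (.lt (.var 20) (.vec 18 (.var 0)))))).exec p ρ m₃ := ⟨_, rfl⟩
  obtain ⟨m₅, hm₅⟩ : ∃ m₅, m₅ = (Cmd.fill 1 (.ite (.vec 20 (.var 1)) (.lit 1)
    (.lit 0))).exec p ρ m₄ := ⟨_, rfl⟩
  obtain ⟨m₆, hm₆⟩ : ∃ m₆, m₆ = (Cmd.fill 2 (.ite (.and (.vec 21 (.var 1))
    (.eq (.vec 28 (.var 1)) (.var 0))) (.lit 1) (.lit 0))).exec p ρ m₅ := ⟨_, rfl⟩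
  obtain ⟨m₇, hm₇⟩ : ∃ m₇, m₇ = (Cmd.fill 3 (.ite (.get 22 (.var 0) (.var 1)) (.lit 1)
    (.lit 0))).exec p ρ m₆ := ⟨_, rfl⟩
  have hexec : outputC.exec p ρ m = m₇ := by
    rw [hm₇, hm₆, hm₅, hm₄, hm₃, hm₂, hm₁]; rfl
  have fr₁ : ∀ a, a ∉ [10, 11, 11] → m₁ a = m a := fun a h => by
    rw [hm₁]; exact Cmd.exec_frame _ (by rw [closure_writes]; exact h) _ _
  have fr₂ : ∀ a, a ∉ [18] → m₂ a = m₁ a := fun a h => by rw [hm₂]; exact Cmd.exec_frame _ h _ _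
  have fr₃ : ∀ a, a ∉ [27] → m₃ a = m₂ a := fun a h => by rw [hm₃]; exact Cmd.exec_frame _ h _ _
  have fr₄ : ∀ a, a ∉ [28] → m₄ a = m₃ a := fun a h => by rw [hm₄]; exact Cmd.exec_frame _ h _ _
  have fr₅ : ∀ a, a ∉ [1] → m₅ a = m₄ a := fun a h => by rw [hm₅]; exact Cmd.exec_frame _ h _ _
  have fr₆ : ∀ a, a ∉ [2] → m₆ a = m₅ a := fun a h => by rw [hm₆]; exact Cmd.exec_frame _ h _ _
  have fr₇ : ∀ a, a ∉ [3] → m₇ a = m₆ a := fun a h => by rw [hm₇]; exact Cmd.exec_frame _ h _ _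
  have h22 : ∀ {u v}, u < p 3 → v < p 3 → (m 22 u v ≠ 0 ↔ T u v) := by
    intro u v hu hv; rw [← hT]; simp [rel, hu, hv]
  have h21 : ∀ {v}, v < p 3 → (m 21 v 0 ≠ 0 ↔ v ∈ V) := by
    intro v hv; rw [← hV, mem_col]; simp [hv]
  have h20 : ∀ {v}, v < p 3 → (m 20 v 0 ≠ 0 ↔ v ∈ B) := by
    intro v hv; rw [← hB, mem_col]; simp [hv]
  have h11 : ∀ {a b}, a < p 3 → b < p 3 → (m₁ 11 a b ≠ 0 ↔ Conn T a b) := by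
    intro a b ha hb
    have := closure_spec (p := p) (ρ := ρ) (m := m) (a := 11) (e := .get 22 (.var 0) (.var 1))
      (by norm_num) hN T (fun i j => by rw [← hT]; simp [rel]) a b
    rw [← hm₁] at this
    simpa only [rel, ha, hb, true_and] using this
  set lab : ℕ → ℕ := fun u => m₂ 18 u 0 with hlabdef
  have h18 : ∀ u < p 3, Tm.IsLeast (p 3) (fun y => Conn T u y) (lab u) := by
    intro u hu
    rw [hlabdef]
    simp only [hm₂]
    rw [exec_fill hu (by omega)]
    refine Tm.ev_least (by norm_num) _ fun i k hi _ => ?_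
    have := h11 hu hi
    simpa using this
  have hlabN : ∀ u < p 3, lab u < p 3 := fun u hu => ((h18 u hu).min u hu .refl).trans_lt hu
  have hlabc : ∀ u < p 3, Conn T u (lab u) := fun u hu => (h18 u hu).holds (hlabN u hu)
  have hlab : ∀ v ∈ V, lab v ∈ reps T V := by
    intro v hv
    refine Finset.mem_filter.mpr ⟨hconnV (hlabc v (hVN hv)) hv, fun y hy hyc => ?_⟩
    exact (h18 v (hVN hv)).min y (hVN hy) ((hlabc v (hVN hv)).trans hyc)
  have h27 : ∀ {v}, v < p 3 → (m₃ 27 v 0 ≠ 0 ↔ v ∈ reps T V) := by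
    intro v hv
    rw [hm₃, exec_fill hv (by omega), ← Tm.tr_iff]
    simp only [Tm.tr_and, Tm.tr_vec, Tm.tr_eq, Tm.ev_vec, Tm.ev_var, update_zero_one]
    rw [fr₂ 21 (by simp), fr₁ 21 (by simp), h21 hv]
    constructor
    · rintro ⟨h1, h2⟩
      rw [← h2]
      exact hlab v h1
    · intro h
      have hvV := (Finset.mem_filter.mp h).1
      exact ⟨hvV, rep_unique hTs (hlab v hvV) h ((hlabc v hv).symm hTs)⟩
  have hrepsN : ∀ {c}, c ∈ reps T V → c < p 3 := fun hc => hVN (Finset.mem_filter.mp hc).1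
  have h28 : ∀ {v}, v < p 3 →
      m₄ 28 v 0 = ((reps T V).filter fun c => c < lab v).card := by
    intro v hv
    rw [hm₄, exec_fill hv (by omega), Tm.ev_count]
    congr 1
    ext c
    simp only [Finset.mem_filter, Finset.mem_range, Tm.tr_and, Tm.tr_vec, Tm.tr_lt, Tm.ev_var,
      Tm.ev_vec, Function.update_self, Function.update_of_ne (show (0 : ℕ) ≠ 20 by norm_num),
      update_zero_one]
    rw [fr₃ 18 (by simp)]
    constructor
    · rintro ⟨hc, h1, h2⟩
      exact ⟨(h27 hc).mp h1, h2⟩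
    · rintro ⟨h1, h2⟩
      exact ⟨hrepsN h1, (h27 (hrepsN h1)).mpr h1, h2⟩
  rw [hexec]
  refine ⟨⟨lab, hlab, fun v hv => hlabc v (hVN hv), fun v hv => ?_, fun j hj v hv => ?_,
    fun u hu v hv => ?_⟩, ?_⟩
  · rw [fr₇ 1 (by simp), fr₆ 1 (by simp), hm₅, exec_fill (by omega) hv, Tm.ev_ite]
    simp only [Tm.tr_vec, Tm.ev_var, Function.update_self, Tm.ev_lit]
    rw [fr₄ 20 (by simp), fr₃ 20 (by simp), fr₂ 20 (by simp), fr₁ 20 (by simp)]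
    simp only [h20 hv]
  · rw [fr₇ 2 (by simp), hm₆, exec_fill hj hv, Tm.ev_ite]
    simp only [Tm.tr_and, Tm.tr_eq, Tm.tr_vec, Tm.ev_vec, Tm.ev_var, Function.update_self,
      Tm.ev_lit, update_zero_one]
    rw [fr₅ 28 (by simp), h28 hv, fr₅ 21 (by simp), fr₄ 21 (by simp), fr₃ 21 (by simp),
      fr₂ 21 (by simp), fr₁ 21 (by simp)]
    simp only [h21 hv]
  · rw [hm₇, exec_fill hu hv, Tm.ev_ite]
    simp only [Tm.tr_get, Tm.ev_var, Function.update_self, Tm.ev_lit, update_zero_one]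
    rw [fr₆ 22 (by simp), fr₅ 22 (by simp), fr₄ 22 (by simp), fr₃ 22 (by simp), fr₂ 22 (by simp),
      fr₁ 22 (by simp)]
    simp only [h22 hu hv]
  · rw [Tm.ev_count]
    congr 1
    ext c
    simp only [Finset.mem_filter, Finset.mem_range, Tm.tr_vec, Tm.ev_var, Function.update_self]
    rw [fr₇ 27 (by simp), fr₆ 27 (by simp), fr₅ 27 (by simp), fr₄ 27 (by simp)]
    exact ⟨fun h => (h27 h.1).mp h.2, fun h => ⟨hrepsN h, (h27 (hrepsN h)).mpr h⟩⟩

/-! ### From relations on numbers to decompositions -/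

section

variable {n : ℕ}

/-- The adjacency relation of a graph on `{0, …, n - 1}`, as a relation on the natural numbers. -/
def graphRel (G : SimpleGraph (Fin n)) : ℕ → ℕ → Prop :=
  fun a b => ∃ u v : Fin n, (u : ℕ) = a ∧ (v : ℕ) = b ∧ G.Adj u v

variable {G : SimpleGraph (Fin n)}

@[simp] theorem graphRel_val {u v : Fin n} : graphRel G u v ↔ G.Adj u v := by
  constructor
  · rintro ⟨u', v', hu, hv, h⟩
    rwa [Fin.ext hu, Fin.ext hv] at h
  · exact fun h => ⟨u, v, rfl, rfl, h⟩

theorem symm_graphRel : Symm (graphRel G) := by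
  rintro a b ⟨u, v, rfl, rfl, h⟩
  exact ⟨v, u, rfl, rfl, h.symm⟩

theorem conn_of_walk {A : ℕ → Prop} {a b : Fin n} (p : G.Walk a b) (h : ∀ v ∈ p.support, A v) :
    Conn (Res (graphRel G) A) a b := by
  induction p with
  | nil => exact .refl
  | cons hadj p ih =>
    simp only [SimpleGraph.Walk.support_cons, List.mem_cons, forall_eq_or_imp] at h
    exact .head ⟨graphRel_val.mpr hadj, h.1, h.2 _ p.start_mem_support⟩ (ih h.2)

theorem walk_of_conn {A : ℕ → Prop} {a : Fin n} (ha : A a) {y : ℕ}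
    (h : Conn (Res (graphRel G) A) a y) :
    ∃ b : Fin n, (b : ℕ) = y ∧ ∃ p : G.Walk a b, ∀ v ∈ p.support, A v := by
  induction h with
  | refl => exact ⟨a, rfl, .nil, by simpa using ha⟩
  | tail _ h ih =>
    obtain ⟨b, rfl, p, hp⟩ := ih
    obtain ⟨⟨b', c, hb, rfl, hadj⟩, -, hc⟩ := h
    obtain rfl := Fin.ext hb
    refine ⟨c, rfl, p.concat hadj, fun v hv => ?_⟩
    rw [SimpleGraph.Walk.support_concat, List.mem_append,
      List.mem_singleton] at hv
    rcases hv with hv | rfl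
    · exact hp v hv
    · exact hc

end

/-- The elements of a finite set have different ranks. -/
theorem rank_injOn (R : Finset ℕ) :
    Set.InjOn (fun c => (R.filter fun d => d < c).card) (R : Set ℕ) := by
  have key : ∀ c ∈ R, ∀ c', c < c' →
      (R.filter fun d => d < c).card < (R.filter fun d => d < c').card := by
    intro c hc c' hlt
    refine Finset.card_lt_card ⟨fun d hd => ?_, fun h => ?_⟩
    · rw [Finset.mem_filter] at hd ⊢
      exact ⟨hd.1, hd.2.trans hlt⟩
    · exact lt_irrefl c (Finset.mem_filter.mp (h (Finset.mem_filter.mpr ⟨hc, hlt⟩))).2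
  intro c hc c' hc' h
  rcases lt_trichotomy c c' with hlt | heq | hlt
  · exact absurd h (key c hc c' hlt).ne
  · exact heq
  · exact absurd h (key c' hc' c hlt).ne'

theorem rank_lt {R : Finset ℕ} {c : ℕ} (hc : c ∈ R) :
    (R.filter fun d => d < c).card < R.card :=
  Finset.card_lt_card ⟨Finset.filter_subset _ _, fun h =>
    lt_irrefl c (Finset.mem_filter.mp (h hc)).2⟩

theorem exists_rank {R : Finset ℕ} {j : ℕ} (hj : j < R.card) :
    ∃ c ∈ R, (R.filter fun d => d < c).card = j := by
  have := Finset.surjOn_of_injOn_of_card_le (s := R) (t := Finset.range R.card)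
    (fun c => (R.filter fun d => d < c).card)
    (fun c hc => by simpa using rank_lt hc) (rank_injOn R) (by simp)
  obtain ⟨c, hc, h⟩ := this (by simpa using hj)
  exact ⟨c, hc, h⟩

section

variable {n N D : ℕ} {G : SimpleGraph (Fin n)} {B V U : Finset ℕ} {T : ℕ → ℕ → Prop}
  {lab : ℕ → ℕ}

/-- The number of the component of `v`. -/
noncomputable def rank (T : ℕ → ℕ → Prop) (V : Finset ℕ) (lab : ℕ → ℕ) (v : ℕ) : ℕ :=
  ((reps T V).filter fun c => c < lab v).card

/-- Two vertices have the same number if and only if they are in the same component. -/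
theorem rank_eq_iff (hs : Symm T) (hlab : ∀ v ∈ V, lab v ∈ reps T V)
    (hc : ∀ v ∈ V, Conn T v (lab v)) {u v : ℕ} (hu : u ∈ V) (hv : v ∈ V) :
    rank T V lab u = rank T V lab v ↔ Conn T u v := by
  constructor
  · intro h
    have h1 := rank_injOn (reps T V) (hlab u hu) (hlab v hv) h
    exact (hc u hu).trans (h1 ▸ (hc v hv).symm hs)
  · intro h
    have h1 : lab u = lab v := rep_unique hs (hlab u hu) (hlab v hv)
      ((((hc u hu).symm hs).trans h).trans (hc v hv))
    unfold rank
    rw [h1]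

/-- The component number `j` of the forest `T` on `V`. -/
def componentTree (hF : ForestInv (graphRel G) V N D T) (hlab : ∀ v ∈ V, lab v ∈ reps T V)
    (hc : ∀ v ∈ V, Conn T v (lab v)) (j : ℕ) : G.Subgraph where
  verts := {v | (v : ℕ) ∈ V ∧ rank T V lab v = j}
  Adj := fun u v => T u v ∧ rank T V lab u = j
  adj_sub := fun h => graphRel_val.mp (hF.sub _ _ h.1)
  edge_vert := fun h => ⟨hF.left _ _ h.1, h.2⟩
  symm := ⟨fun _ _ h => ⟨hF.symm _ _ h.1, ((rank_eq_iff hF.symm hlab hc (hF.left _ _ h.1)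
    (hF.right _ _ h.1)).mpr (.single h.1)).symm.trans h.2⟩⟩

theorem isTree_componentTree (hF : ForestInv (graphRel G) V N D T)
    (hlab : ∀ v ∈ V, lab v ∈ reps T V) (hc : ∀ v ∈ V, Conn T v (lab v)) (hV : V ⊆ Finset.range n)
    {j : ℕ} (hj : j < (reps T V).card) : (componentTree hF hlab hc j).coe.IsTree := by
  classical
  refine ⟨?_, ?_⟩
  · obtain ⟨c, hcR, hcj⟩ := exists_rank hj
    have hcV : c ∈ V := Finset.mem_of_mem_filter c hcR
    have hcn := Finset.mem_range.mp (hV hcV)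
    have hcl : lab c = c := rep_unique hF.symm (hlab c hcV) hcR ((hc c hcV).symm hF.symm)
    have hcj' : rank T V lab c = j := by rw [rank, hcl, hcj]
    rw [SimpleGraph.connected_iff_exists_forall_reachable]
    refine ⟨⟨⟨c, hcn⟩, hcV, hcj'⟩, ?_⟩
    rintro ⟨v, hvV, hvj⟩
    have hcv : Conn T c v := (rank_eq_iff hF.symm hlab hc hcV hvV).mp (hcj'.trans hvj.symm)
    have key : ∀ y, Conn T c y → ∀ hy : y < n,
        ∀ hy' : (⟨y, hy⟩ : Fin n) ∈ (componentTree hF hlab hc j).verts,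
        (componentTree hF hlab hc j).coe.Reachable ⟨⟨c, hcn⟩, hcV, hcj'⟩ ⟨⟨y, hy⟩, hy'⟩ := by
      intro y h
      induction h with
      | refl => exact fun _ _ => .refl _
      | @tail y z hcy hyz ih =>
        intro hz hz'
        have hyV := hF.left _ _ hyz
        have hyj : rank T V lab y = j :=
          ((rank_eq_iff hF.symm hlab hc hcV hyV).mpr hcy).symm.trans hcj'
        exact (ih (Finset.mem_range.mp (hV hyV)) ⟨hyV, hyj⟩).trans
          (SimpleGraph.Adj.reachable ⟨hyz, hyj⟩)
    exact key v hcv v.2 ⟨hvV, hvj⟩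
  · rw [SimpleGraph.isAcyclic_iff_forall_adj_isBridge]
    rintro ⟨u, hu⟩ ⟨v, hv⟩ huv
    rw [SimpleGraph.isBridge_iff]
    intro h
    refine hF.acy u v huv.1 ?_
    rw [SimpleGraph.reachable_iff_reflTransGen] at h
    refine Relation.ReflTransGen.lift (p := delE T u v)
      (fun x : (componentTree hF hlab hc j).verts => ((x : Fin n) : ℕ)) ?_ _ _ h
    rintro ⟨a, ha⟩ ⟨b, hb⟩ hab
    rw [SimpleGraph.deleteEdges_adj] at hab
    refine ⟨hab.1.1, fun h => hab.2 ?_, fun h => hab.2 ?_⟩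
    · obtain rfl := Fin.ext h.1
      obtain rfl := Fin.ext h.2
      rfl
    · obtain rfl := Fin.ext h.1
      obtain rfl := Fin.ext h.2
      exact Sym2.eq_swap

/-- The decomposition that consists of the set `B` and the components of the forest `T` on `V`. -/
noncomputable def forestDecomposition (B : Finset ℕ) (hF : ForestInv (graphRel G) V N D T)
    (hlab : ∀ v ∈ V, lab v ∈ reps T V) (hc : ∀ v ∈ V, Conn T v (lab v))
    (hV : V ⊆ Finset.range n) : Decomposition G where
  U := Finset.univ.filter fun v : Fin n => (v : ℕ) ∈ B
  k := (reps T V).card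
  tree := fun j => componentTree hF hlab hc j
  isTree := fun j => isTree_componentTree hF hlab hc hV j.2
  disjoint := by
    intro i j hij
    rw [Set.disjoint_left]
    rintro v ⟨-, hi⟩ ⟨-, hj⟩
    exact hij (Fin.ext (hi.symm.trans hj))

variable {hF : ForestInv (graphRel G) V N D T} {hlab : ∀ v ∈ V, lab v ∈ reps T V}
  {hc : ∀ v ∈ V, Conn T v (lab v)} {hV : V ⊆ Finset.range n}

theorem neighborSet_card_le (hN : n ≤ N) (j v) :
    (((forestDecomposition B hF hlab hc hV).tree j).neighborSet v).ncard ≤ D := by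
  classical
  refine le_trans ?_ (hF.deg_le v)
  rw [deg, ← Set.ncard_coe_finset]
  refine Set.ncard_le_ncard_of_injOn (fun u : Fin n => (u : ℕ)) ?_ (fun a _ b _ h => Fin.ext h)
    (Finset.finite_toSet _)
  rintro u ⟨hu, -⟩
  rw [Finset.mem_coe, Finset.mem_filter, Finset.mem_range]
  exact ⟨u.2.trans_le hN, hu⟩

theorem maxDegree_forestDecomposition_le (hN : n ≤ N) :
    (forestDecomposition B hF hlab hc hV).maxDegree ≤ D :=
  Finset.sup_le fun j _ => Finset.sup_le fun v _ => neighborSet_card_le hN j v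

/-- The trivial bound, for the case that `f * log n` is large compared with `n`. -/
theorem maxDegree_le (E : Decomposition G) : E.maxDegree ≤ n - 1 := by
  refine Finset.sup_le fun j _ => Finset.sup_le fun v _ => ?_
  have h : ((E.tree j).neighborSet v).ncard ≤ ((Finset.univ.erase v : Finset (Fin n)) :
      Set (Fin n)).ncard := by
    refine Set.ncard_le_ncard (fun u hu => ?_) (Finset.finite_toSet _)
    have : G.Adj v u := (E.tree j).adj_sub hu
    simp [this.ne']
  rw [Set.ncard_coe_finset, Finset.card_erase_of_mem (Finset.mem_univ v), Finset.card_univ,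
    Fintype.card_fin] at h
  exact h

/-- Every path in `G[X]` respects the decomposition. -/
theorem respects_forestDecomposition {f : ℕ} {X : Finset ℕ} (hK : Keeps (graphRel G) U n f X)
    (hXB : ∀ x ∈ X, x ∈ B ∨ x ∈ V)
    (hconn : ∀ x ∈ X, ∀ y ∈ X, graphRel G x y → x ∉ B → y ∉ B → Conn T x y)
    {a b : Fin n} (ha : (a : ℕ) ∈ U) (hb : (b : ℕ) ∈ U) {F : Finset (Fin n)} (hcard : F.card ≤ f) :
    (forestDecomposition B hF hlab hc hV).Respects a b F := by
  rintro ⟨p, hp⟩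
  have hmem : ∀ v : Fin n, (v : ℕ) ∈ F.map Fin.valEmbedding ↔ v ∈ F := by
    intro v
    simp only [Finset.mem_map, Fin.valEmbedding_apply]
    exact ⟨fun ⟨w, hw, h⟩ => Fin.ext h ▸ hw, fun h => ⟨v, h, rfl⟩⟩
  have h1 : Conn (Res (graphRel G) fun v => v ∉ F.map Fin.valEmbedding) a b :=
    conn_of_walk p fun v hv => by rw [hmem]; exact hp v hv
  have haF : a ∉ F := hp a p.start_mem_support
  obtain ⟨b', hb', q, hq⟩ := walk_of_conn ⟨hK.terms ha, by rwa [hmem]⟩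
    (hK.conn (F.map Fin.valEmbedding) (by rwa [Finset.card_map]) a ha b hb h1)
  obtain rfl := Fin.ext hb'
  refine ⟨q, fun v hv => by have := (hq v hv).2; rwa [hmem] at this, fun x y w hw hwU => ?_⟩
  have hwX : ∀ v ∈ w.support, (v : ℕ) ∈ X ∧ (v : ℕ) ∉ B := fun v hv =>
    ⟨(hq v (hw.support_subset hv)).1, fun hB => hwU v hv (Finset.mem_filter.mpr
      ⟨Finset.mem_univ v, hB⟩)⟩
  have hT : ∀ {x y : Fin n} (w : G.Walk x y), (∀ v ∈ w.support, (v : ℕ) ∈ X ∧ (v : ℕ) ∉ B) →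
      ∀ v ∈ w.support, Conn T x v := by
    intro x y w
    induction w with
    | nil =>
      intro _ v hv
      rw [SimpleGraph.Walk.support_nil, List.mem_singleton] at hv
      rw [hv]
    | cons hadj w ih =>
      intro h v hv
      simp only [SimpleGraph.Walk.support_cons, List.mem_cons, forall_eq_or_imp] at h hv
      rcases hv with rfl | hv
      · exact .refl
      · have h2 := h.2 _ w.start_mem_support
        exact (hconn _ h.1.1 _ h2.1 (graphRel_val.mpr hadj) h.1.2 h2.2).trans (ih h.2 v hv)
  have hwV : ∀ v ∈ w.support, (v : ℕ) ∈ V := fun v hv =>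
    (hXB v (hwX v hv).1).resolve_left (hwX v hv).2
  have hxV := hwV x w.start_mem_support
  refine ⟨⟨rank T V lab x, rank_lt (hlab x hxV)⟩, fun v hv => ⟨hwV v hv, ?_⟩⟩
  exact ((rank_eq_iff hF.symm hlab hc hxV (hwV v hv)).mpr (hT w hwX v hv)).symm

end

theorem Decomposition.near_subset {V : Type*} {G : SimpleGraph V} (D : Decomposition G) (s : V)
    (F : Finset V) {u : V} (hu : u ∈ D.near s F) : u ∈ D.U := by
  rcases hu with ⟨j, -, h, -⟩ | ⟨h, -, rfl⟩ <;> exact h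

/-! ### The algorithm -/

/-- The whole computation on arrays. -/
def mainC : Cmd := .seq initC (.seq (roundC.rep 1) outputC)

/-- The number of components in the output. -/
def partsT : Tm := .count 20 (.vec 27 (.var 20))

/-- The algorithm. -/
def algorithm : Program := .seq (.assign 3 (.add (.reg 0) (.const 2)))
  (.seq (mainC.comp 0) (.seq (partsT.comp 0) (.assign 2 (.reg (sreg 0)))))

open Polynomial in
/-- A bound on the running time of the algorithm. -/
noncomputable def algorithmCost : ℕ[X] := (mainC.cost + partsT.cost + 20).comp (X + 2)

theorem residueBound_spec (n f L : ℕ) : n + 1 ≤ residueBound (n + 2) f L ∨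
    2 * (3 * f * L + 1) ^ 2 ≤ residueBound (n + 2) f L := by
  unfold residueBound
  split_ifs
  · exact Or.inr le_rfl
  · exact Or.inl (by omega)

/-- The command computes the parts of a decomposition, if its input is a graph on `{0, …, n - 1}`
and a subset of its vertices. -/
theorem mainC_spec {p : Fin 4 → ℕ} {m : Mem} {ρ : ℕ → ℕ} {n f : ℕ} (hn : p 0 = n) (hf : p 1 = f)
    (hN : p 3 = n + 2) {G : ℕ → ℕ → Prop} (hG : rel m (p 3) 0 = G) (hGs : Symm G)
    (hGn : ∀ a b, G a b → a < n) {U : Finset ℕ}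
    (hU : (Finset.range (p 3)).filter (fun v => m 1 0 v ≠ 0) = U) (hUn : U ⊆ Finset.range n) :
    ∃ L B V T lab, n < 2 ^ L ∧ (L = 0 ∨ 2 ^ (L - 1) ≤ n) ∧
      Sol G U n f (baseLevel (n + 2) (residueBound (n + 2) f L) + L) B V T ∧
      Output (n + 2) (mainC.exec p ρ m) B V T lab ∧
      partsT.ev p (mainC.exec p ρ m) ρ = (reps T V).card := by
  obtain ⟨L, hL, hL', hE, hX⟩ := initC_spec (ρ := ρ) hn hN hf hG hU
  obtain ⟨m₁, hm₁⟩ : ∃ m₁, m₁ = initC.exec p ρ m := ⟨_, rfl⟩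
  obtain ⟨m₂, hm₂⟩ : ∃ m₂, m₂ = (roundC.rep 1).exec p ρ m₁ := ⟨_, rfl⟩
  have hexec : mainC.exec p ρ m = outputC.exec p ρ m₂ := by rw [hm₂, hm₁]; rfl
  rw [← hm₁] at hE hX
  have hkeeps : Keeps G U n f (col m₁ (p 3) 5) := by
    rw [hX]
    refine ⟨subset_rfl, hUn, fun F _ a _ b _ h => h.mono fun x y hxy => ?_⟩
    exact ⟨hxy.1, ⟨Finset.mem_range.mpr (hGn _ _ hxy.1), hxy.2.1⟩,
      ⟨Finset.mem_range.mpr (hGn _ _ (hGs _ _ hxy.1)), hxy.2.2⟩⟩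
  have hL2 : 2 ^ L ≤ 2 * p 3 := by
    rcases hL' with rfl | h
    · rw [pow_zero]; omega
    · have : 2 ^ L ≤ 2 * 2 ^ (L - 1) := by
        rw [← pow_succ']
        exact Nat.pow_le_pow_right (by norm_num) (by omega)
      omega
  have hLN : L < p 3 := by
    rcases hL' with rfl | h
    · omega
    · have := Nat.lt_two_pow_self (n := L - 1)
      omega
  have hsol := rounds_spec (ρ := ρ) hN hGs hE hkeeps hL hL2
    (by rw [hN]; exact residueBound_spec n f L) hLN rfl
  rw [← hm₂] at hsol
  have hF := hsol.forest
  obtain ⟨⟨lab, hout⟩, hk⟩ := outputC_spec (ρ := ρ) (p := p) (m := m₂) (by omega) rfl rfl rfl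
    hF.symm hF.left
  rw [hN] at hsol hout
  refine ⟨L, _, _, _, lab, hL, hL', hsol, ?_, ?_⟩
  · rw [hexec]; exact hout
  · rw [hexec, ← hN]; exact hk

section

variable {n : ℕ} {G : SimpleGraph (Fin n)}

theorem rel_inputStore (f : ℕ) (D : Decomposition G) :
    rel (fun a => (inputStore f G D).arr (loc a)) (n + 2) 0 = graphRel G := by
  funext a b
  have h : (inputStore f G D).arr (loc 0) a b ≠ 0 ↔ graphRel G a b := by
    simp [inputStore, loc, graphRel]
  rw [rel, h, eq_iff_iff]
  refine ⟨fun h => h.2.2, fun h => ⟨?_, ?_, h⟩⟩ <;>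
  · obtain ⟨u, v, rfl, rfl, -⟩ := h
    omega

theorem row_inputStore (f : ℕ) (D : Decomposition G) :
    (Finset.range (n + 2)).filter (fun v => (inputStore f G D).arr (loc 1) 0 v ≠ 0) =
      D.U.map Fin.valEmbedding := by
  ext a
  have h : (inputStore f G D).arr (loc 1) 0 a ≠ 0 ↔ ∃ v : Fin n, (v : ℕ) = a ∧ v ∈ D.U := by
    simp [inputStore, loc]
  rw [Finset.mem_filter, h, Finset.mem_map, Finset.mem_range]
  constructor
  · rintro ⟨-, v, rfl, hv⟩
    exact ⟨v, hv, rfl⟩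
  · rintro ⟨v, hv, rfl⟩
    exact ⟨by simp only [Fin.valEmbedding_apply]; omega, v, rfl, hv⟩

/-- The algorithm halts in polynomial time with a decomposition `(B, Λ)` such that `2|B| ≤ |U|` and
all triplets `⟨a, b, F⟩` with `a, b ∈ U` and `|F| ≤ f` respect it. -/
theorem algorithm_spec (f : ℕ) (D : Decomposition G) :
    ∃ (τ : Store) (t L : ℕ) (E : Decomposition G), Runs algorithm (inputStore f G D) τ t ∧
      t ≤ algorithmCost.eval n ∧ Holds τ E ∧ n < 2 ^ L ∧ (L = 0 ∨ 2 ^ (L - 1) ≤ n) ∧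
      2 * E.U.card ≤ D.U.card ∧
      E.maxDegree ≤ baseLevel (n + 2) (residueBound (n + 2) f L) + L ∧
      ∀ a ∈ D.U, ∀ b ∈ D.U, ∀ F : Finset (Fin n), F.card ≤ f → E.Respects a b F := by
  set p : Fin 4 → ℕ := fun x => if x = 0 then n else if x = 1 then f else if x = 2 then D.k
    else n + 2 with hp
  have hp3 : p 3 = n + 2 := by simp [hp]
  set m : Mem := fun a => (inputStore f G D).arr (loc a) with hm
  set ρ : ℕ → ℕ := fun _ => 0
  obtain ⟨L, B, V, T, lab, hL, hL', hsol, hout, hk⟩ := mainC_spec (p := p) (m := m) (ρ := ρ)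
    (f := f) (G := graphRel G) (U := D.U.map Fin.valEmbedding) (n := n) (by simp [hp])
    (by simp [hp]) hp3 (by rw [hp3]; exact rel_inputStore f D) symm_graphRel
    (by rintro a b ⟨u, v, rfl, rfl, -⟩; exact u.2) (by rw [hp3]; exact row_inputStore f D) (by
      intro a ha
      obtain ⟨v, -, rfl⟩ := Finset.mem_map.mp ha
      exact Finset.mem_range.mpr v.2)
  obtain ⟨X, hK, -, hVX, hXB, hconn⟩ := hsol.exists_keeps
  have hVn : V ⊆ Finset.range n := hVX.trans hK.sub
  set E := forestDecomposition B hsol.forest hout.lab_mem hout.conn hVn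
  have hR : (reps T V).card ≤ n := by
    classical
    exact (Finset.card_filter_le _ _).trans ((Finset.card_le_card hVn).trans (by simp))
  obtain ⟨τ, t, hrun, ht, h1, h2, h3, h4⟩ : Halts algorithm (inputStore f G D)
      (algorithmCost.eval n) fun τ => τ.reg 2 = (reps T V).card ∧
        τ.arr 1 = mainC.exec p ρ m 1 ∧ τ.arr 2 = mainC.exec p ρ m 2 ∧
        τ.arr 3 = mainC.exec p ρ m 3 := by
    have hcost : algorithmCost.eval n = mainC.cost.eval (p 3) + partsT.cost.eval (p 3) + 20 := by
      rw [algorithmCost, Polynomial.eval_comp, hp3]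
      simp
    rw [hcost]
    refine Halts.seq (b₁ := 4) (b₂ := mainC.cost.eval (p 3) + partsT.cost.eval (p 3) + 4)
      (Q := Repr p ρ m) (Halts.assign ⟨?_, ?_, ?_⟩ (by simp [Expr.cost])) (fun σ hσ => ?_)
      (by omega)
    · intro x
      fin_cases x <;> simp [Store.setReg, Expr.eval, inputStore, hp]
    · intro k
      simp only [Store.setReg, inputStore, vreg, ρ]
      split_ifs <;> omega
    · intro a
      rfl
    refine Halts.seq (mainC.comp_halts 0 ρ m σ hσ) (b₂ := partsT.cost.eval (p 3) + 3)
      (fun σ' hσ' => ?_) (by omega)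
    refine Halts.seq (partsT.comp_halts 0 ρ σ' hσ'.1) (b₂ := 2) (fun σ'' hσ'' => ?_) (by omega)
    refine Halts.assign ⟨?_, ?_, ?_, ?_⟩ (by simp [Expr.cost])
    · simp only [Store.setReg, Expr.eval, if_true]
      exact hσ''.2.2.1.trans hk
    · exact hσ''.1.arr 1
    · exact hσ''.1.arr 2
    · exact hσ''.1.arr 3
  refine ⟨τ, t, L, E, hrun, ht, ⟨h1, fun v => ?_, fun j v => ?_, fun u v => ?_⟩, hL, hL', ?_,
    maxDegree_forestDecomposition_le (by omega), fun a ha b hb F hF => ?_⟩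
  · rw [h2, hout.set v (by omega)]
    congr 1
    simp [E, forestDecomposition]
  · have hj : (j : ℕ) < n := j.2.trans_le hR
    rw [h3, hout.parts j (by omega) v (by omega)]
    congr 1
  · rw [h4, hout.trees u (by omega) v (by omega)]
    congr 1
    refine propext ⟨fun h => ?_, ?_⟩
    · exact ⟨⟨rank T V lab u, rank_lt (hout.lab_mem u (hsol.forest.left _ _ h))⟩, h, rfl⟩
    · rintro ⟨j, h, -⟩
      exact h
  · have h5 : E.U.card ≤ B.card := Finset.card_le_card_of_injOn (fun v : Fin n => (v : ℕ))
      (fun v hv => (Finset.mem_filter.mp hv).2) (fun a _ b _ h => Fin.ext h)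
    have h6 := hsol.half
    rw [Finset.card_map] at h6
    omega
  · exact respects_forestDecomposition hK hXB hconn (Finset.mem_map.mpr ⟨a, ha, rfl⟩)
      (Finset.mem_map.mpr ⟨b, hb, rfl⟩) hF

end

/-! ### The degree bound -/

/-- The degrees are `O(t ^ 8)` for `t = 3 * f * L + 1 < n + 2`, as `M = 2 * t ^ 2` and the first
level is about `2 * M ^ 4`. For larger `t` the trivial bound suffices. -/
theorem degree_le_pow {n f L Δ : ℕ} (h : Δ ≤ baseLevel (n + 2) (residueBound (n + 2) f L) + L)
    (h' : Δ ≤ n - 1) (hf : 1 ≤ f) : Δ ≤ (2 * (3 * f * L + 1)) ^ 12 := by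
  set t := 3 * f * L + 1 with ht
  have ht1 : 1 ≤ t := by omega
  have hLt : L ≤ t := by nlinarith
  by_cases hc : t < n + 2
  · have hM : residueBound (n + 2) f L = 2 * t ^ 2 := by rw [residueBound, if_pos hc]
    have hcard : ((Finset.range (n + 2)).filter fun q => q ≤ 2 * t ^ 2).card ≤ 3 * t ^ 2 := by
      have h1 : ((Finset.range (n + 2)).filter fun q => q ≤ 2 * t ^ 2) ⊆
          Finset.range (2 * t ^ 2 + 1) := fun q hq => by
        have := (Finset.mem_filter.mp hq).2
        exact Finset.mem_range.mpr (by omega)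
      have h2 := Finset.card_le_card h1
      rw [Finset.card_range] at h2
      have : 1 ≤ t ^ 2 := Nat.one_le_pow _ _ ht1
      omega
    rw [hM, baseLevel] at h
    have h4 := Nat.pow_le_pow_left hcard 4
    have h8 : t ≤ t ^ 12 := Nat.le_self_pow (by norm_num) t
    have h9 : t ^ 8 ≤ t ^ 12 := Nat.pow_le_pow_right ht1 (by norm_num)
    have h10 : (3 * t ^ 2) ^ 4 = 81 * t ^ 8 := by ring
    have h11 : (2 * t) ^ 12 = 4096 * t ^ 12 := by ring
    omega
  · have : 2 * t ≤ (2 * t) ^ 12 := Nat.le_self_pow (by norm_num) _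
    omega

/-- The passage to the natural logarithm. As `log 2 > 2 / 3`, the bound `2 ^ (L - 1) ≤ n` with `n ≥
2` gives `L ≤ 3 * log n` and `1 ≤ 2 * log n`, and `2 * (3 * 3 + 2) = 22`. -/
theorem pow_le_log_pow {n f L : ℕ} (hn : 2 ≤ n) (hf : 1 ≤ f) (hL : L = 0 ∨ 2 ^ (L - 1) ≤ n) :
    (2 * (3 * f * L + 1) : ℝ) ≤ 22 * (f * Real.log n) := by
  have hn' : (2 : ℝ) ≤ n := by exact_mod_cast hn
  have hf' : (1 : ℝ) ≤ f := by exact_mod_cast hf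
  have h2 := Real.log_two_gt_d9
  have hlog : Real.log 2 ≤ Real.log n := Real.log_le_log (by norm_num) hn'
  have hL' : (L : ℝ) * Real.log 2 ≤ 2 * Real.log n := by
    rcases hL with rfl | hL
    · simp; linarith
    · have h1 : ((2 : ℝ) ^ (L - 1)) ≤ n := by exact_mod_cast hL
      have h3 := Real.log_le_log (by positivity) h1
      rw [Real.log_pow] at h3
      have h4 : (L : ℝ) ≤ ((L - 1 : ℕ) : ℝ) + 1 := by
        have : L ≤ (L - 1) + 1 := by omega
        exact_mod_cast this
      nlinarith
  have h3 : (L : ℝ) ≤ 3 * Real.log n := by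
    have : (0 : ℝ) ≤ L := by positivity
    nlinarith
  have h4 : (f : ℝ) * L ≤ f * (3 * Real.log n) := by gcongr
  have h5 : Real.log n ≤ f * Real.log n := by nlinarith
  nlinarith

end FTDecomp

theorem mainTheorem4 :
    ∃ (P : FTDecomp.Program) (p : Polynomial ℕ) (C : ℝ), 0 < C ∧
      ∀ (n f : ℕ), 1 ≤ f →
      ∀ (G : SimpleGraph (Fin n)) (D : FTDecomp.Decomposition G),
      ∃ (τ : FTDecomp.Store) (T : ℕ) (E : FTDecomp.Decomposition G),
        FTDecomp.Runs P (FTDecomp.inputStore f G D) τ T ∧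
        T ≤ p.eval n ∧
        FTDecomp.Holds τ E ∧
        (∀ Q : Set (Fin n × Fin n × Finset (Fin n)), D.IsRD f Q →
          ∃ Q' : Set (Fin n × Fin n × Finset (Fin n)), E.IsRD f Q' ∧
            ∀ s t F, (s, t, F) ∈ Q → ¬ D.Captured s t F →
              ∀ a ∈ D.near s F, ∀ b ∈ D.near t F, (a, b, F) ∈ Q') ∧
        (E.U.card : ℝ) ≤ (D.U.card : ℝ) / 2 ∧
        (E.maxDegree : ℝ) ≤ (D.maxDegree : ℝ) + (C * (f * Real.log n)) ^ 12 := by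
  refine ⟨FTDecomp.algorithm, FTDecomp.algorithmCost, 22, by norm_num, fun n f hf G D => ?_⟩
  obtain ⟨τ, t, L, E, hrun, ht, hE, -, hL, hU, hdeg, hresp⟩ := FTDecomp.algorithm_spec f D
  refine ⟨τ, t, E, hrun, ht, hE, fun Q hQ => ?_, ?_, ?_⟩
  · -- The new decomposition respects all triplets with both ends in `U`.
    refine ⟨{q | q.1 ∈ D.U ∧ q.2.1 ∈ D.U ∧ q.2.2.card ≤ f},
      fun a b F h => ⟨h.2.2, hresp a h.1 b h.2.1 F h.2.2⟩, ?_⟩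
    intro s t F hst _ a ha b hb
    exact ⟨D.near_subset s F ha, D.near_subset t F hb, (hQ s t F hst).1⟩
  · have : (2 * E.U.card : ℝ) ≤ D.U.card := by exact_mod_cast hU
    linarith
  · have h1 := FTDecomp.maxDegree_le E
    have h2 : (E.maxDegree : ℝ) ≤ (22 * (f * Real.log n)) ^ 12 := by
      by_cases hn : 2 ≤ n
      · have h3 := FTDecomp.degree_le_pow hdeg h1 hf
        calc (E.maxDegree : ℝ) ≤ (((2 * (3 * f * L + 1)) ^ 12 : ℕ) : ℝ) := by exact_mod_cast h3
          _ = (2 * (3 * f * L + 1) : ℝ) ^ 12 := by push_cast; ring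
          _ ≤ (22 * (f * Real.log n)) ^ 12 :=
            pow_le_pow_left₀ (by positivity) (FTDecomp.pow_le_log_pow hn hf hL) 12
      · have h3 : E.maxDegree = 0 := by omega
        rw [h3, Nat.cast_zero]
        exact (show Even 12 by decide).pow_nonneg _
    have h3 : (0 : ℝ) ≤ D.maxDegree := Nat.cast_nonneg _
    linarith
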